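/- **Theorem (Convergence to fluid limits).** *Model.* Prices lie in $[0,1]$ and are partitioned into consecutive bins; $[x]\in\{1,\dots,N\}$ is the (nondecreasing) index of the bin containing the price $x$. Orders arrive as a Poisson process of rate $2$ with i.i.d. labels, independent of the arrival times: an order is a bid or an ask with probability $1/2$ each, with price distribution $\mu_b$, respectively $\mu_a$, on $[0,1]$. Let $p_b(k)$, $p_a(k)$ be the probabilities that an arriving bid, respectively ask, falls into bin $k$. A bid at $x$ and an ask at $y$ are compatible if $[y]\le[x]$. An arriving order is matched with the lowest queued ask (if it is a bid), respectively the highest queued bid (if it is an ask), and both depart, provided the two are compatible; otherwise it joins the book. Initially there is no compatible bid–ask pair and orders sit at finitely many prices; infinitely many orders at one price are allowed. Let $B_k(t),A_k(t)$ be the numbers of bids and asks that arrived into bin $k$ up to time $t$, $Q_b(k,t),Q_a(k,t)$ the numbers of bids and asks queued in bin $k$, $[\beta_t]$ the bin of the highest bid ($0$ if there are no bids), $[\alpha_t]$ the bin of the lowest ask ($N+1$ if there are no asks), and $T_\beta(k,t)=\int_0^t\mathbf 1\{[\beta_s]=k\}\,ds$, $T_\alpha(k,t)=\int_0^t\mathbf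 1\{[\alpha_s]=k\}\,ds$. Fluid scaling is $\overline X_n(t)=n^{-1}X(nt)$. Fix bins $0\le lo<hi\le N+1$. Consider a sequence of such books, driven by the same arrivals, such that for all large $n$ the $n$-th initial state has infinitely many bids in bin $lo$ (no condition if $lo=0$), infinitely many asks in bin $hi$ (no condition if $hi=N+1$), and bounded scaled queues in between: $\overline Q_{b,n}(k,0),\overline Q_{a,n}(k,0)\le 1$ for $lo<k<hi$. (For $lo=0$, $hi=N+1$ these are finite books.) *Claim 1.* Almost surely, for all $lo,hi$ and all such sequences simultaneously: every subsequence of $$(\overline B_n(k,\cdot),\overline A_n(k,\cdot))_{1\le k\le N},\quad(\overline Q_{b,n}(k,\cdot),\overline Q_{a,n}(k,\cdot))_{lo<k<hi},\quad(\overline T_{\beta,n}(k,\cdot))_{lo\le k<hi},\quad(\overline T_{\alpha,n}(k,\cdot))_{lo<k\le hi}$$ has a further subsequence that converges, uniformly on compact subsets of $[0,\infty)$, to Lipschitz functions $b_k,a_k,q_b(k,\cdot),q_a(k,\cdot),\tau_\beta(k,\cdot),\tau_\alpha(k,\cdot)$. Every subsequential limit (a *fluid limit*) is differentiable at almost every $t>0$,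 and satisfies the following for the indicated $k$; equations that contain derivatives hold at every $t>0$ at which the derivatives exist, the others at every $t\ge0$. 1. $b_k'(t)=p_b(k)$, $a_k'(t)=p_a(k)$ for $1\le k\le N$. 2. $\tau_\beta'(k,t)=0$ if $\sum_{k<k'<hi}q_b(k',t)>0$ ($lo\le k<hi$); $\tau_\alpha'(k,t)=0$ if $\sum_{lo<k'<k}q_a(k',t)>0$ ($lo<k\le hi$). 3. $\sum_{lo\le k<hi}\tau_\beta(k,t)=t$, $\ \sum_{lo<k\le hi}\tau_\alpha(k,t)=t$. 4. $q_b(k,t)\ge0$, $q_a(k,t)\ge0$ for $lo<k<hi$. 5. $q_b'(k,t)=0$ if $q_b(k,t)=0$; $q_a'(k,t)=0$ if $q_a(k,t)=0$ ($lo<k<hi$). 6. For $lo<k<hi$, $$q_b'(k,t)=p_b(k)\sum_{k<k'\le hi}\tau_\alpha'(k',t)-\tau_\beta'(k,t)\sum_{1\le k'\le k}p_a(k'),$$ $$q_a'(k,t)=p_a(k)\sum_{lo\le k'<k}\tau_\beta'(k',t)-\tau_\alpha'(k,t)\sum_{k\le k'\le N}p_b(k').$$ The derivatives in 1 and 2 always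 exist, and those of $q_b$, $q_a$ in 6 exist whenever the derivatives on the right-hand side do. *Claim 2 (thresholds).* Suppose $p_b(k),p_a(k)>0$ for all $1\le k\le N$. For a book with a finite initial state, let $\kappa_b$ be the supremum of the prices $x$ such that almost surely only finitely many bids at prices $\le x$ depart from the book ($0$ if there are none), and $\kappa_a$ the infimum of the prices $x$ such that almost surely only finitely many asks at prices $\ge x$ depart ($1$ if there are none). Then almost surely, every fluid limit of finite books ($lo=0$, $hi=N+1$) with $q_b(\cdot,0)=q_a(\cdot,0)=0$ satisfies, for all $t\ge0$, $$\sum_{k=[\kappa_b]-1}^{[\kappa_a]}\tau_\beta(k,t)=t,\qquad\sum_{k=[\kappa_b]}^{[\kappa_a]+1}\tau_\alpha(k,t)=t.$$ -/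

import Mathlib

open MeasureTheory ProbabilityTheory Filter Topology

noncomputable section

namespace LOB

/-- An order: `Sum.inl p` is a bid at price `p`, `Sum.inr q` is an ask at price `q`.
Prices lie in `[0,1]`. -/
abbrev Order : Type := unitInterval ⊕ unitInterval

/-- A partition of the price axis into (at most) `N` consecutive pricing bins; `idx x` is the
index in `{1, …, N}` of the bin containing the price `x`. -/
structure Binning (N : ℕ) where
  idx : unitInterval → ℕ
  mono : Monotone idx
  one_le : ∀ x, 1 ≤ idx x
  le_top : ∀ x, idx x ≤ N

/-- A state of the book: the counting measures of queued bids and queued asks.  Orders sit at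
finitely many prices; infinitely many orders at one price are allowed. -/
structure Book where
  bids : unitInterval →₀ ℕ∞
  asks : unitInterval →₀ ℕ∞

namespace Book

/-- Price of the highest queued bid (only meaningful if there is one). -/
def highestBid (s : Book) : unitInterval := s.bids.support.sup id

/-- Price of the lowest queued ask (only meaningful if there is one). -/
def lowestAsk (s : Book) : unitInterval := s.asks.support.inf id

variable {N : ℕ}

/-- Bin of the highest bid; `0` if there are no bids. -/
def bidBin (b : Binning N) (s : Book) : ℕ :=
  if s.bids.support = ∅ then 0 else b.idx s.highestBid

/-- Bin of the lowest ask; `N + 1` if there are no asks. -/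
def askBin (b : Binning N) (s : Book) : ℕ :=
  if s.asks.support = ∅ then N + 1 else b.idx s.lowestAsk

/-- Number of bids in bin `k`. -/
def bidQueue (b : Binning N) (s : Book) (k : ℕ) : ℕ∞ :=
  ∑ x ∈ s.bids.support with b.idx x = k, s.bids x

/-- Number of asks in bin `k`. -/
def askQueue (b : Binning N) (s : Book) (k : ℕ) : ℕ∞ :=
  ∑ x ∈ s.asks.support with b.idx x = k, s.asks x

/-- No compatible bid-ask pair: a bid at `x` and an ask at `y` are compatible if the bin of `y`
is at most the bin of `x`. -/
def Admissible (b : Binning N) (s : Book) : Prop :=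
  ∀ x ∈ s.bids.support, ∀ y ∈ s.asks.support, b.idx x < b.idx y

/-- Finitely many orders in total. -/
def IsFinite (s : Book) : Prop :=
  (∀ x, s.bids x ≠ ⊤) ∧ ∀ x, s.asks x ≠ ⊤

/-- Change at an order arrival.  An arriving bid is matched with the lowest ask, which departs,
if there is a compatible ask; otherwise it joins the book.  Symmetrically for an arriving ask. -/
def step (b : Binning N) (s : Book) : Order → Book
  | Sum.inl p =>
      if s.askBin b ≤ b.idx p then ⟨s.bids, s.asks - Finsupp.single s.lowestAsk 1⟩
      else ⟨s.bids + Finsupp.single p 1, s.asks⟩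
  | Sum.inr q =>
      if b.idx q ≤ s.bidBin b then ⟨s.bids - Finsupp.single s.highestBid 1, s.asks⟩
      else ⟨s.bids, s.asks + Finsupp.single q 1⟩

/-- The arrival of order `o` makes a queued bid of price at most `x` depart. -/
def BidDeparts (b : Binning N) (s : Book) (o : Order) (x : unitInterval) : Prop :=
  ∃ q, o = Sum.inr q ∧ b.idx q ≤ s.bidBin b ∧ s.highestBid ≤ x

/-- The arrival of order `o` makes a queued ask of price at least `x` depart. -/
def AskDeparts (b : Binning N) (s : Book) (o : Order) (x : unitInterval) : Prop :=
  ∃ p, o = Sum.inl p ∧ s.askBin b ≤ b.idx p ∧ x ≤ s.lowestAsk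

end Book

variable {N : ℕ}

/-- The book after the first `j` orders `o 0, …, o (j - 1)`, started from `s`. -/
def bookAfter (b : Binning N) (s : Book) (o : ℕ → Order) : ℕ → Book
  | 0 => s
  | j + 1 => (bookAfter b s o j).step b (o j)

/-- Arrival time of order `j`, when `gap` is the sequence of interarrival times. -/
def arrivalTime (gap : ℕ → ℝ) (j : ℕ) : ℝ := ∑ i ∈ Finset.range (j + 1), gap i

/-- Number of orders that have arrived up to time `t`. -/
def arrivals (gap : ℕ → ℝ) (t : ℝ) : ℕ := {j | arrivalTime gap j ≤ t}.ncard

/-- The book at time `t`. -/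
def bookAt (b : Binning N) (s : Book) (gap : ℕ → ℝ) (o : ℕ → Order) (t : ℝ) : Book :=
  bookAfter b s o (arrivals gap t)

/-- Law of the label of an order: a bid or an ask with probability `1/2` each, with price
distribution `μb`, respectively `μa`. -/
def labelLaw (μb μa : Measure unitInterval) : Measure Order :=
  (2⁻¹ : ENNReal) • μb.map Sum.inl + (2⁻¹ : ENNReal) • μa.map Sum.inr

/-- Orders arrive as a Poisson process of rate `2` (i.i.d. exponential interarrival times) with
i.i.d. labels independent of the arrival times; so bids and asks each have total rate `1`. -/
structure IsOrderFlow {Ω : Type*} [MeasurableSpace Ω] (P : Measure Ω)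
    (μb μa : Measure unitInterval) (gap : ℕ → Ω → ℝ) (label : ℕ → Ω → Order) : Prop where
  measurable_gap : ∀ j, Measurable (gap j)
  measurable_label : ∀ j, Measurable (label j)
  indep : iIndepFun (fun j ω => (gap j ω, label j ω)) P
  law : ∀ j, P.map (fun ω => (gap j ω, label j ω)) = (expMeasure 2).prod (labelLaw μb μa)

/-- Probability that an arriving order with price distribution `μ` falls into bin `k`. -/
def binProb (b : Binning N) (μ : Measure unitInterval) (k : ℕ) : ℝ := μ.real {x | b.idx x = k}

/-- Threshold for bids: supremum of the prices `x` such that almost surely only finitely many bids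
of price at most `x` depart (`0` if there are none), for the book started from `s`. -/
def kappaB {Ω : Type*} [MeasurableSpace Ω] (P : Measure Ω) (b : Binning N)
    (label : ℕ → Ω → Order) (s : Book) : unitInterval :=
  sSup {x | ∀ᵐ ω ∂P, {j | (bookAfter b s (fun i => label i ω) j).BidDeparts b
    (label j ω) x}.Finite}

/-- Threshold for asks: infimum of the prices `x` such that almost surely only finitely many asks
of price at least `x` depart (`1` if there are none), for the book started from `s`. -/
def kappaA {Ω : Type*} [MeasurableSpace Ω] (P : Measure Ω) (b : Binning N)
    (label : ℕ → Ω → Order) (s : Book) : unitInterval :=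
  sInf {x | ∀ᵐ ω ∂P, {j | (bookAfter b s (fun i => label i ω) j).AskDeparts b
    (label j ω) x}.Finite}

/-- A 6-tuple of families of functions of time, indexed by bins: arrivals of bids and asks, queues
of bids and asks, local times of the highest bid and of the lowest ask. -/
structure Path where
  B : ℕ → ℝ → ℝ
  A : ℕ → ℝ → ℝ
  Qb : ℕ → ℝ → ℝ
  Qa : ℕ → ℝ → ℝ
  Tβ : ℕ → ℝ → ℝ
  Tα : ℕ → ℝ → ℝ

/-- The six processes of the binned book started from `s`. -/
def lobPath (b : Binning N) (s : Book) (gap : ℕ → ℝ) (o : ℕ → Order) : Path where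
  B k t := ({j | arrivalTime gap j ≤ t ∧ ∃ p, o j = Sum.inl p ∧ b.idx p = k}.ncard : ℝ)
  A k t := ({j | arrivalTime gap j ≤ t ∧ ∃ q, o j = Sum.inr q ∧ b.idx q = k}.ncard : ℝ)
  Qb k t := (((bookAt b s gap o t).bidQueue b k).toNat : ℝ)
  Qa k t := (((bookAt b s gap o t).askQueue b k).toNat : ℝ)
  Tβ k t := ∫ u in (0 : ℝ)..t, if (bookAt b s gap o u).bidBin b = k then 1 else 0
  Tα k t := ∫ u in (0 : ℝ)..t, if (bookAt b s gap o u).askBin b = k then 1 else 0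

/-- Fluid scaling `X ↦ n⁻¹ X (n ·)`. -/
def Path.scale (X : Path) (n : ℕ) : Path where
  B k t := (n : ℝ)⁻¹ * X.B k (n * t)
  A k t := (n : ℝ)⁻¹ * X.A k (n * t)
  Qb k t := (n : ℝ)⁻¹ * X.Qb k (n * t)
  Qa k t := (n : ℝ)⁻¹ * X.Qa k (n * t)
  Tβ k t := (n : ℝ)⁻¹ * X.Tβ k (n * t)
  Tα k t := (n : ℝ)⁻¹ * X.Tα k (n * t)

/-- Initial states for the `n`-th system.  There is no compatible bid-ask pair; there are
infinitely many bids in bin `lo` (no condition if `lo = 0`) and infinitely many asks in bin `hi`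
(no condition if `hi = N + 1`); and the queues in the bins strictly between `lo` and `hi`, divided
by `n`, have maximum norm at most `1`.  For `lo = 0`, `hi = N + 1` the book is finite. -/
structure InitialState (b : Binning N) (lo hi n : ℕ) (s : Book) : Prop where
  admissible : s.Admissible b
  bids_lo : lo = 0 ∨ s.bidQueue b lo = ⊤
  asks_hi : hi = N + 1 ∨ s.askQueue b hi = ⊤
  bids_le : ∀ k ∈ Finset.Ioo lo hi, s.bidQueue b k ≤ n
  asks_le : ∀ k ∈ Finset.Ioo lo hi, s.askQueue b k ≤ n

/-- Convergence of a sequence of functions, uniformly on compact subsets of `[0,∞)`. -/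
def UOC (f : ℕ → ℝ → ℝ) (g : ℝ → ℝ) : Prop :=
  ∀ T : ℝ, TendstoUniformlyOn f g atTop (Set.Icc 0 T)

/-- Uniform convergence on compacts of all six families: arrivals in all bins `1, …, N`, queues in
the bins strictly between `lo` and `hi`, local times in the bins that the highest bid
(`lo ≤ k < hi`) and the lowest ask (`lo < k ≤ hi`) can occupy. -/
structure PathUOC (N lo hi : ℕ) (X : ℕ → Path) (F : Path) : Prop where
  B : ∀ k ∈ Finset.Icc 1 N, UOC (fun n => (X n).B k) (F.B k)
  A : ∀ k ∈ Finset.Icc 1 N, UOC (fun n => (X n).A k) (F.A k)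
  Qb : ∀ k ∈ Finset.Ioo lo hi, UOC (fun n => (X n).Qb k) (F.Qb k)
  Qa : ∀ k ∈ Finset.Ioo lo hi, UOC (fun n => (X n).Qa k) (F.Qa k)
  Tβ : ∀ k ∈ Finset.Ico lo hi, UOC (fun n => (X n).Tβ k) (F.Tβ k)
  Tα : ∀ k ∈ Finset.Ioc lo hi, UOC (fun n => (X n).Tα k) (F.Tα k)

/-- Lipschitz continuity on `[0,∞)`. -/
def LipOn (f : ℝ → ℝ) : Prop := ∃ K, LipschitzOnWith K f (Set.Ici 0)

/-- All six families consist of Lipschitz functions on `[0,∞)`. -/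
structure PathLipschitz (N lo hi : ℕ) (F : Path) : Prop where
  B : ∀ k ∈ Finset.Icc 1 N, LipOn (F.B k)
  A : ∀ k ∈ Finset.Icc 1 N, LipOn (F.A k)
  Qb : ∀ k ∈ Finset.Ioo lo hi, LipOn (F.Qb k)
  Qa : ∀ k ∈ Finset.Ioo lo hi, LipOn (F.Qa k)
  Tβ : ∀ k ∈ Finset.Ico lo hi, LipOn (F.Tβ k)
  Tα : ∀ k ∈ Finset.Ioc lo hi, LipOn (F.Tα k)

/-- All the derivatives that occur in the fluid equations exist at `t`. -/
structure PathDifferentiableAt (N lo hi : ℕ) (F : Path) (t : ℝ) : Prop where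
  B : ∀ k ∈ Finset.Icc 1 N, DifferentiableAt ℝ (F.B k) t
  A : ∀ k ∈ Finset.Icc 1 N, DifferentiableAt ℝ (F.A k) t
  Qb : ∀ k ∈ Finset.Ioo lo hi, DifferentiableAt ℝ (F.Qb k) t
  Qa : ∀ k ∈ Finset.Ioo lo hi, DifferentiableAt ℝ (F.Qa k) t
  Tβ : ∀ k ∈ Finset.Ico lo hi, DifferentiableAt ℝ (F.Tβ k) t
  Tα : ∀ k ∈ Finset.Ioc lo hi, DifferentiableAt ℝ (F.Tα k) t

/-- The system of equations and inequalities for fluid limits; `pb k`, `pa k` are the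
probabilities that an arriving bid, respectively ask, falls into bin `k`. -/
structure FluidEquations (N lo hi : ℕ) (pb pa : ℕ → ℝ) (F : Path) : Prop where
  /-- Almost everywhere, all derivatives are defined. -/
  ae_differentiable : ∀ᵐ t ∂(volume.restrict (Set.Ioi (0 : ℝ))), PathDifferentiableAt N lo hi F t
  deriv_B : ∀ k ∈ Finset.Icc 1 N, ∀ t > 0, HasDerivAt (F.B k) (pb k) t
  deriv_A : ∀ k ∈ Finset.Icc 1 N, ∀ t > 0, HasDerivAt (F.A k) (pa k) t
  deriv_Tβ : ∀ k ∈ Finset.Ico lo hi, ∀ t > 0, 0 < ∑ k' ∈ Finset.Ioo k hi, F.Qb k' t →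
    HasDerivAt (F.Tβ k) 0 t
  deriv_Tα : ∀ k ∈ Finset.Ioc lo hi, ∀ t > 0, 0 < ∑ k' ∈ Finset.Ioo lo k, F.Qa k' t →
    HasDerivAt (F.Tα k) 0 t
  sum_Tβ : ∀ t ≥ 0, ∑ k ∈ Finset.Ico lo hi, F.Tβ k t = t
  sum_Tα : ∀ t ≥ 0, ∑ k ∈ Finset.Ioc lo hi, F.Tα k t = t
  nonneg_Qb : ∀ k ∈ Finset.Ioo lo hi, ∀ t ≥ 0, 0 ≤ F.Qb k t
  nonneg_Qa : ∀ k ∈ Finset.Ioo lo hi, ∀ t ≥ 0, 0 ≤ F.Qa k t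
  deriv_Qb_zero : ∀ k ∈ Finset.Ioo lo hi, ∀ t > 0, F.Qb k t = 0 →
    ∀ d, HasDerivAt (F.Qb k) d t → d = 0
  deriv_Qa_zero : ∀ k ∈ Finset.Ioo lo hi, ∀ t > 0, F.Qa k t = 0 →
    ∀ d, HasDerivAt (F.Qa k) d t → d = 0
  deriv_Qb : ∀ k ∈ Finset.Ioo lo hi, ∀ t > 0,
    (∀ k' ∈ Finset.Ioc k hi, DifferentiableAt ℝ (F.Tα k') t) → DifferentiableAt ℝ (F.Tβ k) t →
    HasDerivAt (F.Qb k)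
      (pb k * ∑ k' ∈ Finset.Ioc k hi, deriv (F.Tα k') t
        - deriv (F.Tβ k) t * ∑ k' ∈ Finset.Icc 1 k, pa k') t
  deriv_Qa : ∀ k ∈ Finset.Ioo lo hi, ∀ t > 0,
    (∀ k' ∈ Finset.Ico lo k, DifferentiableAt ℝ (F.Tβ k') t) → DifferentiableAt ℝ (F.Tα k) t →
    HasDerivAt (F.Qa k)
      (pa k * ∑ k' ∈ Finset.Ico lo k, deriv (F.Tβ k') t
        - deriv (F.Tα k) t * ∑ k' ∈ Finset.Icc k N, pb k') t

end LOB

end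

/-! Inside a window `(lo, hi)` the best prices depend only on the integer vector of net queues, and
this vector evolves as a deterministic chain driven by the bins of the arriving orders
(`Regular.net_step`). The infinite supplies in `lo` and `hi`, or the conventions for an empty side,
close the system. For fixed initial net queues, the state met by order `j` is a function of the
earlier orders, and it lasts exactly for the interarrival time `gap j`, which has mean `1/2`. Hence,
summed over visits of a best price to a bin, (indicator of a class of orders) minus (rate times `gap
j`) is a predictable sum of centred terms with exponential moments. A Chernoff bound makes a
deviation of size `ε n` exponentially unlikely. Only polynomially many initial vectors have entries
bounded by `n`, so a union bound and Borel–Cantelli give a law of large numbers that holds for all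
initial states at once (`ae_unifLaw`). This is what allows one null set for all sequences of books.

The rest of the first claim is deterministic. The exact flow balance of each queue, with counts
replaced by rate times local time, holds up to `ε` after scaling (`Sample.balance_Qb`,
`Sample.balance_Qa`). Scaled local times are 1-Lipschitz, so a diagonal argument makes them converge
along a subsequence, and the balance carries the queues along (`System.exists_isFluidLimit`). In the
limit the balance becomes the integrated form of equation 6. A positive limiting queue is positive
in the approximations on a whole neighbourhood, which keeps the best prices away from certain bins
and freezes their local times; a queue that vanishes at an interior time has a minimum there.

For the thresholds, the chain is monotone and conserves the total difference of two ordered states,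
hence never spreads two states apart beyond their initial `ℓ¹` distance (`abs_netChain_sub_le`). So
a fluid limit started empty has the queues of a fluid limit of one fixed finite book
(`IsFluidLimit.queues_eq`). If `M` lies below the bin of `κ_b`, some `x` admits only finitely many
departures of bids at prices up to `x`, while a positive mass of bin `M` lies below `x`. Bids
joining there accumulate, so the queue in `M` can vanish only if the lowest ask has spent no time
above `M`; the balance equations exclude that (`IsFluidLimit.Qb_pos`). Positive bid queues just
below `κ_b` and, symmetrically, positive ask queues just above `κ_a` confine both best prices
(`IsFluidLimit.sum_localTimes`). -/

namespace LOB

noncomputable section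

section

/-! ### The chain of net queues

Inside a window `(lo, hi)` of bins the book is described by the net queues `ν k` (bids minus asks in
bin `k`).  An arriving bid in bin `p` increases `ν` by one in the bin `min p a`, where `a` is the bin
of the lowest ask; an arriving ask in bin `q` decreases it by one in the bin `max q β`. -/

section NetChain

variable {lo hi : ℕ}

/-- Lowest bin of the window with negative net queue; `hi` if there is none. -/
def netAsk (lo hi : ℕ) (ν : ℕ → ℤ) : ℕ :=
  (insert hi {k ∈ Finset.Ioo lo hi | ν k < 0}).min' (Finset.insert_nonempty _ _)

/-- Highest bin of the window with positive net queue; `lo` if there is none. -/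
def netBid (lo hi : ℕ) (ν : ℕ → ℤ) : ℕ :=
  (insert lo {k ∈ Finset.Ioo lo hi | 0 < ν k}).max' (Finset.insert_nonempty _ _)

/-- Change of the net queues at an arrival: `Sum.inl p` is a bid in bin `p`, `Sum.inr q` an ask in
bin `q`. -/
def netStep (lo hi : ℕ) (ν : ℕ → ℤ) : ℕ ⊕ ℕ → ℕ → ℤ
  | Sum.inl p => ν + Pi.single (min p (netAsk lo hi ν)) 1
  | Sum.inr q => ν - Pi.single (max q (netBid lo hi ν)) 1

/-- The net queues after the first `j` arrivals. -/
def netChain (lo hi : ℕ) (ν : ℕ → ℤ) (c : ℕ → ℕ ⊕ ℕ) : ℕ → ℕ → ℤ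
  | 0 => ν
  | j + 1 => netStep lo hi (netChain lo hi ν c j) (c j)

lemma netAsk_le (ν : ℕ → ℤ) : netAsk lo hi ν ≤ hi :=
  Finset.min'_le _ _ (Finset.mem_insert_self _ _)

lemma netAsk_mem (ν : ℕ → ℤ) :
    netAsk lo hi ν = hi ∨ netAsk lo hi ν ∈ Finset.Ioo lo hi ∧ ν (netAsk lo hi ν) < 0 := by
  have h := Finset.min'_mem (insert hi {k ∈ Finset.Ioo lo hi | ν k < 0})
    (Finset.insert_nonempty _ _)
  rw [Finset.mem_insert, Finset.mem_filter] at h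
  exact h

lemma lt_netAsk (h : lo < hi) (ν : ℕ → ℤ) : lo < netAsk lo hi ν := by
  rcases netAsk_mem (lo := lo) (hi := hi) ν with h' | h'
  · rwa [h']
  · exact (Finset.mem_Ioo.1 h'.1).1

lemma netAsk_le_of_neg {ν : ℕ → ℤ} {k : ℕ} (hk : k ∈ Finset.Ioo lo hi) (h : ν k < 0) :
    netAsk lo hi ν ≤ k :=
  Finset.min'_le _ _ (Finset.mem_insert_of_mem (Finset.mem_filter.2 ⟨hk, h⟩))

lemma netAsk_eq {ν : ℕ → ℤ} {a : ℕ} (h1 : lo < a) (h2 : a ≤ hi) (h3 : a < hi → ν a < 0)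
    (h4 : ∀ k ∈ Finset.Ioo lo hi, ν k < 0 → a ≤ k) : netAsk lo hi ν = a := by
  apply le_antisymm
  · rcases h2.eq_or_lt with h | h
    · exact h ▸ netAsk_le ν
    · exact netAsk_le_of_neg (Finset.mem_Ioo.2 ⟨h1, h⟩) (h3 h)
  · rcases netAsk_mem (lo := lo) (hi := hi) ν with h' | h'
    · rwa [h']
    · exact h4 _ h'.1 h'.2

lemma le_netBid (ν : ℕ → ℤ) : lo ≤ netBid lo hi ν :=
  Finset.le_max' _ _ (Finset.mem_insert_self _ _)

lemma netBid_mem (ν : ℕ → ℤ) :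
    netBid lo hi ν = lo ∨ netBid lo hi ν ∈ Finset.Ioo lo hi ∧ 0 < ν (netBid lo hi ν) := by
  have h := Finset.max'_mem (insert lo {k ∈ Finset.Ioo lo hi | 0 < ν k})
    (Finset.insert_nonempty _ _)
  rw [Finset.mem_insert, Finset.mem_filter] at h
  exact h

lemma netBid_lt (h : lo < hi) (ν : ℕ → ℤ) : netBid lo hi ν < hi := by
  rcases netBid_mem (lo := lo) (hi := hi) ν with h' | h'
  · rwa [h']
  · exact (Finset.mem_Ioo.1 h'.1).2

lemma le_netBid_of_pos {ν : ℕ → ℤ} {k : ℕ} (hk : k ∈ Finset.Ioo lo hi) (h : 0 < ν k) :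
    k ≤ netBid lo hi ν :=
  Finset.le_max' _ _ (Finset.mem_insert_of_mem (Finset.mem_filter.2 ⟨hk, h⟩))

lemma netBid_eq {ν : ℕ → ℤ} {a : ℕ} (h1 : lo ≤ a) (h2 : a < hi) (h3 : lo < a → 0 < ν a)
    (h4 : ∀ k ∈ Finset.Ioo lo hi, 0 < ν k → k ≤ a) : netBid lo hi ν = a := by
  apply le_antisymm
  · rcases netBid_mem (lo := lo) (hi := hi) ν with h' | h'
    · rwa [h']
    · exact h4 _ h'.1 h'.2
  · rcases h1.eq_or_lt with h | h
    · exact h ▸ le_netBid ν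
    · exact le_netBid_of_pos (Finset.mem_Ioo.2 ⟨h, h2⟩) (h3 h)

lemma netAsk_congr {ν μ : ℕ → ℤ} (h : ∀ k ∈ Finset.Ioo lo hi, ν k = μ k) :
    netAsk lo hi ν = netAsk lo hi μ := by
  have : {k ∈ Finset.Ioo lo hi | ν k < 0} = {k ∈ Finset.Ioo lo hi | μ k < 0} :=
    Finset.filter_congr fun k hk => by rw [h k hk]
  simp only [netAsk, this]

lemma netBid_congr {ν μ : ℕ → ℤ} (h : ∀ k ∈ Finset.Ioo lo hi, ν k = μ k) :
    netBid lo hi ν = netBid lo hi μ := by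
  have : {k ∈ Finset.Ioo lo hi | 0 < ν k} = {k ∈ Finset.Ioo lo hi | 0 < μ k} :=
    Finset.filter_congr fun k hk => by rw [h k hk]
  simp only [netBid, this]

lemma netStep_congr {ν μ : ℕ → ℤ} (h : ∀ k ∈ Finset.Ioo lo hi, ν k = μ k) (c : ℕ ⊕ ℕ) :
    ∀ k ∈ Finset.Ioo lo hi, netStep lo hi ν c k = netStep lo hi μ c k := by
  intro k hk
  rcases c with p | q
  · simp [netStep, netAsk_congr h, h k hk]
  · simp [netStep, netBid_congr h, h k hk]

/-- The entries outside the window are mere counters and never influence the dynamics, so only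
finitely many initial coordinates matter in the union bound. -/
lemma netChain_congr {ν μ : ℕ → ℤ} (h : ∀ k ∈ Finset.Ioo lo hi, ν k = μ k) (c : ℕ → ℕ ⊕ ℕ)
    (j : ℕ) : ∀ k ∈ Finset.Ioo lo hi, netChain lo hi ν c j k = netChain lo hi μ c j k := by
  induction j with
  | zero => exact h
  | succ j ih => exact netStep_congr ih (c j)

/-- Non-anticipation: this is what makes visits to a bin predictable. -/
lemma netChain_congr_code {c d : ℕ → ℕ ⊕ ℕ} (ν : ℕ → ℤ) (j : ℕ) (h : ∀ i < j, c i = d i) :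
    netChain lo hi ν c j = netChain lo hi ν d j := by
  induction j with
  | zero => rfl
  | succ j ih =>
    simp only [netChain]
    rw [ih fun i hi => h i (by omega), h j (by omega)]

lemma netAsk_mono {ν μ : ℕ → ℤ} (h : ν ≤ μ) : netAsk lo hi ν ≤ netAsk lo hi μ := by
  rcases netAsk_mem (lo := lo) (hi := hi) μ with h' | h'
  · rw [h']; exact netAsk_le ν
  · exact netAsk_le_of_neg h'.1 ((h _).trans_lt h'.2)

lemma netBid_mono {ν μ : ℕ → ℤ} (h : ν ≤ μ) : netBid lo hi ν ≤ netBid lo hi μ := by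
  rcases netBid_mem (lo := lo) (hi := hi) ν with h' | h'
  · rw [h']; exact le_netBid μ
  · exact le_netBid_of_pos h'.1 (h'.2.trans_le (h _))

/-- The order is endangered only where the smaller state receives a bid's unit that the larger one
does not. Then that bin is the lowest ask of the smaller state but lies below the lowest ask of the
larger one, so the entries are negative and nonnegative there and leave room for the unit. For asks
the roles are exchanged. -/
lemma netStep_mono (hlh : lo < hi) {ν μ : ℕ → ℤ} (h : ν ≤ μ) (c : ℕ ⊕ ℕ) :
    netStep lo hi ν c ≤ netStep lo hi μ c := by
  intro k
  have hk : ν k ≤ μ k := h k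
  rcases c with p | q
  · have ha := netAsk_mono (lo := lo) (hi := hi) h
    simp only [netStep, Pi.add_apply, Pi.single_apply]
    split_ifs with h1 h2 h2
    · omega
    · have h3 : k = netAsk lo hi ν := by omega
      have h4 : k < netAsk lo hi μ := by omega
      have h5 : k ∈ Finset.Ioo lo hi :=
        Finset.mem_Ioo.2 ⟨h3 ▸ lt_netAsk hlh ν, h4.trans_le (netAsk_le μ)⟩
      have h6 : 0 ≤ μ k := by
        by_contra h6
        exact absurd (netAsk_le_of_neg h5 (not_le.1 h6)) (by omega)
      have h7 : ν k < 0 := by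
        rcases netAsk_mem (lo := lo) (hi := hi) ν with h' | h'
        · rw [← h3] at h'; exact absurd (Finset.mem_Ioo.1 h5).2 (by omega)
        · rw [← h3] at h'; exact h'.2
      omega
    · omega
    · omega
  · have ha := netBid_mono (lo := lo) (hi := hi) h
    simp only [netStep, Pi.sub_apply, Pi.single_apply]
    split_ifs with h1 h2 h2
    · omega
    · omega
    · have h3 : k = netBid lo hi μ := by omega
      have h4 : netBid lo hi ν < k := by omega
      have h5 : k ∈ Finset.Ioo lo hi :=
        Finset.mem_Ioo.2 ⟨(le_netBid ν).trans_lt h4, h3 ▸ netBid_lt hlh μ⟩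
      have h6 : ν k ≤ 0 := by
        by_contra h6
        exact absurd (le_netBid_of_pos h5 (not_le.1 h6)) (by omega)
      have h7 : 0 < μ k := by
        rcases netBid_mem (lo := lo) (hi := hi) μ with h' | h'
        · rw [← h3] at h'; exact absurd (Finset.mem_Ioo.1 h5).1 (by omega)
        · rw [← h3] at h'; exact h'.2
      omega
    · omega

lemma netChain_mono (hlh : lo < hi) {ν μ : ℕ → ℤ} (h : ν ≤ μ) (c : ℕ → ℕ ⊕ ℕ) (j : ℕ) :
    netChain lo hi ν c j ≤ netChain lo hi μ c j := by
  induction j with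
  | zero => exact h
  | succ j ih => exact netStep_mono hlh ih (c j)

/-- Each arrival changes the total by exactly one, in a direction that does not depend on the state.
This needs the range to include the boundary bins, where trades with the outside supply are booked.
-/
lemma sum_netStep_sub {M : ℕ} (hlh : lo < hi) (hM : hi < M) (ν μ : ℕ → ℤ) (c : ℕ ⊕ ℕ)
    (hc : ∀ q, c = Sum.inr q → q < M) :
    ∑ k ∈ Finset.range M, (netStep lo hi μ c k - netStep lo hi ν c k) =
      ∑ k ∈ Finset.range M, (μ k - ν k) := by
  rcases c with p | q
  · have h1 := netAsk_le (lo := lo) (hi := hi) ν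
    have h2 := netAsk_le (lo := lo) (hi := hi) μ
    simp only [netStep, Pi.add_apply, Finset.sum_sub_distrib, Finset.sum_add_distrib,
      Finset.sum_pi_single', Finset.mem_range]
    rw [if_pos (by omega), if_pos (by omega)]
    ring
  · have h1 := netBid_lt hlh ν
    have h2 := netBid_lt hlh μ
    have h3 := hc q rfl
    simp only [netStep, Pi.sub_apply, Finset.sum_sub_distrib,
      Finset.sum_pi_single', Finset.mem_range]
    rw [if_pos (by omega), if_pos (by omega)]
    ring

lemma sum_netChain_sub {M : ℕ} (hlh : lo < hi) (hM : hi < M) (ν μ : ℕ → ℤ) (c : ℕ → ℕ ⊕ ℕ)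
    (hc : ∀ i q, c i = Sum.inr q → q < M) (j : ℕ) :
    ∑ k ∈ Finset.range M, (netChain lo hi μ c j k - netChain lo hi ν c j k) =
      ∑ k ∈ Finset.range M, (μ k - ν k) := by
  induction j with
  | zero => rfl
  | succ j ih => exact (sum_netStep_sub hlh hM _ _ (c j) (hc j)).trans ih

/-- Two chains driven by the same arrivals stay as close as they were initially. -/
lemma abs_netChain_sub_le {M : ℕ} (hlh : lo < hi) (hM : hi < M) (ν μ : ℕ → ℤ) (c : ℕ → ℕ ⊕ ℕ)
    (hc : ∀ i q, c i = Sum.inr q → q < M) (j : ℕ) {k : ℕ} (hk : k < M) :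
    |netChain lo hi μ c j k - netChain lo hi ν c j k| ≤
      ∑ i ∈ Finset.range M, |μ i - ν i| := by
  -- Both chains are compared with the one started from the pointwise maximum. The differences stay
  -- nonnegative with conserved sum, so each of them is at most the initial sum.
  have key : ∀ ρ : ℕ → ℤ, ρ ≤ ν ⊔ μ → netChain lo hi ρ c j k ≤ netChain lo hi (ν ⊔ μ) c j k ∧
      netChain lo hi (ν ⊔ μ) c j k - netChain lo hi ρ c j k ≤
        ∑ i ∈ Finset.range M, ((ν ⊔ μ) i - ρ i) := by
    intro ρ hρ
    have h1 := netChain_mono hlh hρ c j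
    refine ⟨h1 k, ?_⟩
    rw [← sum_netChain_sub hlh hM ρ (ν ⊔ μ) c hc j]
    exact Finset.single_le_sum (f := fun k => netChain lo hi (ν ⊔ μ) c j k - netChain lo hi ρ c j k)
      (fun i _ => sub_nonneg.2 (h1 i)) (Finset.mem_range.2 hk)
  obtain ⟨h1, h2⟩ := key ν le_sup_left
  obtain ⟨h3, h4⟩ := key μ le_sup_right
  have h5 : ∑ i ∈ Finset.range M, |μ i - ν i| =
      ∑ i ∈ Finset.range M, ((ν ⊔ μ) i - ν i) + ∑ i ∈ Finset.range M, ((ν ⊔ μ) i - μ i) := by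
    rw [← Finset.sum_add_distrib]
    refine Finset.sum_congr rfl fun i _ => ?_
    simp only [Pi.sup_apply]
    rcases le_total (ν i) (μ i) with h | h
    · rw [sup_eq_right.2 h, abs_of_nonneg (sub_nonneg.2 h)]; ring
    · rw [sup_eq_left.2 h, abs_of_nonpos (sub_nonpos.2 h)]; ring
  rw [h5, abs_le]
  constructor <;> linarith

end NetChain

end

section

/-! ### Counting orders in a book -/

section Count

open scoped Classical in
/-- Number of orders with a price in `S`. -/
def cnt (f : unitInterval →₀ ℕ∞) (S : Set unitInterval) : ℕ∞ :=
  f.sum fun x c => if x ∈ S then c else 0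

lemma cnt_add (f g : unitInterval →₀ ℕ∞) (S : Set unitInterval) :
    cnt (f + g) S = cnt f S + cnt g S := by
  classical
  refine Finsupp.sum_add_index' (fun x => by simp) fun x c d => ?_
  split_ifs <;> simp

lemma cnt_single (x : unitInterval) (S : Set unitInterval) [Decidable (x ∈ S)] :
    cnt (Finsupp.single x 1) S = if x ∈ S then 1 else 0 := by
  rw [cnt, Finsupp.sum_single_index (by simp)]
  by_cases hx : x ∈ S <;> simp [hx]

lemma cnt_mono (f : unitInterval →₀ ℕ∞) {S S' : Set unitInterval} (h : S ⊆ S') :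
    cnt f S ≤ cnt f S' := by
  classical
  refine Finset.sum_le_sum fun x _ => ?_
  by_cases hx : x ∈ S
  · simp [hx, h hx]
  · simp [hx]

lemma cnt_ne_zero_iff (f : unitInterval →₀ ℕ∞) (S : Set unitInterval) :
    cnt f S ≠ 0 ↔ ∃ x ∈ f.support, x ∈ S := by
  classical
  rw [cnt, Finsupp.sum, Ne, Finset.sum_eq_zero_iff]
  push Not
  refine exists_congr fun x => and_congr_right fun hx => ?_
  simp [Finsupp.mem_support_iff.1 hx]

/-- Subtraction is moved to the other side so that the identity also holds for infinite counts. -/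
lemma cnt_sub_single (f : unitInterval →₀ ℕ∞) {x : unitInterval} (hx : x ∈ f.support)
    (S : Set unitInterval) [Decidable (x ∈ S)] :
    cnt (f - Finsupp.single x 1) S + (if x ∈ S then 1 else 0) = cnt f S := by
  rw [← cnt_single, ← cnt_add]
  congr 1
  ext y
  by_cases hxy : x = y
  · subst hxy
    have : (1 : ℕ∞) ≤ f x := Order.one_le_iff_pos.2 (pos_iff_ne_zero.2 (Finsupp.mem_support_iff.1 hx))
    simp [tsub_add_cancel_of_le this]
  · simp [Finsupp.single_eq_of_ne' hxy]

lemma support_sub_single_subset (f : unitInterval →₀ ℕ∞) (x : unitInterval) :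
    (f - Finsupp.single x 1).support ⊆ f.support := by
  intro y hy
  rw [Finsupp.mem_support_iff] at hy ⊢
  intro h
  simp [h] at hy

end Count

/-! ### Best prices and queues under a single arrival. -/

namespace Book

variable {N : ℕ} (b : Binning N) (s : Book)

lemma bidQueue_eq_cnt (k : ℕ) : s.bidQueue b k = cnt s.bids {x | b.idx x = k} := by
  classical
  rw [bidQueue, Finset.sum_filter]
  refine Finset.sum_congr rfl fun x _ => ?_
  by_cases hx : b.idx x = k <;> simp [hx]

lemma askQueue_eq_cnt (k : ℕ) : s.askQueue b k = cnt s.asks {x | b.idx x = k} := by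
  classical
  rw [askQueue, Finset.sum_filter]
  refine Finset.sum_congr rfl fun x _ => ?_
  by_cases hx : b.idx x = k <;> simp [hx]

lemma highestBid_mem (h : s.bids.support.Nonempty) : s.highestBid ∈ s.bids.support := by
  obtain ⟨x, hx, hx'⟩ := s.bids.support.exists_mem_eq_sup h id
  rw [highestBid, hx']; exact hx

lemma lowestAsk_mem (h : s.asks.support.Nonempty) : s.lowestAsk ∈ s.asks.support := by
  obtain ⟨x, hx, hx'⟩ := s.asks.support.exists_mem_eq_inf h id
  rw [lowestAsk, hx']; exact hx

lemma le_highestBid {x : unitInterval} (h : x ∈ s.bids.support) : x ≤ s.highestBid :=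
  Finset.le_sup (f := id) h

lemma lowestAsk_le {x : unitInterval} (h : x ∈ s.asks.support) : s.lowestAsk ≤ x :=
  Finset.inf_le (f := id) h

variable {s}

lemma bidBin_eq (h : s.bids.support.Nonempty) : s.bidBin b = b.idx s.highestBid :=
  if_neg h.ne_empty

lemma askBin_eq (h : s.asks.support.Nonempty) : s.askBin b = b.idx s.lowestAsk :=
  if_neg h.ne_empty

lemma idx_le_bidBin {x : unitInterval} (h : x ∈ s.bids.support) : b.idx x ≤ s.bidBin b := by
  rw [bidBin_eq b ⟨x, h⟩]; exact b.mono (le_highestBid s h)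

lemma askBin_le_idx {x : unitInterval} (h : x ∈ s.asks.support) : s.askBin b ≤ b.idx x := by
  rw [askBin_eq b ⟨x, h⟩]; exact b.mono (lowestAsk_le s h)

lemma bids_nonempty (h : 0 < s.bidBin b) : s.bids.support.Nonempty := by
  rw [Finset.nonempty_iff_ne_empty]
  intro h'
  simp [bidBin, h'] at h

lemma asks_nonempty (h : s.askBin b ≤ N) : s.asks.support.Nonempty := by
  rw [Finset.nonempty_iff_ne_empty]
  intro h'
  simp [askBin, h'] at h

variable (s) in
lemma bidBin_le : s.bidBin b ≤ N := by
  rw [bidBin]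
  split_ifs
  · omega
  · exact b.le_top _

variable (s) in
lemma one_le_askBin : 1 ≤ s.askBin b := by
  rw [askBin]
  split_ifs
  · omega
  · exact b.one_le _

lemma bidQueue_bidBin_ne_zero (h : 0 < s.bidBin b) : s.bidQueue b (s.bidBin b) ≠ 0 := by
  have h' := bids_nonempty b h
  rw [bidQueue_eq_cnt, cnt_ne_zero_iff]
  exact ⟨_, highestBid_mem s h', (bidBin_eq b h').symm⟩

lemma askQueue_askBin_ne_zero (h : s.askBin b ≤ N) : s.askQueue b (s.askBin b) ≠ 0 := by
  have h' := asks_nonempty b h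
  rw [askQueue_eq_cnt, cnt_ne_zero_iff]
  exact ⟨_, lowestAsk_mem s h', (askBin_eq b h').symm⟩

lemma le_bidBin {k : ℕ} (h : s.bidQueue b k ≠ 0) : k ≤ s.bidBin b := by
  rw [bidQueue_eq_cnt, cnt_ne_zero_iff] at h
  obtain ⟨x, hx, rfl⟩ := h
  exact idx_le_bidBin b hx

lemma askBin_le {k : ℕ} (h : s.askQueue b k ≠ 0) : s.askBin b ≤ k := by
  rw [askQueue_eq_cnt, cnt_ne_zero_iff] at h
  obtain ⟨x, hx, rfl⟩ := h
  exact askBin_le_idx b hx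

variable {b}

lemma Admissible.bidBin_lt_askBin (h : s.Admissible b) : s.bidBin b < s.askBin b := by
  rcases s.bids.support.eq_empty_or_nonempty with h1 | h1
  · have := one_le_askBin b s
    rw [bidBin, if_pos h1]; omega
  rcases s.asks.support.eq_empty_or_nonempty with h2 | h2
  · have := bidBin_le b s
    rw [askBin, if_pos h2]; omega
  rw [bidBin_eq b h1, askBin_eq b h2]
  exact h _ (highestBid_mem s h1) _ (lowestAsk_mem s h2)

lemma Admissible.step (h : s.Admissible b) (o : Order) : (s.step b o).Admissible b := by
  rcases o with p | q
  · rw [Book.step]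
    split_ifs with hp
    · exact fun x hx y hy => h x hx y (support_sub_single_subset _ _ hy)
    · intro x hx y hy
      rcases Finset.mem_union.1 (Finsupp.support_add hx) with hx | hx
      · exact h x hx y hy
      · rw [Finset.mem_singleton.1 (Finsupp.support_single_subset hx)]
        have := askBin_le_idx b (s := s) hy
        omega
  · rw [Book.step]
    split_ifs with hq
    · exact fun x hx y hy => h x (support_sub_single_subset _ _ hx) y hy
    · intro x hx y hy
      rcases Finset.mem_union.1 (Finsupp.support_add hy) with hy | hy
      · exact h x hx y hy
      · rw [Finset.mem_singleton.1 (Finsupp.support_single_subset hy)]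
        have := idx_le_bidBin b (s := s) hx
        omega

lemma cnt_bids_step_inl (s : Book) (p : unitInterval) (S : Set unitInterval)
    [Decidable (p ∈ S)] :
    cnt (s.step b (Sum.inl p)).bids S =
      cnt s.bids S + if p ∈ S ∧ b.idx p < s.askBin b then 1 else 0 := by
  rw [Book.step]
  split_ifs with h1 h2 h2
  · omega
  · simp
  · rw [cnt_add, cnt_single, if_pos h2.1]
  · rw [cnt_add, cnt_single, if_neg fun h => h2 ⟨h, not_le.1 h1⟩]

lemma cnt_asks_step_inr (s : Book) (q : unitInterval) (S : Set unitInterval)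
    [Decidable (q ∈ S)] :
    cnt (s.step b (Sum.inr q)).asks S =
      cnt s.asks S + if q ∈ S ∧ s.bidBin b < b.idx q then 1 else 0 := by
  rw [Book.step]
  split_ifs with h1 h2 h2
  · omega
  · simp
  · rw [cnt_add, cnt_single, if_pos h2.1]
  · rw [cnt_add, cnt_single, if_neg fun h => h2 ⟨h, not_le.1 h1⟩]

lemma cnt_bids_step_inr (s : Book) (q : unitInterval) (S : Set unitInterval)
    [Decidable (s.highestBid ∈ S)] :
    cnt (s.step b (Sum.inr q)).bids S +
      (if b.idx q ≤ s.bidBin b ∧ s.highestBid ∈ S then 1 else 0) = cnt s.bids S := by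
  rw [Book.step]
  -- Bins start at `1` and `0` encodes an empty bid side, so a match forces a bid to be present.
  have h0 := b.one_le q
  by_cases h1 : b.idx q ≤ s.bidBin b
  · simp only [h1, if_true, true_and]
    exact cnt_sub_single _ (highestBid_mem s (bids_nonempty b (by omega))) S
  · simp [h1]

lemma cnt_asks_step_inl (s : Book) (p : unitInterval) (S : Set unitInterval)
    [Decidable (s.lowestAsk ∈ S)] :
    cnt (s.step b (Sum.inl p)).asks S +
      (if s.askBin b ≤ b.idx p ∧ s.lowestAsk ∈ S then 1 else 0) = cnt s.asks S := by
  rw [Book.step]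
  have h0 := b.le_top p
  by_cases h1 : s.askBin b ≤ b.idx p
  · simp only [h1, if_true, true_and]
    exact cnt_sub_single _ (lowestAsk_mem s (asks_nonempty b (by omega))) S
  · simp [h1]

variable (b) in
lemma bidQueue_step_inl (s : Book) (p : unitInterval) (k : ℕ) :
    (s.step b (Sum.inl p)).bidQueue b k =
      s.bidQueue b k + if b.idx p = k ∧ k < s.askBin b then 1 else 0 := by
  rw [bidQueue_eq_cnt, bidQueue_eq_cnt, cnt_bids_step_inl]
  refine congrArg _ ?_
  exact if_congr ⟨fun h => ⟨h.1, h.1 ▸ h.2⟩, fun h => ⟨h.1, h.1.symm ▸ h.2⟩⟩ rfl rfl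

variable (b) in
lemma askQueue_step_inr (s : Book) (q : unitInterval) (k : ℕ) :
    (s.step b (Sum.inr q)).askQueue b k =
      s.askQueue b k + if b.idx q = k ∧ s.bidBin b < k then 1 else 0 := by
  rw [askQueue_eq_cnt, askQueue_eq_cnt, cnt_asks_step_inr]
  refine congrArg _ ?_
  exact if_congr ⟨fun h => ⟨h.1, h.1 ▸ h.2⟩, fun h => ⟨h.1, h.1.symm ▸ h.2⟩⟩ rfl rfl

variable (b) in
lemma bidQueue_step_inr (s : Book) (q : unitInterval) (k : ℕ) :
    (s.step b (Sum.inr q)).bidQueue b k + (if b.idx q ≤ k ∧ s.bidBin b = k then 1 else 0) =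
      s.bidQueue b k := by
  rw [bidQueue_eq_cnt, bidQueue_eq_cnt, ← cnt_bids_step_inr s q]
  refine congrArg _ ?_
  refine if_congr ⟨fun h => ⟨h.2.symm ▸ h.1, ?_⟩, fun h => ?_⟩ rfl rfl
  · have := b.one_le q
    exact (bidBin_eq b (bids_nonempty b (by omega))).symm.trans h.2
  · have := b.one_le q
    have h2 : b.idx s.highestBid = k := h.2
    rw [← bidBin_eq b (bids_nonempty b (by omega))] at h2
    exact ⟨h2 ▸ h.1, h2⟩

variable (b) in
lemma askQueue_step_inl (s : Book) (p : unitInterval) (k : ℕ) :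
    (s.step b (Sum.inl p)).askQueue b k + (if k ≤ b.idx p ∧ s.askBin b = k then 1 else 0) =
      s.askQueue b k := by
  rw [askQueue_eq_cnt, askQueue_eq_cnt, ← cnt_asks_step_inl s p]
  refine congrArg _ ?_
  refine if_congr ⟨fun h => ⟨h.2.symm ▸ h.1, ?_⟩, fun h => ?_⟩ rfl rfl
  · have := b.le_top p
    exact (askBin_eq b (asks_nonempty b (by omega))).symm.trans h.2
  · have := b.le_top p
    have h2 : b.idx s.lowestAsk = k := h.2
    rw [← askBin_eq b (asks_nonempty b (by omega))] at h2
    exact ⟨h2 ▸ h.1, h2⟩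

end Book

/-! ### Books in a window -/

variable {N : ℕ}

/-- The book behaves like a finite book in the window `(lo, hi)`: it is admissible, it has infinitely
many bids in `lo` and asks in `hi` (if these are bins), and finite queues in between. -/
structure Regular (b : Binning N) (lo hi : ℕ) (s : Book) : Prop where
  admissible : s.Admissible b
  bids_lo : lo = 0 ∨ s.bidQueue b lo = ⊤
  asks_hi : hi = N + 1 ∨ s.askQueue b hi = ⊤
  bids_ne_top : ∀ k ∈ Finset.Ioo lo hi, s.bidQueue b k ≠ ⊤
  asks_ne_top : ∀ k ∈ Finset.Ioo lo hi, s.askQueue b k ≠ ⊤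

/-- Net queue in bin `k`. -/
def net (b : Binning N) (s : Book) (k : ℕ) : ℤ :=
  ((s.bidQueue b k).toNat : ℤ) - ((s.askQueue b k).toNat : ℤ)

/-- An order, up to the position of its price in the bin. -/
def code (b : Binning N) : Order → ℕ ⊕ ℕ := Sum.map b.idx b.idx

section Code

variable (b : Binning N)

lemma code_inl (p : unitInterval) : code b (Sum.inl p) = Sum.inl (b.idx p) := rfl

lemma code_inr (q : unitInterval) : code b (Sum.inr q) = Sum.inr (b.idx q) := rfl

lemma sum_code_inr (q : unitInterval) (k : ℕ) (P : Prop) [Decidable P] :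
    (∑ i ∈ Finset.Icc 1 k, if code b (Sum.inr q) = Sum.inr i ∧ P then 1 else 0) =
      if b.idx q ≤ k ∧ P then 1 else 0 := by
  have := b.one_le q
  by_cases hP : P <;> simp [hP, code, this]

lemma sum_code_inl (p : unitInterval) (k : ℕ) (P : Prop) [Decidable P] :
    (∑ i ∈ Finset.Icc k N, if code b (Sum.inl p) = Sum.inl i ∧ P then 1 else 0) =
      if k ≤ b.idx p ∧ P then 1 else 0 := by
  have := b.le_top p
  by_cases hP : P <;> simp [hP, code, this]

end Code

/-! ### The window as a closed system driven by bins. -/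

namespace Regular

variable {b : Binning N} {lo hi : ℕ} {s : Book}

lemma lo_le_bidBin (h : Regular b lo hi s) : lo ≤ s.bidBin b := by
  rcases h.bids_lo with h' | h'
  · omega
  · exact Book.le_bidBin b (by simp [h'])

lemma askBin_le_hi (h : Regular b lo hi s) : s.askBin b ≤ hi := by
  rcases h.asks_hi with h' | h'
  · rw [h', Book.askBin]
    split_ifs
    · exact le_rfl
    · exact (b.le_top _).trans (by omega)
  · exact Book.askBin_le b (by simp [h'])

lemma bidBin_lt_hi (h : Regular b lo hi s) : s.bidBin b < hi :=
  h.admissible.bidBin_lt_askBin.trans_le h.askBin_le_hi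

lemma lo_lt_askBin (h : Regular b lo hi s) : lo < s.askBin b :=
  h.lo_le_bidBin.trans_lt h.admissible.bidBin_lt_askBin

/-- By admissibility no ask shares the bin of the highest bid, so the net queue is positive there.
The default value `lo` of `netBid` matches the infinite supply in `lo` and, for `lo = 0`, the
convention for an empty bid side. -/
lemma bidBin_eq_netBid (h : Regular b lo hi s) : s.bidBin b = netBid lo hi (net b s) := by
  symm
  have hlt := h.admissible.bidBin_lt_askBin
  refine netBid_eq h.lo_le_bidBin h.bidBin_lt_hi (fun hlo => ?_) fun k hk hpos => ?_
  · have h1 := Book.bidQueue_bidBin_ne_zero (b := b) (s := s) (by omega)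
    have h2 := h.bids_ne_top _ (Finset.mem_Ioo.2 ⟨hlo, h.bidBin_lt_hi⟩)
    have h3 : s.askQueue b (s.bidBin b) = 0 := by
      by_contra h3
      have := Book.askBin_le b h3
      omega
    have h4 : (s.bidQueue b (s.bidBin b)).toNat ≠ 0 := by
      rw [Ne, ENat.toNat_eq_zero]; tauto
    rw [net, h3]
    simp only [ENat.toNat_zero]
    omega
  · refine Book.le_bidBin b fun h0 => ?_
    rw [net, h0] at hpos
    simp only [ENat.toNat_zero] at hpos
    omega

lemma askBin_eq_netAsk (h : Regular b lo hi s) (hhi : hi ≤ N + 1) :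
    s.askBin b = netAsk lo hi (net b s) := by
  symm
  have hlt := h.admissible.bidBin_lt_askBin
  refine netAsk_eq h.lo_lt_askBin h.askBin_le_hi (fun hlo => ?_) fun k hk hpos => ?_
  · have h1 := Book.askQueue_askBin_ne_zero (b := b) (s := s) (by omega)
    have h2 := h.asks_ne_top _ (Finset.mem_Ioo.2 ⟨h.lo_lt_askBin, hlo⟩)
    have h3 : s.bidQueue b (s.askBin b) = 0 := by
      by_contra h3
      have := Book.le_bidBin b h3
      omega
    have h4 : (s.askQueue b (s.askBin b)).toNat ≠ 0 := by
      rw [Ne, ENat.toNat_eq_zero]; tauto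
    rw [net, h3]
    simp only [ENat.toNat_zero]
    omega
  · refine Book.askBin_le b fun h0 => ?_
    rw [net, h0] at hpos
    simp only [ENat.toNat_zero] at hpos
    omega

lemma step (h : Regular b lo hi s) (o : Order) : Regular b lo hi (s.step b o) := by
  have hb := h.bidBin_lt_hi
  have ha := h.lo_lt_askBin
  rcases o with p | q
  · refine ⟨h.admissible.step _, h.bids_lo.imp_right fun h' => ?_, h.asks_hi.imp_right fun h' => ?_,
      fun k hk => ?_, fun k hk => ?_⟩
    · rw [Book.bidQueue_step_inl, h', top_add]
    · have := Book.askQueue_step_inl b s p hi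
      rw [h', ENat.add_eq_top] at this
      refine this.resolve_right ?_
      split_ifs <;> simp
    · rw [Book.bidQueue_step_inl, Ne, ENat.add_eq_top]
      have := h.bids_ne_top k hk
      split_ifs <;> simpa using this
    · have := h.asks_ne_top k hk
      rw [← Book.askQueue_step_inl b s p k, Ne, ENat.add_eq_top] at this
      tauto
  · refine ⟨h.admissible.step _, h.bids_lo.imp_right fun h' => ?_, h.asks_hi.imp_right fun h' => ?_,
      fun k hk => ?_, fun k hk => ?_⟩
    · have := Book.bidQueue_step_inr b s q lo
      rw [h', ENat.add_eq_top] at this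
      refine this.resolve_right ?_
      split_ifs <;> simp
    · rw [Book.askQueue_step_inr, h', top_add]
    · have := h.bids_ne_top k hk
      rw [← Book.bidQueue_step_inr b s q k, Ne, ENat.add_eq_top] at this
      tauto
    · rw [Book.askQueue_step_inr, Ne, ENat.add_eq_top]
      have := h.asks_ne_top k hk
      split_ifs <;> simpa using this

/-- Departures are split according to the bin of the arriving ask, since each bin has its own
arrival rate. -/
lemma toNat_bidQueue_step (h : Regular b lo hi s) (o : Order) {k : ℕ} (hk : k ∈ Finset.Ioo lo hi) :
    ((s.step b o).bidQueue b k).toNat +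
      (∑ q ∈ Finset.Icc 1 k, if code b o = Sum.inr q ∧ s.bidBin b = k then 1 else 0) =
    (s.bidQueue b k).toNat + if code b o = Sum.inl k ∧ k < s.askBin b then 1 else 0 := by
  have h1 := h.bids_ne_top k hk
  have h2 := (h.step o).bids_ne_top k hk
  rcases o with p | q
  · have := Book.bidQueue_step_inl b s p k
    simp only [code_inl, reduceCtorEq, false_and, if_false, Finset.sum_const_zero,
      Sum.inl.injEq, this]
    rw [ENat.toNat_add h1 (by split_ifs <;> simp)]
    split_ifs <;> simp
  · have := Book.bidQueue_step_inr b s q k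
    rw [← this, ENat.toNat_add h2 (by split_ifs <;> simp), sum_code_inr]
    simp only [code_inr, reduceCtorEq, false_and, if_false]
    split_ifs <;> simp

lemma toNat_askQueue_step (h : Regular b lo hi s) (o : Order) {k : ℕ} (hk : k ∈ Finset.Ioo lo hi) :
    ((s.step b o).askQueue b k).toNat +
      (∑ p ∈ Finset.Icc k N, if code b o = Sum.inl p ∧ s.askBin b = k then 1 else 0) =
    (s.askQueue b k).toNat + if code b o = Sum.inr k ∧ s.bidBin b < k then 1 else 0 := by
  have h1 := h.asks_ne_top k hk
  have h2 := (h.step o).asks_ne_top k hk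
  rcases o with p | q
  · have := Book.askQueue_step_inl b s p k
    rw [← this, ENat.toNat_add h2 (by split_ifs <;> simp), sum_code_inl]
    simp only [code_inl, reduceCtorEq, false_and, if_false]
    split_ifs <;> simp
  · have := Book.askQueue_step_inr b s q k
    simp only [code_inr, reduceCtorEq, false_and, if_false, Finset.sum_const_zero,
      Sum.inr.injEq, this]
    rw [ENat.toNat_add h1 (by split_ifs <;> simp)]
    split_ifs <;> simp

/-- A bid that joins its bin and a bid that removes the lowest ask both raise a net queue by one;
the two cases merge into the bin `min p a`. -/
lemma net_step (h : Regular b lo hi s) (hhi : hi ≤ N + 1) (o : Order) :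
    ∀ k ∈ Finset.Ioo lo hi, net b (s.step b o) k = netStep lo hi (net b s) (code b o) k := by
  intro k hk
  have h1 := h.toNat_bidQueue_step o hk
  have h2 := h.toNat_askQueue_step o hk
  have h3 := h.admissible.bidBin_lt_askBin
  rcases o with p | q
  · rw [sum_code_inl] at h2
    simp only [code_inl, netStep, ← h.askBin_eq_netAsk hhi, Pi.add_apply,
      Pi.single_apply, reduceCtorEq, false_and, if_false, Finset.sum_const_zero,
      Sum.inl.injEq] at h1 h2 ⊢
    rw [net, net]
    split_ifs at h1 h2 ⊢ <;> omega
  · rw [sum_code_inr] at h1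
    simp only [code_inr, netStep, ← h.bidBin_eq_netBid, Pi.sub_apply,
      Pi.single_apply, reduceCtorEq, false_and, if_false, Finset.sum_const_zero,
      Sum.inr.injEq] at h1 h2 ⊢
    rw [net, net]
    split_ifs at h1 h2 ⊢ <;> omega

lemma after (h : Regular b lo hi s) (o : ℕ → Order) (j : ℕ) :
    Regular b lo hi (bookAfter b s o j) := by
  induction j with
  | zero => exact h
  | succ j ih => exact ih.step _

lemma net_bookAfter (h : Regular b lo hi s) (hhi : hi ≤ N + 1) (o : ℕ → Order) (j : ℕ) :
    ∀ k ∈ Finset.Ioo lo hi,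
      net b (LOB.bookAfter b s o j) k = netChain lo hi (net b s) (fun i => code b (o i)) j k := by
  induction j with
  | zero => exact fun k _ => rfl
  | succ j ih =>
    intro k hk
    rw [LOB.bookAfter, (h.after o j).net_step hhi _ k hk]
    exact netStep_congr ih _ k hk

lemma bidBin_bookAfter (h : Regular b lo hi s) (hhi : hi ≤ N + 1) (o : ℕ → Order) (j : ℕ) :
    (LOB.bookAfter b s o j).bidBin b =
      netBid lo hi (netChain lo hi (net b s) (fun i => code b (o i)) j) := by
  rw [(h.after o j).bidBin_eq_netBid, netBid_congr (h.net_bookAfter hhi o j)]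

lemma askBin_bookAfter (h : Regular b lo hi s) (hhi : hi ≤ N + 1) (o : ℕ → Order) (j : ℕ) :
    (LOB.bookAfter b s o j).askBin b =
      netAsk lo hi (netChain lo hi (net b s) (fun i => code b (o i)) j) := by
  rw [(h.after o j).askBin_eq_netAsk hhi, netAsk_congr (h.net_bookAfter hhi o j)]

/-- The bid queue is the positive part of the net queue. -/
lemma toNat_bidQueue (h : Regular b lo hi s) {k : ℕ} :
    ((s.bidQueue b k).toNat : ℤ) = max (net b s k) 0 := by
  have h3 := h.admissible.bidBin_lt_askBin
  by_cases h0 : s.bidQueue b k = 0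
  · simp [net, h0]
  · have h1 := Book.le_bidBin b h0
    have h2 : s.askQueue b k = 0 := by
      by_contra h2
      have := Book.askBin_le b h2
      omega
    simp [net, h2]

/-- The ask queue is the negative part of the net queue. -/
lemma toNat_askQueue (h : Regular b lo hi s) {k : ℕ} :
    ((s.askQueue b k).toNat : ℤ) = max (-net b s k) 0 := by
  have h1 := h.toNat_bidQueue (k := k)
  have h2 : net b s k = ((s.bidQueue b k).toNat : ℤ) - ((s.askQueue b k).toNat : ℤ) := rfl
  omega

end Regular

lemma InitialState.regular {b : Binning N} {lo hi n : ℕ} {s : Book} (h : InitialState b lo hi n s) :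
    Regular b lo hi s :=
  ⟨h.admissible, h.bids_lo, h.asks_hi,
    fun k hk => ne_top_of_le_ne_top (ENat.natCast_ne_top n) (h.bids_le k hk),
    fun k hk => ne_top_of_le_ne_top (ENat.natCast_ne_top n) (h.asks_le k hk)⟩

lemma InitialState.abs_net_le {b : Binning N} {lo hi n : ℕ} {s : Book}
    (h : InitialState b lo hi n s) : ∀ k ∈ Finset.Ioo lo hi, |net b s k| ≤ n := by
  intro k hk
  have h1 := ENat.toNat_le_of_le_natCast (h.bids_le k hk)
  have h2 := ENat.toNat_le_of_le_natCast (h.asks_le k hk)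
  rw [net, abs_le]
  constructor <;> omega

end

section

/-! ### Exponential moments of predictable sums -/

section Exponential

variable {Ω α : Type*} [MeasurableSpace Ω] {P : Measure Ω} [MeasurableSpace α] {Z : ℕ → Ω → α}

/-- The σ-algebra generated by `Z 0, …, Z (m - 1)`. -/
abbrev past (Z : ℕ → Ω → α) (m : ℕ) : MeasurableSpace Ω :=
  ⨆ i ∈ Set.Iio m, MeasurableSpace.comap (Z i) inferInstance

omit [MeasurableSpace Ω] in
lemma comap_le_past {i m : ℕ} (h : i < m) :
    MeasurableSpace.comap (Z i) inferInstance ≤ past Z m :=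
  le_iSup₂_of_le i h le_rfl

omit [MeasurableSpace Ω] in
lemma measurable_past {i m : ℕ} (h : i < m) : Measurable[past Z m] (Z i) :=
  measurable_iff_comap_le.2 (comap_le_past h)

omit [MeasurableSpace Ω] in
lemma past_mono {i m : ℕ} (h : i ≤ m) : past Z i ≤ past Z m :=
  biSup_mono fun _ hj => lt_of_lt_of_le hj h

lemma past_le (hZ : ∀ i, Measurable (Z i)) (m : ℕ) : past Z m ≤ ‹MeasurableSpace Ω› :=
  iSup₂_le fun i _ => (hZ i).comap_le

lemma indep_past (hZ : ∀ i, Measurable (Z i)) (hind : iIndepFun Z P) (m : ℕ) :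
    Indep (past Z m) (MeasurableSpace.comap (Z m) inferInstance) P := by
  have := indep_iSup_of_disjoint (m := fun i => MeasurableSpace.comap (Z i) inferInstance)
    (fun i => (hZ i).comap_le) hind (S := Set.Iio m) (T := {m}) (by simp)
  simpa [past] using this

lemma measurable_predictable_sum {f : α → ℝ} (hf : Measurable f) {I : ℕ → Set Ω}
    (hI : ∀ j, MeasurableSet[past Z j] (I j)) (m : ℕ) :
    Measurable[past Z m]
      fun ω => ∑ j ∈ Finset.range m, (I j).indicator (fun ω => f (Z j ω)) ω := by
  refine Finset.measurable_sum _ fun j hj => ?_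
  have hj := Finset.mem_range.1 hj
  exact (hf.comp (measurable_past hj)).indicator (past_mono hj.le _ (hI j))

/-- Induction on `m`. On `I m`, which belongs to the past, the new factor is independent of the past
and costs at most `L`; off `I m` it equals one, hence the condition `1 ≤ L`. -/
lemma lintegral_exp_predictable_sum_le (hZ : ∀ i, Measurable (Z i)) (hind : iIndepFun Z P)
    [IsProbabilityMeasure P] {f : α → ℝ} (hf : Measurable f) {L : ENNReal} (hL1 : 1 ≤ L)
    (hL : ∀ i, ∫⁻ ω, ENNReal.ofReal (Real.exp (f (Z i ω))) ∂P ≤ L) {I : ℕ → Set Ω}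
    (hI : ∀ j, MeasurableSet[past Z j] (I j)) (m : ℕ) :
    ∫⁻ ω, ENNReal.ofReal (Real.exp
      (∑ j ∈ Finset.range m, (I j).indicator (fun ω => f (Z j ω)) ω)) ∂P ≤ L ^ m := by
  induction m with
  | zero => simp
  | succ m ih =>
    set U : Ω → ENNReal := fun ω => ENNReal.ofReal (Real.exp
      (∑ j ∈ Finset.range m, (I j).indicator (fun ω => f (Z j ω)) ω)) with hU
    set V : Ω → ENNReal := fun ω => ENNReal.ofReal (Real.exp (f (Z m ω))) with hV
    have hUm : Measurable[past Z m] U :=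
      (Real.measurable_exp.comp (measurable_predictable_sum hf hI m)).ennreal_ofReal
    have hVm : Measurable[MeasurableSpace.comap (Z m) inferInstance] V :=
      (Real.measurable_exp.comp (hf.comp (comap_measurable (Z m)))).ennreal_ofReal
    have hUI : Measurable[past Z m] ((I m).indicator U) := hUm.indicator (hI m)
    have hUI' : Measurable[past Z m] ((I m)ᶜ.indicator U) := hUm.indicator (hI m).compl
    have h1 : ∀ ω, ENNReal.ofReal (Real.exp
        (∑ j ∈ Finset.range (m + 1), (I j).indicator (fun ω => f (Z j ω)) ω)) =
        (I m).indicator U ω * V ω + (I m)ᶜ.indicator U ω := by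
      intro ω
      rw [Finset.sum_range_succ, Real.exp_add, ENNReal.ofReal_mul (Real.exp_nonneg _)]
      by_cases hω : ω ∈ I m
      · simp [hω, hU, hV]
      · simp [hω, hU]
    have hle := past_le hZ m
    calc _ = ∫⁻ ω, ((I m).indicator U ω * V ω + (I m)ᶜ.indicator U ω) ∂P :=
          lintegral_congr h1
      _ = ∫⁻ ω, (I m).indicator U ω * V ω ∂P + ∫⁻ ω, (I m)ᶜ.indicator U ω ∂P :=
          lintegral_add_right _ (hUI'.mono hle le_rfl)
      _ = (∫⁻ ω, (I m).indicator U ω ∂P) * (∫⁻ ω, V ω ∂P) + ∫⁻ ω, (I m)ᶜ.indicator U ω ∂P := by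
          rw [lintegral_mul_eq_lintegral_mul_lintegral_of_independent_measurableSpace hle
            (hZ m).comap_le (indep_past hZ hind m) hUI hVm]
      _ ≤ (∫⁻ ω, (I m).indicator U ω ∂P) * L + (∫⁻ ω, (I m)ᶜ.indicator U ω ∂P) * L := by
          gcongr
          · exact hL m
          · exact le_mul_of_one_le_right' hL1
      _ = (∫⁻ ω, U ω ∂P) * L := by
          rw [← add_mul, ← lintegral_add_right _ (hUI'.mono hle le_rfl)]
          congr 2
          ext ω
          exact Set.indicator_self_add_compl_apply (I m) U ω
      _ ≤ L ^ m * L := by gcongr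
      _ = L ^ (m + 1) := (pow_succ _ _).symm

/-- Chernoff bound: Markov's inequality for the exponential of the sum. -/
lemma measure_predictable_sum_ge_le (hZ : ∀ i, Measurable (Z i)) (hind : iIndepFun Z P)
    [IsProbabilityMeasure P] {f : α → ℝ} (hf : Measurable f) {l δ : ℝ} (hl : 0 < l) (hδ : 0 ≤ δ)
    (hL : ∀ i, ∫⁻ ω, ENNReal.ofReal (Real.exp (l * f (Z i ω))) ∂P ≤
      ENNReal.ofReal (Real.exp (l * δ))) {I : ℕ → Set Ω}
    (hI : ∀ j, MeasurableSet[past Z j] (I j)) (m : ℕ) (x : ℝ) :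
    P {ω | x ≤ ∑ j ∈ Finset.range m, (I j).indicator (fun ω => f (Z j ω)) ω} ≤
      ENNReal.ofReal (Real.exp (l * δ * m - l * x)) := by
  have h1 := lintegral_exp_predictable_sum_le hZ hind (hf.const_mul l)
    (L := ENNReal.ofReal (Real.exp (l * δ)))
    (by rw [ENNReal.one_le_ofReal]; exact Real.one_le_exp (by positivity)) hL hI m
  have h2 : ∀ ω, ∑ j ∈ Finset.range m, (I j).indicator (fun ω => l * f (Z j ω)) ω =
      l * ∑ j ∈ Finset.range m, (I j).indicator (fun ω => f (Z j ω)) ω := by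
    intro ω
    rw [Finset.mul_sum]
    refine Finset.sum_congr rfl fun j _ => ?_
    by_cases hω : ω ∈ I j <;> simp [hω]
  simp only [h2] at h1
  have hmeas : Measurable fun ω => ENNReal.ofReal (Real.exp
      (l * ∑ j ∈ Finset.range m, (I j).indicator (fun ω => f (Z j ω)) ω)) :=
    (Real.measurable_exp.comp (((measurable_predictable_sum hf hI m).mono
      (past_le hZ m) le_rfl).const_mul l)).ennreal_ofReal
  have hx : ENNReal.ofReal (Real.exp (l * x)) ≠ 0 := by simp [Real.exp_pos]
  have h3 := meas_ge_le_lintegral_div (μ := P) hmeas.aemeasurable hx ENNReal.ofReal_ne_top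
  have h4 : {ω | x ≤ ∑ j ∈ Finset.range m, (I j).indicator (fun ω => f (Z j ω)) ω} =
      {ω | ENNReal.ofReal (Real.exp (l * x)) ≤ ENNReal.ofReal (Real.exp
      (l * ∑ j ∈ Finset.range m, (I j).indicator (fun ω => f (Z j ω)) ω))} := by
    ext ω
    rw [Set.mem_ofPred_eq, Set.mem_ofPred_eq, ENNReal.ofReal_le_ofReal_iff (Real.exp_nonneg _),
      Real.exp_le_exp, mul_le_mul_iff_right₀ hl]
  rw [h4]
  refine h3.trans ((ENNReal.div_le_div_right h1 _).trans ?_)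
  rw [← ENNReal.ofReal_pow (Real.exp_nonneg _), ← ENNReal.ofReal_div_of_pos (Real.exp_pos _),
    ← Real.exp_nat_mul, ← Real.exp_sub]
  exact (congrArg _ (congrArg _ (by ring))).le

lemma summable_poly_mul_exp (d C : ℕ) {r : ℝ} (hr : 0 < r) :
    Summable fun n : ℕ => ((2 * n + 1 : ℕ) : ℝ) ^ d * ((C * n + 1 : ℕ) : ℝ) * Real.exp (-(r * n)) := by
  have h0 : ‖Real.exp (-r)‖ < 1 := by
    rw [Real.norm_eq_abs, abs_of_pos (Real.exp_pos _), Real.exp_lt_one_iff]; linarith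
  have h1 : Summable fun n : ℕ => ((n + 1 : ℕ) : ℝ) ^ (d + 1) * Real.exp (-r) ^ (n + 1) :=
    (summable_nat_add_iff (f := fun n : ℕ => (n : ℝ) ^ (d + 1) * Real.exp (-r) ^ n) 1).2
      (summable_pow_mul_geometric_of_norm_lt_one (d + 1) h0)
  have key : ∀ n : ℕ, ((2 * n + 1 : ℕ) : ℝ) ^ d * ((C * n + 1 : ℕ) : ℝ) * Real.exp (-(r * n)) ≤
      Real.exp r * ((2 : ℝ) ^ d * (C + 1)) *
        (((n + 1 : ℕ) : ℝ) ^ (d + 1) * Real.exp (-r) ^ (n + 1)) := by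
    intro n
    have hC : (0 : ℝ) ≤ C := Nat.cast_nonneg C
    have hn : (0 : ℝ) ≤ n := Nat.cast_nonneg n
    have h2 : ((2 * n + 1 : ℕ) : ℝ) ≤ 2 * ((n + 1 : ℕ) : ℝ) := by push_cast; linarith
    have h3 : ((C * n + 1 : ℕ) : ℝ) ≤ (C + 1) * ((n + 1 : ℕ) : ℝ) := by
      push_cast
      linarith
    have h4 : Real.exp (-(r * n)) = Real.exp r * Real.exp (-r) ^ (n + 1) := by
      rw [← Real.exp_nat_mul, ← Real.exp_add]
      congr 1
      push_cast
      ring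
    have h5 : ((2 * n + 1 : ℕ) : ℝ) ^ d ≤ 2 ^ d * ((n + 1 : ℕ) : ℝ) ^ d := by
      rw [← mul_pow]
      exact pow_le_pow_left₀ (Nat.cast_nonneg _) h2 d
    have h6 := mul_le_mul h5 h3 (Nat.cast_nonneg _) (by positivity)
    have h7 := mul_le_mul_of_nonneg_right h6 (Real.exp_nonneg (-(r * n)))
    refine h7.trans_eq ?_
    rw [h4, pow_succ ((n + 1 : ℕ) : ℝ) d]
    ring
  exact Summable.of_nonneg_of_le (fun n => by positivity) key (h1.mul_left _)

/-- Uniform law of large numbers for predictable sums, one-sided, over polynomially many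
selections. -/
lemma ae_eventually_predictable_sum_lt (hZ : ∀ i, Measurable (Z i)) (hind : iIndepFun Z P)
    [IsProbabilityMeasure P] {f : α → ℝ} (hf : Measurable f)
    (H : ∀ δ > 0, ∃ l > 0, ∀ i, ∫⁻ ω, ENNReal.ofReal (Real.exp (l * f (Z i ω))) ∂P ≤
      ENNReal.ofReal (Real.exp (l * δ)))
    {ι : Type*} (V : ℕ → Finset ι) {d : ℕ} (hV : ∀ n, (V n).card ≤ (2 * n + 1) ^ d)
    {I : ι → ℕ → Set Ω} (hI : ∀ v j, MeasurableSet[past Z j] (I v j)) (C : ℕ) {ε : ℝ}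
    (hε : 0 < ε) :
    ∀ᵐ ω ∂P, ∀ᶠ n : ℕ in atTop, ∀ v ∈ V n, ∀ m ≤ C * n,
      ∑ j ∈ Finset.range m, (I v j).indicator (fun ω => f (Z j ω)) ω < ε * n := by
  -- With this `δ`, the exponential moment over `m ≤ C n` terms is at most `exp (l ε n / 2)`. Half
  -- of the Chernoff exponent `l ε n` survives and beats the polynomial number of selections and of
  -- values of `m`.
  obtain ⟨l, hl, hL⟩ := H (ε / (2 * (C + 1))) (by positivity)
  set δ := ε / (2 * (C + 1)) with hδ
  set E : ℕ → Set Ω := fun n => ⋃ v ∈ V n, ⋃ m ∈ Finset.range (C * n + 1),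
    {ω | ε * n ≤ ∑ j ∈ Finset.range m, (I v j).indicator (fun ω => f (Z j ω)) ω} with hE
  have hEn : ∀ n, P (E n) ≤ ENNReal.ofReal (((2 * n + 1 : ℕ) : ℝ) ^ d * ((C * n + 1 : ℕ) : ℝ) *
      Real.exp (-(l * ε / 2 * n))) := by
    intro n
    have h1 : ∀ v ∈ V n, ∀ m ∈ Finset.range (C * n + 1),
        P {ω | ε * n ≤ ∑ j ∈ Finset.range m, (I v j).indicator (fun ω => f (Z j ω)) ω} ≤
          ENNReal.ofReal (Real.exp (-(l * ε / 2 * n))) := by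
      intro v _ m hm
      refine (measure_predictable_sum_ge_le hZ hind hf hl (by positivity) hL (hI v) m _).trans ?_
      refine ENNReal.ofReal_le_ofReal (Real.exp_le_exp.2 ?_)
      have hm' : (m : ℝ) ≤ (C + 1) * n := by
        have : m ≤ C * n := by simpa [Nat.lt_succ_iff] using hm
        have : (m : ℝ) ≤ C * n := by exact_mod_cast this
        nlinarith [Nat.cast_nonneg (α := ℝ) n]
      have h2 : δ * m ≤ ε / 2 * n := by
        calc δ * m ≤ δ * ((C + 1) * n) := by gcongr
          _ = ε / 2 * n := by rw [hδ]; field_simp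
      nlinarith [mul_le_mul_of_nonneg_left h2 hl.le]
    calc P (E n) ≤ ∑ v ∈ V n, ∑ m ∈ Finset.range (C * n + 1),
          ENNReal.ofReal (Real.exp (-(l * ε / 2 * n))) := by
          refine (measure_biUnion_finset_le _ _).trans (Finset.sum_le_sum fun v hv => ?_)
          exact (measure_biUnion_finset_le _ _).trans (Finset.sum_le_sum fun m hm => h1 v hv m hm)
      _ = ((V n).card : ENNReal) * (((C * n + 1 : ℕ) : ENNReal) *
            ENNReal.ofReal (Real.exp (-(l * ε / 2 * n)))) := by
          simp
      _ ≤ (((2 * n + 1) ^ d : ℕ) : ENNReal) * (((C * n + 1 : ℕ) : ENNReal) *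
            ENNReal.ofReal (Real.exp (-(l * ε / 2 * n)))) := by
          gcongr
          exact hV n
      _ = _ := by
          rw [ENNReal.ofReal_mul (by positivity), ENNReal.ofReal_mul (by positivity),
            ← Nat.cast_pow, ENNReal.ofReal_natCast, ENNReal.ofReal_natCast, mul_assoc]
  have hsum : ∑' n, P (E n) ≠ ⊤ := by
    refine ne_top_of_le_ne_top ?_ (ENNReal.tsum_le_tsum hEn)
    rw [← ENNReal.ofReal_tsum_of_nonneg (fun n => by positivity)
      (summable_poly_mul_exp d C (by positivity))]
    exact ENNReal.ofReal_ne_top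
  filter_upwards [ae_eventually_notMem hsum] with ω hω
  filter_upwards [hω] with n hn v hv m hm
  by_contra hcon
  refine hn ?_
  simp only [hE, Set.mem_iUnion, Finset.mem_range]
  exact ⟨v, hv, m, by omega, not_lt.1 hcon⟩

end Exponential

/-! ### Exponential interarrival times -/

section ExpMeasure

instance : IsProbabilityMeasure (expMeasure 2) := isProbabilityMeasure_expMeasure two_pos

lemma gammaPDF_toReal_smul (g : ℝ → ℝ) :
    (fun x => (gammaPDF 1 2 x).toReal • g x) =
      (Set.Ici (0 : ℝ)).indicator fun x => 2 * Real.exp (-(2 * x)) * g x := by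
  ext x
  rw [gammaPDF, ENNReal.toReal_ofReal (gammaPDFReal_nonneg one_pos two_pos x), gammaPDFReal]
  by_cases hx : 0 ≤ x <;> simp [hx]

lemma integrable_expMeasure_iff (g : ℝ → ℝ) :
    Integrable g (expMeasure 2) ↔
      IntegrableOn (fun x => 2 * Real.exp (-(2 * x)) * g x) (Set.Ioi 0) := by
  rw [expMeasure, gammaMeasure, integrable_withDensity_iff_integrable_smul'
    (f := gammaPDF 1 2) (measurable_gammaPDFReal 1 2).ennreal_ofReal (ae_of_all _ fun x => ENNReal.ofReal_lt_top),
    gammaPDF_toReal_smul, integrable_indicator_iff measurableSet_Ici,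
    integrableOn_Ici_iff_integrableOn_Ioi]

lemma integral_expMeasure (g : ℝ → ℝ) :
    ∫ x, g x ∂(expMeasure 2) = ∫ x in Set.Ioi 0, 2 * Real.exp (-(2 * x)) * g x := by
  rw [expMeasure, gammaMeasure, integral_withDensity_eq_integral_toReal_smul
    (f := gammaPDF 1 2) (measurable_gammaPDFReal 1 2).ennreal_ofReal (ae_of_all _ fun x => ENNReal.ofReal_lt_top),
    gammaPDF_toReal_smul, integral_indicator measurableSet_Ici, integral_Ici_eq_integral_Ioi]

lemma integrable_exp_mul_expMeasure {t : ℝ} (ht : t < 2) :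
    Integrable (fun x => Real.exp (t * x)) (expMeasure 2) := by
  rw [integrable_expMeasure_iff]
  refine ((integrableOn_exp_mul_Ioi (a := t - 2) (by linarith) 0).const_mul 2).congr
    (ae_of_all _ fun x => ?_)
  change 2 * Real.exp ((t - 2) * x) = 2 * Real.exp (-(2 * x)) * Real.exp (t * x)
  rw [mul_assoc, ← Real.exp_add]
  ring_nf

lemma integral_id_expMeasure : ∫ x, x ∂(expMeasure 2) = 1 / 2 := by
  rw [integral_expMeasure]
  have h := Real.integral_rpow_mul_exp_neg_mul_Ioi (a := 2) (r := 2) two_pos two_pos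
  have h1 : ∀ x : ℝ, 2 * Real.exp (-(2 * x)) * x = 2 * (x ^ ((2 : ℝ) - 1) * Real.exp (-(2 * x))) := by
    intro x
    rw [show (2 : ℝ) - 1 = 1 by norm_num, Real.rpow_one]
    ring
  simp only [h1]
  rw [integral_const_mul, h]
  norm_num

lemma integrable_id_expMeasure : Integrable (fun x => x) (expMeasure 2) :=
  integrable_of_integral_eq_one (f := fun x => 2 * x) (by
    rw [integral_const_mul, integral_id_expMeasure]; norm_num) |>.const_mul (1 / 2) |>.congr
      (ae_of_all _ fun x => by ring)

lemma expMeasure_Iic_zero : expMeasure 2 (Set.Iic 0) = 0 := by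
  have h := cdf_expMeasure_eq (r := 2) two_pos 0
  rw [cdf_eq_real] at h
  simpa [measureReal_eq_zero_iff] using h

end ExpMeasure

end

section

/-! ### The uniform law of large numbers along the net queues -/

/-- A centred variable has a moment generating function with derivative zero at the origin, so for
small `l > 0` it is at most `1 + δ l ≤ exp (l δ)`. -/
lemma exists_lintegral_exp_le {α : Type*} [MeasurableSpace α] {ν : Measure α}
    [IsProbabilityMeasure ν] {f : α → ℝ} (hint : 0 ∈ interior (integrableExpSet f ν))
    (hf0 : ∫ x, f x ∂ν = 0) {δ : ℝ} (hδ : 0 < δ) :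
    ∃ l > 0, ∫⁻ x, ENNReal.ofReal (Real.exp (l * f x)) ∂ν ≤ ENNReal.ofReal (Real.exp (l * δ)) := by
  have h1 := hasDerivAt_mgf hint
  have h2 : ∫ x, f x * Real.exp (0 * f x) ∂ν = 0 := by simpa using hf0
  rw [h2] at h1
  have h3 := h1.isLittleO.def hδ
  have h4 : ∀ᶠ l in 𝓝 (0 : ℝ), l ∈ integrableExpSet f ν := mem_interior_iff_mem_nhds.1 hint
  have h5 : ∀ᶠ l in 𝓝[>] (0 : ℝ), 0 < l ∧ l ∈ integrableExpSet f ν ∧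
      ‖mgf f ν l - mgf f ν 0 - (l - 0) • (0 : ℝ)‖ ≤ δ * ‖l - 0‖ := by
    filter_upwards [self_mem_nhdsWithin, h4.filter_mono nhdsWithin_le_nhds,
      h3.filter_mono nhdsWithin_le_nhds] with l h6 h7 h8
    exact ⟨h6, h7, h8⟩
  obtain ⟨l, hl, hint', hbound⟩ := h5.exists
  refine ⟨l, hl, ?_⟩
  rw [← ofReal_integral_eq_lintegral_ofReal hint' (ae_of_all _ fun x => Real.exp_nonneg _)]
  refine ENNReal.ofReal_le_ofReal ?_
  simp only [mgf_zero', probReal_univ, sub_zero, smul_zero, Real.norm_eq_abs,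
    abs_of_pos hl] at hbound
  have h9 := (abs_le.1 hbound).2
  have h10 := Real.add_one_le_exp (l * δ)
  change mgf f ν l ≤ _
  linarith

section Flow

variable {N : ℕ} (b : Binning N) {μb μa : Measure unitInterval} [IsProbabilityMeasure μb]
  [IsProbabilityMeasure μa]

lemma Binning.measurable_idx : Measurable b.idx := b.mono.measurable

lemma measurable_code : Measurable (code b) :=
  b.measurable_idx.sumMap b.measurable_idx

instance : IsProbabilityMeasure (labelLaw μb μa) := by
  constructor
  have h1 : IsProbabilityMeasure (μb.map (Sum.inl : unitInterval → Order)) :=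
    Measure.isProbabilityMeasure_map measurable_inl.aemeasurable
  have h2 : IsProbabilityMeasure (μa.map (Sum.inr : unitInterval → Order)) :=
    Measure.isProbabilityMeasure_map measurable_inr.aemeasurable
  simp [labelLaw, ENNReal.inv_two_add_inv_two]

/-- The compensated contribution of an order to the number of orders with label in `G`. -/
def incr (μb μa : Measure unitInterval) (G : Set Order) (z : ℝ × Order) : ℝ :=
  G.indicator 1 z.2 - 2 * (labelLaw μb μa).real G * z.1

omit [IsProbabilityMeasure μb] [IsProbabilityMeasure μa] in
lemma measurable_incr {G : Set Order} (hG : MeasurableSet G) : Measurable (incr μb μa G) := by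
  unfold incr
  have : Measurable (G.indicator (1 : Order → ℝ)) := measurable_one.indicator hG
  fun_prop

/-- Centred because an interarrival time has mean `1/2`, which cancels the factor `2`. -/
lemma integral_incr {G : Set Order} (hG : MeasurableSet G) :
    ∫ z, incr μb μa G z ∂((expMeasure 2).prod (labelLaw μb μa)) = 0 := by
  have h1 : Integrable (fun z : ℝ × Order => G.indicator (1 : Order → ℝ) z.2)
      ((expMeasure 2).prod (labelLaw μb μa)) :=
    Integrable.comp_snd ((integrable_const (1 : ℝ)).indicator hG) _
  have h2 : Integrable (fun z : ℝ × Order => 2 * (labelLaw μb μa).real G * z.1)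
      ((expMeasure 2).prod (labelLaw μb μa)) :=
    Integrable.comp_fst (integrable_id_expMeasure.const_mul _) _
  simp only [incr]
  rw [integral_sub h1 h2, integral_fun_snd (fun l => G.indicator (1 : Order → ℝ) l),
    integral_fun_fst (fun g => 2 * (labelLaw μb μa).real G * g), integral_const_mul,
    integral_id_expMeasure, integral_indicator_one hG]
  simp only [probReal_univ, one_smul]
  ring

/-- The indicator is bounded, and `exp (c * gap)` is integrable for `c < 2`. The coefficient of the
gap has modulus at most `2 |t|`, so `|t| < 1` suffices. -/
lemma zero_mem_interior_integrableExpSet_incr {G : Set Order} (hG : MeasurableSet G) (σ : ℝ)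
    (hσ : |σ| = 1) :
    0 ∈ interior (integrableExpSet (fun z => σ * incr μb μa G z)
      ((expMeasure 2).prod (labelLaw μb μa))) := by
  rw [mem_interior]
  refine ⟨Set.Ioo (-1) 1, fun t ht => ?_, isOpen_Ioo, by simp⟩
  set p := (labelLaw μb μa).real G with hp
  have hp0 : 0 ≤ p := measureReal_nonneg
  have hp1 : p ≤ 1 := measureReal_le_one
  have h1 : |t * σ| < 1 := by rw [abs_mul, hσ, mul_one]; exact abs_lt.2 ht
  have h2 : -(t * σ) * (2 * p) < 2 := by
    have := (abs_lt.1 h1).1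
    rcases hp0.eq_or_lt with h | h
    · rw [← h]; norm_num
    · nlinarith [mul_pos h (by linarith : 0 < 1 + t * σ)]
  have h3 : Integrable (fun l : Order => Real.exp (t * σ * G.indicator 1 l)) (labelLaw μb μa) := by
    refine Integrable.of_bound (C := Real.exp 1)
      (by
        have : Measurable (G.indicator (1 : Order → ℝ)) := measurable_one.indicator hG
        fun_prop) (ae_of_all _ fun l => ?_)
    rw [Real.norm_eq_abs, abs_of_pos (Real.exp_pos _), Real.exp_le_exp]
    have := (abs_lt.1 h1).2
    by_cases hl : l ∈ G <;> simp [hl]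
    linarith
  have h4 := (integrable_exp_mul_expMeasure h2).mul_prod h3
  refine h4.congr (ae_of_all _ fun z => ?_)
  change Real.exp _ * Real.exp _ = Real.exp (t * (σ * (G.indicator 1 z.2 - 2 * p * z.1)))
  rw [← Real.exp_add]
  congr 1
  ring

instance : DiscreteMeasurableSpace (ℕ ⊕ ℕ) :=
  ⟨fun _ => measurableSet_sum_iff.2 ⟨.of_discrete, .of_discrete⟩⟩

/-- Sums of `y` over the visits of the lowest ask, or of the highest bid, to a bin are small,
uniformly over the initial states. -/
def UnifLaw (lo hi : ℕ) (c : ℕ → ℕ ⊕ ℕ) (y : ℕ → ℝ) : Prop :=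
  ∀ C : ℕ, ∀ ε > 0, ∀ᶠ n : ℕ in atTop, ∀ ν : ℕ → ℤ, (∀ k ∈ Finset.Ioo lo hi, |ν k| ≤ n) →
    ∀ m ≤ C * n, ∀ k,
      |∑ j ∈ Finset.range m, if netAsk lo hi (netChain lo hi ν c j) = k then y j else 0| ≤ ε * n ∧
      |∑ j ∈ Finset.range m, if netBid lo hi (netChain lo hi ν c j) = k then y j else 0| ≤ ε * n

variable {Ω : Type*} [MeasurableSpace Ω] {P : Measure Ω} [IsProbabilityMeasure P]
  {gap : ℕ → Ω → ℝ} {label : ℕ → Ω → Order}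

-- A function of the first `j` codes factors through finite tuples in a countable discrete space,
-- where measurability is automatic.
omit [IsProbabilityMeasure P] in
lemma measurableSet_past (Φ : (ℕ → ℕ ⊕ ℕ) → ℕ) (j k : ℕ)
    (hΦ : ∀ c d : ℕ → ℕ ⊕ ℕ, (∀ i < j, c i = d i) → Φ c = Φ d) :
    MeasurableSet[past (fun i ω => (gap i ω, label i ω)) j]
      {ω | Φ (fun i => code b (label i ω)) = k} := by
  set Φ' : (Fin j → ℕ ⊕ ℕ) → ℕ := fun v => Φ fun i => if h : i < j then v ⟨i, h⟩ else Sum.inl 0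
  have h1 : ∀ ω, Φ (fun i => code b (label i ω)) = Φ' fun i => code b (label i ω) := by
    intro ω
    refine hΦ _ _ fun i hi => ?_
    simp [hi]
  have h2 : Measurable[past (fun i ω => (gap i ω, label i ω)) j]
      fun ω => (fun i : Fin j => code b (label i ω)) := by
    refine @measurable_pi_lambda _ _ _ (past (fun i ω => (gap i ω, label i ω)) j) _ _ fun i => ?_
    exact ((measurable_code b).comp measurable_snd).comp
      (measurable_past (Z := fun i ω => (gap i ω, label i ω)) i.2)
  have h3 : Measurable Φ' := measurable_of_countable _
  simp only [h1]
  exact (h3.comp h2) (measurableSet_singleton k)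

/-- The law for one bin, one constant and one sign. -/
lemma ae_eventually_sum_visits_lt (hflow : IsOrderFlow P μb μa gap label) {G : Set Order}
    (hG : MeasurableSet G) (lo hi : ℕ) (pos : (ℕ → ℤ) → ℕ) (k C : ℕ) {ε : ℝ} (hε : 0 < ε) {σ : ℝ}
    (hσ : |σ| = 1) :
    ∀ᵐ ω ∂P, ∀ᶠ n : ℕ in atTop,
      ∀ v ∈ Fintype.piFinset fun _ : Fin (N + 2) => Finset.Icc (-n : ℤ) n, ∀ m ≤ C * n,
      ∑ j ∈ Finset.range m, (if pos (netChain lo hi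
        (fun i => if h : i < N + 2 then v ⟨i, h⟩ else 0) (fun i => code b (label i ω)) j) = k
        then σ * incr μb μa G (gap j ω, label j ω) else 0) < ε * n := by
  have hZ : ∀ i, Measurable fun ω => (gap i ω, label i ω) :=
    fun i => (hflow.measurable_gap i).prodMk (hflow.measurable_label i)
  have hf : Measurable fun z => σ * incr μb μa G z := (measurable_incr hG).const_mul σ
  have := ae_eventually_predictable_sum_lt (P := P) hZ hflow.indep hf (fun δ hδ => by
      obtain ⟨l, hl, hle⟩ := exists_lintegral_exp_le
        (zero_mem_interior_integrableExpSet_incr (μb := μb) (μa := μa) hG σ hσ)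
        (by rw [integral_const_mul, integral_incr hG, mul_zero]) hδ
      refine ⟨l, hl, fun i => ?_⟩
      rw [← hflow.law i, lintegral_map _ (hZ i)] at hle
      · exact hle
      · exact (Real.measurable_exp.comp (hf.const_mul l)).ennreal_ofReal)
    -- The selections are the initial vectors with entries in `[-n, n]`, at most `(2 n + 1) ^ (N +
    -- 2)` of them.
    (fun n : ℕ => Fintype.piFinset fun _ : Fin (N + 2) => Finset.Icc (-n : ℤ) n) (d := N + 2)
    (fun n => by
      rw [Fintype.card_piFinset]
      simp only [Int.card_Icc, Finset.prod_const, Finset.card_univ, Fintype.card_fin]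
      exact Nat.pow_le_pow_left (by omega) _)
    (I := fun v j => {ω | pos (netChain lo hi
        (fun i => if h : i < N + 2 then v ⟨i, h⟩ else 0) (fun i => code b (label i ω)) j) = k})
    (fun v j => measurableSet_past b (fun c => pos (netChain lo hi
        (fun i => if h : i < N + 2 then v ⟨i, h⟩ else 0) c j)) j k
        fun c d hcd => by simp only [netChain_congr_code _ j hcd]) C hε
  filter_upwards [this] with ω hω
  filter_upwards [hω] with n hn v hv m hm
  refine lt_of_eq_of_lt (Finset.sum_congr rfl fun j _ => ?_) (hn v hv m hm)
  simp [Set.indicator_apply]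

/-- The almost sure events are indexed by countably many parameters, with `1 / (q + 1)` in place of
`ε`, two signs, and the two best prices. The set `G` need not be a union of bins: the threshold
argument uses parts of a bin. -/
lemma ae_unifLaw (hflow : IsOrderFlow P μb μa gap label) {G : Set Order} (hG : MeasurableSet G) :
    ∀ᵐ ω ∂P, ∀ lo hi : ℕ, lo < hi → hi ≤ N + 1 →
      UnifLaw lo hi (fun j => code b (label j ω))
        (fun j => incr μb μa G (gap j ω, label j ω)) := by
  have h0 : ∀ᵐ ω ∂P, ∀ lo hi k C q : ℕ, ∀ i j : Bool, ∀ᶠ n : ℕ in atTop,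
      ∀ v ∈ Fintype.piFinset fun _ : Fin (N + 2) => Finset.Icc (-n : ℤ) n, ∀ m ≤ C * n,
      ∑ l ∈ Finset.range m, (if cond j (netAsk lo hi) (netBid lo hi) (netChain lo hi
        (fun i => if h : i < N + 2 then v ⟨i, h⟩ else 0) (fun i => code b (label i ω)) l) = k
        then cond i (1 : ℝ) (-1) * incr μb μa G (gap l ω, label l ω) else 0) <
          1 / ((q : ℝ) + 1) * n := by
    simp only [ae_all_iff]
    intro lo hi k C q i j
    exact ae_eventually_sum_visits_lt b hflow hG lo hi _ k C (by positivity)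
      (by cases i <;> simp)
  filter_upwards [h0] with ω hω lo hi hlh hhi C ε hε
  obtain ⟨q, hq⟩ := exists_nat_one_div_lt hε
  have h1 : ∀ᶠ n : ℕ in atTop, ∀ k ∈ Finset.range (N + 2), ∀ i j : Bool,
      ∀ v ∈ Fintype.piFinset fun _ : Fin (N + 2) => Finset.Icc (-n : ℤ) n, ∀ m ≤ C * n,
      ∑ l ∈ Finset.range m, (if cond j (netAsk lo hi) (netBid lo hi) (netChain lo hi
        (fun i => if h : i < N + 2 then v ⟨i, h⟩ else 0) (fun i => code b (label i ω)) l) = k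
        then cond i (1 : ℝ) (-1) * incr μb μa G (gap l ω, label l ω) else 0) <
          1 / ((q : ℝ) + 1) * n := by
    rw [Filter.eventually_all_finset]
    intro k _
    rw [Filter.eventually_all]
    intro i
    rw [Filter.eventually_all]
    exact fun j => hω lo hi k C q i j
  filter_upwards [h1] with n hn ν hν m hm k
  -- An arbitrary initial state is replaced by its restriction to the window, which yields the same
  -- best prices and belongs to the finite family.
  set v : Fin (N + 2) → ℤ := fun i => if (i : ℕ) ∈ Finset.Ioo lo hi then ν i else 0 with hv
  have hvmem : v ∈ Fintype.piFinset fun _ : Fin (N + 2) => Finset.Icc (-n : ℤ) n := by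
    rw [Fintype.mem_piFinset]
    intro i
    rw [Finset.mem_Icc, ← abs_le, hv]
    dsimp only
    split_ifs with hi'
    · exact hν _ hi'
    · simp
  have hcongr : ∀ i ∈ Finset.Ioo lo hi,
      ν i = (fun i => if h : i < N + 2 then v ⟨i, h⟩ else 0) i := by
    intro i hi'
    have h2 := (Finset.mem_Ioo.1 hi').2
    simp only [hv]
    rw [dif_pos (by omega), if_pos hi']
  have hchain := netChain_congr hcongr (fun i => code b (label i ω))
  have hle : 1 / ((q : ℝ) + 1) * n ≤ ε * n := by gcongr
  by_cases hk : k < N + 2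
  · have h3 : ∀ j : Bool, |∑ l ∈ Finset.range m, if cond j (netAsk lo hi) (netBid lo hi)
        (netChain lo hi (fun i => if h : i < N + 2 then v ⟨i, h⟩ else 0)
          (fun i => code b (label i ω)) l) = k
        then incr μb μa G (gap l ω, label l ω) else 0| ≤ ε * n := by
      intro j
      have h4 := hn k (Finset.mem_range.2 hk) true j v hvmem m hm
      have h5 := hn k (Finset.mem_range.2 hk) false j v hvmem m hm
      simp only [cond_true, cond_false, one_mul, neg_one_mul] at h4 h5
      rw [abs_le]
      constructor
      · have h6 : ∀ x y : ℝ, ∀ p : Prop, ∀ [Decidable p], (if p then -x else 0) =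
            -(if p then x else 0) := fun x y p _ => by split_ifs <;> simp
        simp only [h6 _ 0, Finset.sum_neg_distrib] at h5
        linarith
      · linarith
    refine ⟨?_, ?_⟩
    · convert! h3 true using 5 with j _
      simp only [cond_true]
      rw [netAsk_congr (hchain j)]
    · convert! h3 false using 5 with j _
      simp only [cond_false]
      rw [netBid_congr (hchain j)]
  · have h3 : ∀ j, ¬ netAsk lo hi (netChain lo hi ν (fun i => code b (label i ω)) j) = k := by
      intro j
      have := netAsk_le (lo := lo) (hi := hi) (netChain lo hi ν (fun i => code b (label i ω)) j)
      omega
    have h4 : ∀ j, ¬ netBid lo hi (netChain lo hi ν (fun i => code b (label i ω)) j) = k := by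
      intro j
      have := netBid_lt hlh (netChain lo hi ν (fun i => code b (label i ω)) j)
      omega
    simp only [h3, h4, if_false, Finset.sum_const_zero, abs_zero, and_self]
    positivity

end Flow

end

section

/-! ### Arrival times -/

/-- Interarrival times of a typical Poisson process of rate `2`. -/
structure Timing (gap : ℕ → ℝ) : Prop where
  pos : ∀ j, 0 < gap j
  law : ∀ C : ℕ, ∀ ε > 0, ∀ᶠ n : ℕ in atTop, ∀ m ≤ C * n,
    |(m : ℝ) - 2 * ∑ i ∈ Finset.range m, gap i| ≤ ε * n

/-- The lowest ask started from the zero state is in exactly one of the bins up to `hi`, so the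
plain sum is a bounded number of visit sums. -/
lemma UnifLaw.total {lo hi : ℕ} {c : ℕ → ℕ ⊕ ℕ} {y : ℕ → ℝ}
    (h : UnifLaw lo hi c y) (C : ℕ) {ε : ℝ} (hε : 0 < ε) :
    ∀ᶠ n : ℕ in atTop, ∀ m ≤ C * n, |∑ j ∈ Finset.range m, y j| ≤ ε * n := by
  filter_upwards [h C (ε / (hi + 1)) (by positivity)] with n hn m hm
  have h1 := hn 0 (by simp) m hm
  have h2 : ∑ j ∈ Finset.range m, y j = ∑ k ∈ Finset.range (hi + 1), ∑ j ∈ Finset.range m,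
      if netAsk lo hi (netChain lo hi 0 c j) = k then y j else 0 := by
    rw [Finset.sum_comm]
    refine Finset.sum_congr rfl fun j _ => ?_
    rw [Finset.sum_ite_eq, if_pos]
    exact Finset.mem_range.2 (Nat.lt_succ_of_le (netAsk_le _))
  rw [h2]
  refine (Finset.abs_sum_le_sum_abs _ _).trans ((Finset.sum_le_sum fun k _ => (h1 k).1).trans ?_)
  rw [Finset.sum_const, Finset.card_range, nsmul_eq_mul]
  push_cast
  exact le_of_eq (by field_simp)

namespace Timing

variable {gap : ℕ → ℝ}

lemma strictMono (h : Timing gap) : StrictMono fun m => ∑ i ∈ Finset.range m, gap i :=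
  strictMono_nat_of_lt_succ fun m => by
    rw [Finset.sum_range_succ]; linarith [h.pos m]

lemma tendsto (h : Timing gap) : Tendsto (fun m => ∑ i ∈ Finset.range m, gap i) atTop atTop := by
  have h1 : Tendsto (fun n : ℕ => (n : ℝ) * (1 / 4)) atTop atTop :=
    tendsto_natCast_atTop_atTop.atTop_mul_const (by norm_num)
  refine tendsto_atTop_mono' _ ?_ h1
  filter_upwards [h.law 1 (1 / 2) (by norm_num)] with n hn
  have := (abs_le.1 (hn n (by omega))).2
  linarith

/-- Arrival times increase strictly to infinity, so the arrivals up to `t` form a finite initial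
segment and `ncard` takes no default value. -/
lemma lt_arrivals_iff (h : Timing gap) (t : ℝ) (j : ℕ) :
    j < arrivals gap t ↔ arrivalTime gap j ≤ t := by
  have hex : ∃ j, t < arrivalTime gap j :=
    ((h.tendsto.comp (tendsto_add_atTop_nat 1)).eventually_gt_atTop t).exists
  have hmono : StrictMono (arrivalTime gap) := fun i j hij => h.strictMono (Nat.succ_lt_succ hij)
  classical
  have h1 : {j | arrivalTime gap j ≤ t} = Set.Iio (Nat.find hex) := by
    ext i
    simp only [Set.mem_ofPred_eq, Set.mem_Iio, Nat.lt_find_iff, not_lt]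
    exact ⟨fun hi m hm => (hmono.monotone hm).trans hi, fun hi => hi i le_rfl⟩
  have h2 : arrivals gap t = Nat.find hex := by
    rw [arrivals, h1, Set.ncard_eq_toFinset_card', Set.toFinset_Iio, Nat.card_Iio]
  rw [h2]
  exact (Set.ext_iff.1 h1 j).symm

lemma arrivals_eq (h : Timing gap) {t : ℝ} {m : ℕ} (h1 : ∑ i ∈ Finset.range m, gap i ≤ t)
    (h2 : t < ∑ i ∈ Finset.range (m + 1), gap i) : arrivals gap t = m := by
  apply le_antisymm
  · by_contra h3
    exact absurd ((h.lt_arrivals_iff t m).1 (not_le.1 h3)) (not_le.2 h2)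
  · rcases m with _ | m
    · exact Nat.zero_le _
    · exact (h.lt_arrivals_iff t m).2 h1

lemma le_of_nonneg (h : Timing gap) {t : ℝ} (ht : 0 ≤ t) :
    ∑ i ∈ Finset.range (arrivals gap t), gap i ≤ t := by
  rcases h1 : arrivals gap t with _ | m
  · simpa using ht
  · exact (h.lt_arrivals_iff t m).1 (by omega)

lemma lt_sum (h : Timing gap) (t : ℝ) : t < ∑ i ∈ Finset.range (arrivals gap t + 1), gap i :=
  not_le.1 fun h1 => lt_irrefl _ ((h.lt_arrivals_iff t _).2 h1)

lemma arrivals_zero (h : Timing gap) : arrivals gap 0 = 0 :=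
  h.arrivals_eq (by simp) (by simpa using h.pos 0)

lemma monotone_arrivals (h : Timing gap) : Monotone (arrivals gap) := by
  intro s t hst
  by_contra h1
  exact lt_irrefl _ ((h.lt_arrivals_iff t _).2
    (((h.lt_arrivals_iff s _).1 (not_le.1 h1)).trans hst))

lemma eventually_arrivals_le (h : Timing gap) (T : ℝ) :
    ∃ C : ℕ, ∀ᶠ n : ℕ in atTop, ∀ t ∈ Set.Icc 0 T, arrivals gap (n * t) < C * n := by
  -- By the law with error `n`, the first `C n` arrivals take time at least `(C - 1) n / 2`, which
  -- exceeds `n T`.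
  obtain ⟨C, hC⟩ := exists_nat_gt (2 * T + 1)
  refine ⟨C, ?_⟩
  filter_upwards [h.law C 1 one_pos, eventually_ge_atTop 1] with n hn hn1 t ht
  by_contra hcon
  have h1 := (abs_le.1 (hn _ le_rfl)).2
  have h2 : (0 : ℝ) < n := by exact_mod_cast hn1
  have h3 : ∑ i ∈ Finset.range (C * n), gap i ≤ n * t :=
    (h.strictMono.monotone (not_lt.1 hcon)).trans (h.le_of_nonneg (mul_nonneg h2.le ht.1))
  push_cast at h1
  have h4 : (n : ℝ) * t ≤ n * T := mul_le_mul_of_nonneg_left ht.2 h2.le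
  have h5 : (2 * T + 1) * n < C * n := mul_lt_mul_of_pos_right hC h2
  linarith

/-- Two consecutive instances of the law differ by `1 - 2 * gap m`, so no single gap is of order
`n`. -/
lemma eventually_gap_le (h : Timing gap) (C : ℕ) {ε : ℝ} (hε : 0 < ε) :
    ∀ᶠ n : ℕ in atTop, ∀ m < C * n, gap m ≤ ε * n := by
  filter_upwards [h.law C (ε / 2) (by positivity), eventually_ge_atTop (Nat.ceil ε⁻¹)]
    with n hn hn1 m hm
  have h1 := (abs_le.1 (hn m hm.le)).2
  have h2 := (abs_le.1 (hn (m + 1) hm)).1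
  rw [Finset.sum_range_succ] at h2
  push_cast at h2
  have h3 : ε⁻¹ ≤ n := (Nat.le_ceil _).trans (by exact_mod_cast hn1)
  have h4 : 1 ≤ ε * n := by
    rw [inv_le_iff_one_le_mul₀ hε] at h3; linarith
  linarith

/-- A function of the state, along time, is integrable on bounded intervals. -/
lemma intervalIntegrable (h : Timing gap) {f : ℕ → ℝ} {K : ℝ} (hf : ∀ j, |f j| ≤ K) (s t : ℝ) :
    IntervalIntegrable (fun u => f (arrivals gap u)) volume s t := by
  have hm : Measurable fun u => f (arrivals gap u) :=
    (measurable_from_top (f := f)).comp h.monotone_arrivals.measurable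
  exact intervalIntegrable_const (c := K) |>.mono_fun hm.aestronglyMeasurable
    (ae_of_all _ fun u => by
      change |f _| ≤ |K|
      exact (hf _).trans (le_abs_self K))

lemma integral_arrivals_of_mem (h : Timing gap) (f : ℕ → ℝ) {m : ℕ} {t : ℝ}
    (h1 : ∑ i ∈ Finset.range m, gap i ≤ t) (h2 : t ≤ ∑ i ∈ Finset.range (m + 1), gap i) :
    ∫ u in (∑ i ∈ Finset.range m, gap i)..t, f (arrivals gap u) =
      (t - ∑ i ∈ Finset.range m, gap i) * f m := by
  have h3 : ∫ u in (∑ i ∈ Finset.range m, gap i)..t, f (arrivals gap u) =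
      ∫ u in (∑ i ∈ Finset.range m, gap i)..t, f m := by
    rw [intervalIntegral.integral_of_le h1, intervalIntegral.integral_of_le h1,
      ← integral_Ico_eq_integral_Ioc, ← integral_Ico_eq_integral_Ioc]
    refine setIntegral_congr_fun measurableSet_Ico fun u hu => ?_
    rw [h.arrivals_eq hu.1 (hu.2.trans_le h2)]
  rw [h3, intervalIntegral.integral_const, smul_eq_mul]

/-- The state after `j` orders lasts exactly for the gap that precedes order `j`. -/
lemma integral_arrivals_sum (h : Timing gap) {f : ℕ → ℝ} {K : ℝ} (hf : ∀ j, |f j| ≤ K) (m : ℕ) :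
    ∫ u in (0 : ℝ)..∑ i ∈ Finset.range m, gap i, f (arrivals gap u) =
      ∑ j ∈ Finset.range m, gap j * f j := by
  induction m with
  | zero => simp
  | succ m ih =>
    rw [← intervalIntegral.integral_add_adjacent_intervals (h.intervalIntegrable hf _ _)
      (h.intervalIntegrable hf (∑ i ∈ Finset.range m, gap i) _), ih,
      h.integral_arrivals_of_mem f (h.strictMono (Nat.lt_succ_self m)).le le_rfl,
      Finset.sum_range_succ (fun j => gap j * f j)]
    simp only [Nat.succ_eq_add_one, Finset.sum_range_succ gap, add_sub_cancel_left]

/-- The time integral of a function of the state. -/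
lemma integral_arrivals (h : Timing gap) {f : ℕ → ℝ} {K : ℝ} (hf : ∀ j, |f j| ≤ K) {t : ℝ}
    (ht : 0 ≤ t) :
    ∫ u in (0 : ℝ)..t, f (arrivals gap u) = ∑ j ∈ Finset.range (arrivals gap t), gap j * f j +
      (t - ∑ i ∈ Finset.range (arrivals gap t), gap i) * f (arrivals gap t) := by
  rw [← intervalIntegral.integral_add_adjacent_intervals (h.intervalIntegrable hf _ _)
      (h.intervalIntegrable hf (∑ i ∈ Finset.range (arrivals gap t), gap i) _),
      h.integral_arrivals_sum hf,
      h.integral_arrivals_of_mem f (h.le_of_nonneg ht) (h.lt_sum t).le]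

/-- The compensator summed over visits is the local time up to the last arrival; the second `δ` pays
for the unfinished gap. -/
lemma abs_sum_sub_integral_le (h : Timing gap) (I : ℕ → Prop) [DecidablePred I] {x : ℕ → ℝ}
    {p : ℝ} (hp : 0 ≤ p) {t δ : ℝ} (ht : 0 ≤ t)
    (h1 : |∑ j ∈ Finset.range (arrivals gap t), if I j then x j - p * gap j else 0| ≤ δ)
    (h2 : p * gap (arrivals gap t) ≤ δ) :
    |(∑ j ∈ Finset.range (arrivals gap t), if I j then x j else 0) -
      p * ∫ u in (0 : ℝ)..t, if I (arrivals gap u) then 1 else 0| ≤ 2 * δ := by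
  have h3 := h.integral_arrivals (f := fun j => if I j then 1 else 0) (K := 1)
    (fun j => by split_ifs <;> simp) ht
  set m := arrivals gap t with hm
  have h4 : (∑ j ∈ Finset.range m, if I j then x j - p * gap j else 0) =
      (∑ j ∈ Finset.range m, if I j then x j else 0) -
        p * ∑ j ∈ Finset.range m, gap j * (if I j then 1 else 0) := by
    rw [Finset.mul_sum, ← Finset.sum_sub_distrib]
    exact Finset.sum_congr rfl fun j _ => by split_ifs <;> simp
  have h5 := h.le_of_nonneg ht
  have h6 := h.lt_sum t
  rw [Finset.sum_range_succ] at h6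
  rw [← hm] at h5 h6
  have h7 : |p * ((t - ∑ i ∈ Finset.range m, gap i) * (if I m then 1 else 0))| ≤ δ := by
    rw [abs_of_nonneg (by split_ifs <;> [positivity; simp]) ]
    · refine le_trans (mul_le_mul_of_nonneg_left ?_ hp) h2
      split_ifs
      · linarith
      · simpa using (h.pos m).le
  rw [h3]
  rw [h4] at h1
  rw [abs_le] at h1 h7 ⊢
  constructor <;> linarith

lemma eventually_visits (h : Timing gap) {lo hi : ℕ} {c : ℕ → ℕ ⊕ ℕ} {x : ℕ → ℝ} {p : ℝ}
    (hp : 0 ≤ p) (hU : UnifLaw lo hi c fun j => x j - p * gap j) (T : ℝ) {ε : ℝ} (hε : 0 < ε) :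
    ∀ᶠ n : ℕ in atTop, ∀ ν : ℕ → ℤ, (∀ k ∈ Finset.Ioo lo hi, |ν k| ≤ n) → ∀ t ∈ Set.Icc 0 T, ∀ k,
      |(∑ j ∈ Finset.range (arrivals gap (n * t)),
          if netAsk lo hi (netChain lo hi ν c j) = k then x j else 0) -
        p * ∫ u in (0 : ℝ)..n * t,
          if netAsk lo hi (netChain lo hi ν c (arrivals gap u)) = k then 1 else 0| ≤ ε * n ∧
      |(∑ j ∈ Finset.range (arrivals gap (n * t)),
          if netBid lo hi (netChain lo hi ν c j) = k then x j else 0) -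
        p * ∫ u in (0 : ℝ)..n * t,
          if netBid lo hi (netChain lo hi ν c (arrivals gap u)) = k then 1 else 0| ≤ ε * n := by
  obtain ⟨C, hC⟩ := h.eventually_arrivals_le T
  filter_upwards [hC, hU C (ε / 2) (by positivity),
    h.eventually_gap_le C (ε := ε / (2 * (p + 1))) (by positivity)] with n h1 h2 h3 ν hν t ht k
  have h4 := h1 t ht
  have hnt : 0 ≤ (n : ℝ) * t := mul_nonneg (Nat.cast_nonneg n) ht.1
  have h5 : p * gap (arrivals gap (n * t)) ≤ ε / 2 * n := by
    calc p * gap (arrivals gap (n * t)) ≤ (p + 1) * (ε / (2 * (p + 1)) * n) :=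
          mul_le_mul (by linarith) (h3 _ h4) (h.pos _).le (by positivity)
      _ = ε / 2 * n := by field_simp
  have h6 := h2 ν hν _ h4.le k
  have h7 : ε * n = 2 * (ε / 2 * n) := by ring
  rw [h7]
  exact ⟨h.abs_sum_sub_integral_le _ hp hnt h6.1 h5, h.abs_sum_sub_integral_le _ hp hnt h6.2 h5⟩

end Timing

end

section

/-! ### Approximate balance equations -/

variable {N : ℕ}

/-- A typical realization of the order flow. -/
structure Sample (b : Binning N) (pb pa : ℕ → ℝ) (gap : ℕ → ℝ) (o : ℕ → Order) : Prop where
  timing : Timing gap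
  bid_law : ∀ lo hi, lo < hi → hi ≤ N + 1 → ∀ k, UnifLaw lo hi (fun j => code b (o j))
    fun j => (if code b (o j) = Sum.inl k then 1 else 0) - pb k * gap j
  ask_law : ∀ lo hi, lo < hi → hi ≤ N + 1 → ∀ k, UnifLaw lo hi (fun j => code b (o j))
    fun j => (if code b (o j) = Sum.inr k then 1 else 0) - pa k * gap j
  pb_nonneg : ∀ k, 0 ≤ pb k
  pa_nonneg : ∀ k, 0 ≤ pa k

lemma code_eq_inl_iff (b : Binning N) (o : Order) (k : ℕ) :
    code b o = Sum.inl k ↔ ∃ p, o = Sum.inl p ∧ b.idx p = k := by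
  rcases o with p | q <;> simp [code]

lemma code_eq_inr_iff (b : Binning N) (o : Order) (k : ℕ) :
    code b o = Sum.inr k ↔ ∃ q, o = Sum.inr q ∧ b.idx q = k := by
  rcases o with p | q <;> simp [code]

section Path

variable {b : Binning N} {gap : ℕ → ℝ} {o : ℕ → Order}

lemma Timing.ncard_eq_sum (h : Timing gap) (t : ℝ) (p : ℕ → Prop) [DecidablePred p] :
    ({j | arrivalTime gap j ≤ t ∧ p j}.ncard : ℝ) =
      ∑ j ∈ Finset.range (arrivals gap t), if p j then (1 : ℝ) else 0 := by
  have h1 : {j | arrivalTime gap j ≤ t ∧ p j} =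
      ((Finset.range (arrivals gap t)).filter p : Set ℕ) := by
    ext j
    simp [h.lt_arrivals_iff]
  rw [h1, Set.ncard_coe_finset, Finset.sum_boole]

lemma lobPath_B (h : Timing gap) (s : Book) (k : ℕ) (t : ℝ) :
    (lobPath b s gap o).B k t = ∑ j ∈ Finset.range (arrivals gap t),
      if code b (o j) = Sum.inl k then (1 : ℝ) else 0 := by
  rw [← h.ncard_eq_sum]
  simp only [code_eq_inl_iff]
  rfl

lemma lobPath_A (h : Timing gap) (s : Book) (k : ℕ) (t : ℝ) :
    (lobPath b s gap o).A k t = ∑ j ∈ Finset.range (arrivals gap t),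
      if code b (o j) = Sum.inr k then (1 : ℝ) else 0 := by
  rw [← h.ncard_eq_sum]
  simp only [code_eq_inr_iff]
  rfl

variable {lo hi : ℕ} {s : Book}

/-- Exact flow balance, decomposed by the bin of a best price so that every inner sum is a visit sum
controlled by the uniform law. Bids join while the lowest ask is above `k`; asks from bins up to `k`
remove bids while the highest bid is in `k`. -/
lemma Regular.sum_bidQueue (h : Regular b lo hi s) (o : ℕ → Order) {k : ℕ}
    (hk : k ∈ Finset.Ioo lo hi) (m : ℕ) :
    (((bookAfter b s o m).bidQueue b k).toNat : ℝ) = ((s.bidQueue b k).toNat : ℝ) +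
      (∑ a ∈ Finset.Ioc k hi, ∑ j ∈ Finset.range m, if (bookAfter b s o j).askBin b = a then
        (if code b (o j) = Sum.inl k then 1 else 0) else 0) -
      ∑ q ∈ Finset.Icc 1 k, ∑ j ∈ Finset.range m, if (bookAfter b s o j).bidBin b = k then
        (if code b (o j) = Sum.inr q then 1 else 0) else 0 := by
  induction m with
  | zero => simp [bookAfter]
  | succ m ih =>
    have h1 := (h.after o m).toNat_bidQueue_step (o m) hk
    have h2 : (∑ a ∈ Finset.Ioc k hi, if (bookAfter b s o m).askBin b = a then
        (if code b (o m) = Sum.inl k then (1 : ℝ) else 0) else 0) =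
        if code b (o m) = Sum.inl k ∧ k < (bookAfter b s o m).askBin b then 1 else 0 := by
      rw [Finset.sum_ite_eq]
      have := (h.after o m).askBin_le_hi
      simp only [Finset.mem_Ioc, this, and_true]
      split_ifs <;> simp_all
    have h3 : (∑ q ∈ Finset.Icc 1 k, if (bookAfter b s o m).bidBin b = k then
        (if code b (o m) = Sum.inr q then (1 : ℝ) else 0) else 0) =
        ∑ q ∈ Finset.Icc 1 k, if code b (o m) = Sum.inr q ∧ (bookAfter b s o m).bidBin b = k
          then 1 else 0 := by
      refine Finset.sum_congr rfl fun q _ => ?_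
      split_ifs <;> simp_all
    have h4 := congrArg (Nat.cast (R := ℝ)) h1
    push_cast at h4
    simp only [Finset.sum_range_succ, Finset.sum_add_distrib, bookAfter]
    rw [h2, h3]
    linarith

lemma Regular.sum_askQueue (h : Regular b lo hi s) (o : ℕ → Order) {k : ℕ}
    (hk : k ∈ Finset.Ioo lo hi) (m : ℕ) :
    (((bookAfter b s o m).askQueue b k).toNat : ℝ) = ((s.askQueue b k).toNat : ℝ) +
      (∑ a ∈ Finset.Ico lo k, ∑ j ∈ Finset.range m, if (bookAfter b s o j).bidBin b = a then
        (if code b (o j) = Sum.inr k then 1 else 0) else 0) -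
      ∑ p ∈ Finset.Icc k N, ∑ j ∈ Finset.range m, if (bookAfter b s o j).askBin b = k then
        (if code b (o j) = Sum.inl p then 1 else 0) else 0 := by
  induction m with
  | zero => simp [bookAfter]
  | succ m ih =>
    have h1 := (h.after o m).toNat_askQueue_step (o m) hk
    have h2 : (∑ a ∈ Finset.Ico lo k, if (bookAfter b s o m).bidBin b = a then
        (if code b (o m) = Sum.inr k then (1 : ℝ) else 0) else 0) =
        if code b (o m) = Sum.inr k ∧ (bookAfter b s o m).bidBin b < k then 1 else 0 := by
      rw [Finset.sum_ite_eq]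
      have := (h.after o m).lo_le_bidBin
      simp only [Finset.mem_Ico, this, true_and]
      split_ifs <;> simp_all
    have h3 : (∑ p ∈ Finset.Icc k N, if (bookAfter b s o m).askBin b = k then
        (if code b (o m) = Sum.inl p then (1 : ℝ) else 0) else 0) =
        ∑ p ∈ Finset.Icc k N, if code b (o m) = Sum.inl p ∧ (bookAfter b s o m).askBin b = k
          then 1 else 0 := by
      refine Finset.sum_congr rfl fun q _ => ?_
      split_ifs <;> simp_all
    have h4 := congrArg (Nat.cast (R := ℝ)) h1
    push_cast at h4
    simp only [Finset.sum_range_succ, Finset.sum_add_distrib, bookAfter]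
    rw [h2, h3]
    linarith

lemma bookAt_zero (h : Timing gap) (s : Book) : bookAt b s gap o 0 = s := by
  rw [bookAt, h.arrivals_zero, bookAfter]

lemma lobPath_Tβ (s : Book) (k : ℕ) (t : ℝ) :
    (lobPath b s gap o).Tβ k t = ∫ u in (0 : ℝ)..t,
      if (bookAfter b s o (arrivals gap u)).bidBin b = k then 1 else 0 := rfl

lemma lobPath_Tα (s : Book) (k : ℕ) (t : ℝ) :
    (lobPath b s gap o).Tα k t = ∫ u in (0 : ℝ)..t,
      if (bookAfter b s o (arrivals gap u)).askBin b = k then 1 else 0 := rfl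

lemma abs_sum_le_card_mul {ι : Type*} (S : Finset ι) {f : ι → ℝ} {e : ℝ}
    (h : ∀ i ∈ S, |f i| ≤ e) : |∑ i ∈ S, f i| ≤ S.card * e := by
  refine (Finset.abs_sum_le_sum_abs _ _).trans ((Finset.sum_le_sum h).trans ?_)
  rw [Finset.sum_const, nsmul_eq_mul]

/-- Visits of the highest bid and the lowest ask to bins, uniformly over the initial states. -/
lemma eventually_visits_book (ht : Timing gap) (hhi : hi ≤ N + 1) {x : ℕ → ℝ}
    {p : ℝ} (hp : 0 ≤ p) (hU : UnifLaw lo hi (fun j => code b (o j)) fun j => x j - p * gap j)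
    (T : ℝ) {ε : ℝ} (hε : 0 < ε) :
    ∀ᶠ n : ℕ in atTop, ∀ s, InitialState b lo hi n s → ∀ t ∈ Set.Icc 0 T, ∀ k,
      |(∑ j ∈ Finset.range (arrivals gap (n * t)),
          if (bookAfter b s o j).askBin b = k then x j else 0) -
        p * (lobPath b s gap o).Tα k (n * t)| ≤ ε * n ∧
      |(∑ j ∈ Finset.range (arrivals gap (n * t)),
          if (bookAfter b s o j).bidBin b = k then x j else 0) -
        p * (lobPath b s gap o).Tβ k (n * t)| ≤ ε * n := by
  filter_upwards [ht.eventually_visits hp hU T hε] with n hn s hs t ht k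
  have h1 := hn (net b s) hs.abs_net_le t ht k
  simp only [lobPath_Tα, lobPath_Tβ, hs.regular.askBin_bookAfter hhi,
    hs.regular.bidBin_bookAfter hhi]
  exact h1

variable {pb pa : ℕ → ℝ}

lemma Sample.balance_Qb (h : Sample b pb pa gap o) (hlh : lo < hi) (hhi : hi ≤ N + 1) {k : ℕ}
    (hk : k ∈ Finset.Ioo lo hi) (T : ℝ) {ε : ℝ} (hε : 0 < ε) :
    ∀ᶠ n : ℕ in atTop, ∀ s, InitialState b lo hi n s → ∀ t ∈ Set.Icc 0 T,
      |((lobPath b s gap o).scale n).Qb k t - (((lobPath b s gap o).scale n).Qb k 0 +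
        (pb k * ∑ a ∈ Finset.Ioc k hi, ((lobPath b s gap o).scale n).Tα a t) -
        ((lobPath b s gap o).scale n).Tβ k t * ∑ q ∈ Finset.Icc 1 k, pa q)| ≤ ε := by
  -- The error is shared among the bins above `k` up to `hi` and the `k` bins of arriving asks.
  set e := ε / (hi + k + 1) with he
  have he0 : 0 < e := by positivity
  have h2 : ∀ᶠ n : ℕ in atTop, ∀ q ∈ Finset.Icc 1 k,
      ∀ s, InitialState b lo hi n s → ∀ t ∈ Set.Icc 0 T, ∀ k,
      |(∑ j ∈ Finset.range (arrivals gap (n * t)),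
          if (bookAfter b s o j).askBin b = k then
            (if code b (o j) = Sum.inr q then 1 else 0) else 0) -
        pa q * (lobPath b s gap o).Tα k (n * t)| ≤ e * n ∧
      |(∑ j ∈ Finset.range (arrivals gap (n * t)),
          if (bookAfter b s o j).bidBin b = k then
            (if code b (o j) = Sum.inr q then 1 else 0) else 0) -
        pa q * (lobPath b s gap o).Tβ k (n * t)| ≤ e * n :=
    (Filter.eventually_all_finset _).2 fun q _ =>
      eventually_visits_book h.timing hhi (h.pa_nonneg q) (h.ask_law lo hi hlh hhi q) T he0
  filter_upwards [eventually_visits_book h.timing hhi (h.pb_nonneg k) (h.bid_law lo hi hlh hhi k)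
    T he0, h2, eventually_ge_atTop 1] with n h1 h2 hn1 s hs t ht
  have hn : (0 : ℝ) < n := by exact_mod_cast hn1
  have h3 := hs.regular.sum_bidQueue o hk (arrivals gap (n * t))
  have h4 := abs_sum_le_card_mul (Finset.Ioc k hi) fun a _ => (h1 s hs t ht a).1
  have h5 := abs_sum_le_card_mul (Finset.Icc 1 k) fun q hq => (h2 q hq s hs t ht k).2
  rw [Finset.sum_sub_distrib, ← Finset.mul_sum] at h4
  rw [Finset.sum_sub_distrib, ← Finset.sum_mul] at h5
  have h6 : (Finset.Ioc k hi).card * (e * n) + (Finset.Icc 1 k).card * (e * n) ≤ ε * n := by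
    rw [← add_mul, ← mul_assoc]
    refine mul_le_mul_of_nonneg_right ?_ hn.le
    have : (((Finset.Ioc k hi).card : ℝ) + (Finset.Icc 1 k).card) ≤ hi + k + 1 := by
      have h7 : (Finset.Ioc k hi).card + (Finset.Icc 1 k).card ≤ hi + k + 1 := by
        simp only [Nat.card_Ioc, Nat.card_Icc]; omega
      exact_mod_cast h7
    calc _ ≤ ((hi : ℝ) + k + 1) * e := mul_le_mul_of_nonneg_right this he0.le
      _ = ε := by rw [he]; field_simp
  have h7 : (lobPath b s gap o).Qb k (n * t) =
      (((bookAfter b s o (arrivals gap (n * t))).bidQueue b k).toNat : ℝ) := rfl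
  have h8 : (lobPath b s gap o).Qb k 0 = ((s.bidQueue b k).toNat : ℝ) := by
    change (((bookAt b s gap o 0).bidQueue b k).toNat : ℝ) = _
    rw [bookAt_zero h.timing]
  simp only [Path.scale, mul_zero, ← Finset.mul_sum]
  have h9 : |(lobPath b s gap o).Qb k (n * t) - ((lobPath b s gap o).Qb k 0 +
      pb k * ∑ a ∈ Finset.Ioc k hi, (lobPath b s gap o).Tα a (n * t) -
      (∑ q ∈ Finset.Icc 1 k, pa q) * (lobPath b s gap o).Tβ k (n * t))| ≤ ε * n := by
    rw [h7, h8, h3]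
    rw [abs_le] at h4 h5 ⊢
    constructor <;> linarith
  rw [← mul_le_mul_iff_right₀ hn, ← abs_of_pos hn, ← abs_mul, abs_of_pos hn]
  refine le_trans (le_of_eq (congrArg _ ?_)) (h9.trans_eq (mul_comm _ _))
  field_simp

lemma Sample.balance_Qa (h : Sample b pb pa gap o) (hlh : lo < hi) (hhi : hi ≤ N + 1) {k : ℕ}
    (hk : k ∈ Finset.Ioo lo hi) (T : ℝ) {ε : ℝ} (hε : 0 < ε) :
    ∀ᶠ n : ℕ in atTop, ∀ s, InitialState b lo hi n s → ∀ t ∈ Set.Icc 0 T,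
      |((lobPath b s gap o).scale n).Qa k t - (((lobPath b s gap o).scale n).Qa k 0 +
        (pa k * ∑ a ∈ Finset.Ico lo k, ((lobPath b s gap o).scale n).Tβ a t) -
        ((lobPath b s gap o).scale n).Tα k t * ∑ p ∈ Finset.Icc k N, pb p)| ≤ ε := by
  set e := ε / (N + k + 1) with he
  have he0 : 0 < e := by positivity
  have h2 : ∀ᶠ n : ℕ in atTop, ∀ q ∈ Finset.Icc k N,
      ∀ s, InitialState b lo hi n s → ∀ t ∈ Set.Icc 0 T, ∀ k,
      |(∑ j ∈ Finset.range (arrivals gap (n * t)),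
          if (bookAfter b s o j).askBin b = k then
            (if code b (o j) = Sum.inl q then 1 else 0) else 0) -
        pb q * (lobPath b s gap o).Tα k (n * t)| ≤ e * n ∧
      |(∑ j ∈ Finset.range (arrivals gap (n * t)),
          if (bookAfter b s o j).bidBin b = k then
            (if code b (o j) = Sum.inl q then 1 else 0) else 0) -
        pb q * (lobPath b s gap o).Tβ k (n * t)| ≤ e * n :=
    (Filter.eventually_all_finset _).2 fun q _ =>
      eventually_visits_book h.timing hhi (h.pb_nonneg q) (h.bid_law lo hi hlh hhi q) T he0
  filter_upwards [eventually_visits_book h.timing hhi (h.pa_nonneg k) (h.ask_law lo hi hlh hhi k)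
    T he0, h2, eventually_ge_atTop 1] with n h1 h2 hn1 s hs t ht
  have hn : (0 : ℝ) < n := by exact_mod_cast hn1
  have h3 := hs.regular.sum_askQueue o hk (arrivals gap (n * t))
  have h4 := abs_sum_le_card_mul (Finset.Ico lo k) fun a _ => (h1 s hs t ht a).2
  have h5 := abs_sum_le_card_mul (Finset.Icc k N) fun q hq => (h2 q hq s hs t ht k).1
  rw [Finset.sum_sub_distrib, ← Finset.mul_sum] at h4
  rw [Finset.sum_sub_distrib, ← Finset.sum_mul] at h5
  have h6 : (Finset.Ico lo k).card * (e * n) + (Finset.Icc k N).card * (e * n) ≤ ε * n := by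
    rw [← add_mul, ← mul_assoc]
    refine mul_le_mul_of_nonneg_right ?_ hn.le
    have : (((Finset.Ico lo k).card : ℝ) + (Finset.Icc k N).card) ≤ N + k + 1 := by
      have h7 : (Finset.Ico lo k).card + (Finset.Icc k N).card ≤ N + k + 1 := by
        simp only [Nat.card_Ico, Nat.card_Icc]; omega
      exact_mod_cast h7
    calc _ ≤ ((N : ℝ) + k + 1) * e := mul_le_mul_of_nonneg_right this he0.le
      _ = ε := by rw [he]; field_simp
  have h7 : (lobPath b s gap o).Qa k (n * t) =
      (((bookAfter b s o (arrivals gap (n * t))).askQueue b k).toNat : ℝ) := rfl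
  have h8 : (lobPath b s gap o).Qa k 0 = ((s.askQueue b k).toNat : ℝ) := by
    change (((bookAt b s gap o 0).askQueue b k).toNat : ℝ) = _
    rw [bookAt_zero h.timing]
  simp only [Path.scale, mul_zero, ← Finset.mul_sum]
  have h9 : |(lobPath b s gap o).Qa k (n * t) - ((lobPath b s gap o).Qa k 0 +
      pa k * ∑ a ∈ Finset.Ico lo k, (lobPath b s gap o).Tβ a (n * t) -
      (∑ q ∈ Finset.Icc k N, pb q) * (lobPath b s gap o).Tα k (n * t))| ≤ ε * n := by
    rw [h7, h8, h3]
    rw [abs_le] at h4 h5 ⊢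
    constructor <;> linarith
  rw [← mul_le_mul_iff_right₀ hn, ← abs_of_pos hn, ← abs_mul, abs_of_pos hn]
  refine le_trans (le_of_eq (congrArg _ ?_)) (h9.trans_eq (mul_comm _ _))
  field_simp

lemma Timing.eventually_count (h : Timing gap) {x : ℕ → ℝ} {p : ℝ} (hp : 0 ≤ p) {c : ℕ → ℕ ⊕ ℕ}
    (hU : UnifLaw lo hi c fun j => x j - p * gap j) (T : ℝ) {ε : ℝ} (hε : 0 < ε) :
    ∀ᶠ n : ℕ in atTop, ∀ t ∈ Set.Icc 0 T,
      |(n : ℝ)⁻¹ * (∑ j ∈ Finset.range (arrivals gap (n * t)), x j) - p * t| ≤ ε := by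
  obtain ⟨C, hC⟩ := h.eventually_arrivals_le T
  filter_upwards [hC, hU.total C (ε := ε / 2) (by positivity),
    h.eventually_gap_le C (ε := ε / (2 * (p + 1))) (by positivity), eventually_ge_atTop 1]
    with n h1 h2 h3 hn1 t ht
  have h4 := h1 t ht
  have hn : (0 : ℝ) < n := by exact_mod_cast hn1
  have h5 : p * gap (arrivals gap (n * t)) ≤ ε / 2 * n := by
    calc p * gap (arrivals gap (n * t)) ≤ (p + 1) * (ε / (2 * (p + 1)) * n) :=
          mul_le_mul (by linarith) (h3 _ h4) (h.pos _).le (by positivity)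
      _ = ε / 2 * n := by field_simp
  -- With the condition that is always true, the local time is the elapsed time.
  have h6 := h.abs_sum_sub_integral_le (fun _ => True) hp (mul_nonneg hn.le ht.1)
    (by simpa using h2 _ h4.le) h5
  simp only [if_true, intervalIntegral.integral_const, smul_eq_mul, mul_one, sub_zero] at h6
  rw [← mul_le_mul_iff_right₀ hn, ← abs_of_pos hn, ← abs_mul, abs_of_pos hn]
  refine le_trans (le_of_eq (congrArg _ ?_)) (h6.trans_eq (by ring))
  field_simp

lemma Sample.balance_B (h : Sample b pb pa gap o) (k : ℕ) (T : ℝ) {ε : ℝ} (hε : 0 < ε) :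
    ∀ᶠ n : ℕ in atTop, ∀ s, ∀ t ∈ Set.Icc 0 T,
      |((lobPath b s gap o).scale n).B k t - pb k * t| ≤ ε := by
  filter_upwards [h.timing.eventually_count (h.pb_nonneg k)
    (h.bid_law 0 (N + 1) (by omega) le_rfl k) T hε] with n hn s t ht
  rw [Path.scale]
  simp only [lobPath_B h.timing]
  exact hn t ht

lemma Sample.balance_A (h : Sample b pb pa gap o) (k : ℕ) (T : ℝ) {ε : ℝ} (hε : 0 < ε) :
    ∀ᶠ n : ℕ in atTop, ∀ s, ∀ t ∈ Set.Icc 0 T,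
      |((lobPath b s gap o).scale n).A k t - pa k * t| ≤ ε := by
  filter_upwards [h.timing.eventually_count (h.pa_nonneg k)
    (h.ask_law 0 (N + 1) (by omega) le_rfl k) T hε] with n hn s t ht
  rw [Path.scale]
  simp only [lobPath_A h.timing]
  exact hn t ht

end Path

end

section

/-! ### Uniform convergence on compacts -/

section UOC

variable {f f' : ℕ → ℝ → ℝ} {g g' : ℝ → ℝ}

lemma uoc_iff : UOC f g ↔
    ∀ T : ℝ, ∀ ε > 0, ∀ᶠ n in atTop, ∀ t ∈ Set.Icc 0 T, |f n t - g t| ≤ ε := by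
  simp only [UOC, Metric.tendstoUniformlyOn_iff, dist_comm (g _), Real.dist_eq]
  refine forall_congr' fun T => ⟨fun h ε hε => ?_, fun h ε hε => ?_⟩
  · exact (h ε hε).mono fun n hn t ht => (hn t ht).le
  · exact (h (ε / 2) (half_pos hε)).mono fun n hn t ht => (hn t ht).trans_lt (half_lt_self hε)

lemma UOC.tendsto (h : UOC f g) {t : ℝ} (ht : 0 ≤ t) : Tendsto (fun n => f n t) atTop (𝓝 (g t)) :=
  (h t).tendsto_at (Set.right_mem_Icc.2 ht)

lemma UOC.of_approx (h : UOC f g)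
    (hf : ∀ T : ℝ, ∀ ε > 0, ∀ᶠ n in atTop, ∀ t ∈ Set.Icc 0 T, |f' n t - f n t| ≤ ε) :
    UOC f' g := by
  rw [uoc_iff] at h ⊢
  intro T ε hε
  filter_upwards [h T (ε / 2) (by positivity), hf T (ε / 2) (by positivity)] with n h1 h2 t ht
  have h3 := abs_sub_le (f' n t) (f n t) (g t)
  linarith [h1 t ht, h2 t ht]

lemma UOC.add (h : UOC f g) (h' : UOC f' g') :
    UOC (fun n t => f n t + f' n t) (fun t => g t + g' t) := fun T => (h T).add (h' T)

lemma UOC.sub (h : UOC f g) (h' : UOC f' g') :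
    UOC (fun n t => f n t - f' n t) (fun t => g t - g' t) := fun T => (h T).sub (h' T)

lemma UOC.mul_const (h : UOC f g) (c : ℝ) : UOC (fun n t => f n t * c) (fun t => g t * c) := by
  rw [uoc_iff] at h ⊢
  intro T ε hε
  filter_upwards [h T (ε / (|c| + 1)) (by positivity)] with n hn t ht
  rw [← sub_mul, abs_mul]
  calc _ ≤ ε / (|c| + 1) * (|c| + 1) :=
        mul_le_mul (hn t ht) (by linarith) (abs_nonneg _) (by positivity)
    _ = ε := by field_simp

lemma UOC.const_mul (h : UOC f g) (c : ℝ) : UOC (fun n t => c * f n t) (fun t => c * g t) := by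
  simpa only [mul_comm c] using h.mul_const c

lemma uoc_const {a : ℕ → ℝ} {l : ℝ} (h : Tendsto a atTop (𝓝 l)) :
    UOC (fun n _ => a n) (fun _ => l) := by
  rw [uoc_iff]
  intro T ε hε
  exact (Metric.tendsto_nhds.1 h ε hε).mono fun n hn t _ => hn.le

lemma UOC.sum {ι : Type*} {S : Finset ι} {f : ι → ℕ → ℝ → ℝ} {g : ι → ℝ → ℝ}
    (h : ∀ i ∈ S, UOC (f i) (g i)) : UOC (fun n t => ∑ i ∈ S, f i n t) (fun t => ∑ i ∈ S, g i t) := by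
  classical
  induction S using Finset.induction_on with
  | empty => simpa using uoc_const tendsto_const_nhds
  | insert a S ha ih =>
    simp only [Finset.sum_insert ha]
    exact (h a (Finset.mem_insert_self _ _)).add
      (ih fun i hi => h i (Finset.mem_insert_of_mem hi))

lemma UOC.comp (h : UOC f g) {ψ : ℕ → ℕ} (hψ : Tendsto ψ atTop atTop) :
    UOC (fun n => f (ψ n)) g :=
  fun T u hu => hψ.eventually (h T u hu)

lemma UOC.limit_unique (h : UOC f g) (h' : UOC f g') : ∀ t ≥ 0, g t = g' t :=
  fun _ ht => tendsto_nhds_unique (h.tendsto ht) (h'.tendsto ht)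

/-- Equi-Lipschitz functions that converge at rational times converge uniformly on compacts. -/
lemma exists_uoc_of_rat (hL : ∀ n s t, |f n t - f n s| ≤ |t - s|)
    (hq : ∀ q : ℚ, ∃ l, Tendsto (fun n => f n q) atTop (𝓝 l)) :
    ∃ g, UOC f g ∧ ∀ s t, |g t - g s| ≤ |t - s| := by
  have hex : ∀ t, ∃ l, Tendsto (fun n => f n t) atTop (𝓝 l) := by
    intro t
    refine cauchySeq_tendsto_of_complete (Metric.cauchySeq_iff'.2 fun ε hε => ?_)
    obtain ⟨q, hq1, hq2⟩ := exists_rat_btwn (show t < t + ε / 4 by linarith)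
    obtain ⟨l, hl⟩ := hq q
    obtain ⟨n0, hn0⟩ := Metric.cauchySeq_iff'.1 hl.cauchySeq (ε / 4) (by positivity)
    refine ⟨n0, fun n hn => ?_⟩
    have h1 := hn0 n hn
    have h2 := hL n q t
    have h3 := hL n0 q t
    rw [Real.dist_eq] at h1 ⊢
    have h4 : |t - q| ≤ ε / 4 := by rw [abs_le]; constructor <;> linarith
    rw [abs_lt] at h1 ⊢
    rw [abs_le] at h2 h3
    constructor <;> linarith
  choose g hg using hex
  have hgL : ∀ s t, |g t - g s| ≤ |t - s| := fun s t =>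
    le_of_tendsto ((hg t).sub (hg s)).abs (Eventually.of_forall fun n => hL n s t)
  refine ⟨g, uoc_iff.2 fun T ε hε => ?_, hgL⟩
  -- Convergence on a finite `ε / 3`-net of times spreads to all times by the common Lipschitz
  -- bound.
  obtain ⟨S, -, hfin, hcov⟩ := isCompact_Icc (a := (0 : ℝ)) (b := T) |>.finite_cover_balls
    (e := ε / 3) (by positivity)
  have h1 : ∀ᶠ n in atTop, ∀ s ∈ S, |f n s - g s| < ε / 3 :=
    (Filter.eventually_all_finite hfin).2 fun s _ =>
      (Metric.tendsto_nhds.1 (hg s) (ε / 3) (by positivity)).mono fun n hn => hn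
  filter_upwards [h1] with n hn t ht
  obtain ⟨s, hs, hts⟩ := Set.mem_iUnion₂.1 (hcov ht)
  rw [Metric.mem_ball, Real.dist_eq] at hts
  have h2 := hn s hs
  have h3 := hL n s t
  have h4 := hgL s t
  rw [abs_lt] at h2
  rw [abs_le] at h3 h4 ⊢
  constructor <;> linarith

end UOC

/-! ### Local times -/

variable {N : ℕ} {b : Binning N} {gap : ℕ → ℝ} {o : ℕ → Order} {s : Book} {lo hi : ℕ}

lemma Timing.integral_ind_mem (h : Timing gap) (I : ℕ → Prop) [DecidablePred I] {u v : ℝ}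
    (huv : u ≤ v) : (∫ x in u..v, if I (arrivals gap x) then (1 : ℝ) else 0) ∈ Set.Icc 0 (v - u) := by
  have h1 := h.intervalIntegrable (f := fun j => if I j then 1 else 0) (K := 1)
    (fun j => by split_ifs <;> simp) u v
  constructor
  · exact intervalIntegral.integral_nonneg huv fun x _ => by split_ifs <;> simp
  · have := intervalIntegral.integral_mono_on huv h1 (intervalIntegrable_const (c := (1 : ℝ)))
      fun x _ => by split_ifs <;> simp
    simpa using this

lemma Timing.scaled_integral_sub (h : Timing gap) (I : ℕ → Prop) [DecidablePred I] (n : ℕ) {u v : ℝ}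
    (huv : u ≤ v) :
    (n : ℝ)⁻¹ * (∫ x in (0 : ℝ)..n * v, if I (arrivals gap x) then (1 : ℝ) else 0) -
      (n : ℝ)⁻¹ * (∫ x in (0 : ℝ)..n * u, if I (arrivals gap x) then (1 : ℝ) else 0) ∈
      Set.Icc 0 (v - u) := by
  have h1 := fun a b => h.intervalIntegrable (f := fun j => if I j then 1 else 0) (K := 1)
    (fun j => by split_ifs <;> simp) a b
  have h2 := h.integral_ind_mem I (mul_le_mul_of_nonneg_left huv (Nat.cast_nonneg (α := ℝ) n))
  rw [← mul_sub, intervalIntegral.integral_interval_sub_left (h1 _ _) (h1 _ _)]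
  refine ⟨mul_nonneg (by positivity) h2.1, ?_⟩
  rcases (Nat.cast_nonneg (α := ℝ) n).eq_or_lt with h0 | h0
  · rw [← h0]; simpa using huv
  · calc _ ≤ (n : ℝ)⁻¹ * (n * v - n * u) := mul_le_mul_of_nonneg_left h2.2 (by positivity)
      _ = v - u := by field_simp

lemma Timing.scale_Tβ_sub (h : Timing gap) (s : Book) (n k : ℕ) {u v : ℝ} (huv : u ≤ v) :
    ((lobPath b s gap o).scale n).Tβ k v - ((lobPath b s gap o).scale n).Tβ k u ∈
      Set.Icc 0 (v - u) :=
  h.scaled_integral_sub (fun j => (bookAfter b s o j).bidBin b = k) n huv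

lemma Timing.scale_Tα_sub (h : Timing gap) (s : Book) (n k : ℕ) {u v : ℝ} (huv : u ≤ v) :
    ((lobPath b s gap o).scale n).Tα k v - ((lobPath b s gap o).scale n).Tα k u ∈
      Set.Icc 0 (v - u) :=
  h.scaled_integral_sub (fun j => (bookAfter b s o j).askBin b = k) n huv

lemma scale_Tβ_zero (s : Book) (n k : ℕ) : ((lobPath b s gap o).scale n).Tβ k 0 = 0 := by
  simp [Path.scale, lobPath]

lemma scale_Tα_zero (s : Book) (n k : ℕ) : ((lobPath b s gap o).scale n).Tα k 0 = 0 := by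
  simp [Path.scale, lobPath]

lemma scale_Qb_nonneg (s : Book) (n k : ℕ) (t : ℝ) : 0 ≤ ((lobPath b s gap o).scale n).Qb k t := by
  simp only [Path.scale, lobPath]; positivity

lemma scale_Qa_nonneg (s : Book) (n k : ℕ) (t : ℝ) : 0 ≤ ((lobPath b s gap o).scale n).Qa k t := by
  simp only [Path.scale, lobPath]; positivity

lemma Timing.scaled_integral_sum (h : Timing gap) {S : Finset ℕ} {x : ℕ → ℕ} (hx : ∀ j, x j ∈ S)
    {n : ℕ} (hn : 1 ≤ n) (t : ℝ) :
    ∑ k ∈ S, (n : ℝ)⁻¹ * (∫ u in (0 : ℝ)..n * t, if x (arrivals gap u) = k then (1 : ℝ) else 0) =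
      t := by
  rw [← Finset.mul_sum, ← intervalIntegral.integral_finsetSum fun k _ =>
    h.intervalIntegrable (f := fun j => if x j = k then 1 else 0) (K := 1)
      (fun j => by split_ifs <;> simp) _ _]
  simp only [Finset.sum_ite_eq, hx, if_true, intervalIntegral.integral_const, smul_eq_mul]
  have : (0 : ℝ) < n := by exact_mod_cast hn
  field_simp
  ring

lemma Regular.sum_scale_Tβ (hs : Regular b lo hi s) (h : Timing gap) {n : ℕ} (hn : 1 ≤ n) (t : ℝ) :
    ∑ k ∈ Finset.Ico lo hi, ((lobPath b s gap o).scale n).Tβ k t = t :=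
  h.scaled_integral_sum (fun j => Finset.mem_Ico.2
    ⟨(hs.after o j).lo_le_bidBin, (hs.after o j).bidBin_lt_hi⟩) hn t

lemma Regular.sum_scale_Tα (hs : Regular b lo hi s) (h : Timing gap) {n : ℕ} (hn : 1 ≤ n) (t : ℝ) :
    ∑ k ∈ Finset.Ioc lo hi, ((lobPath b s gap o).scale n).Tα k t = t :=
  h.scaled_integral_sum (fun j => Finset.mem_Ioc.2
    ⟨(hs.after o j).lo_lt_askBin, (hs.after o j).askBin_le_hi⟩) hn t

lemma scaled_integral_eq_of_not {I : ℕ → Prop} [DecidablePred I] (h : Timing gap) {n : ℕ} {u v : ℝ}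
    (huv : u ≤ v) (hI : ∀ x ∈ Set.Icc u v, ¬ I (arrivals gap (n * x))) :
    (n : ℝ)⁻¹ * (∫ x in (0 : ℝ)..n * v, if I (arrivals gap x) then (1 : ℝ) else 0) =
      (n : ℝ)⁻¹ * (∫ x in (0 : ℝ)..n * u, if I (arrivals gap x) then (1 : ℝ) else 0) := by
  have h1 := fun a b => h.intervalIntegrable (f := fun j => if I j then 1 else 0) (K := 1)
    (fun j => by split_ifs <;> simp) a b
  rcases (Nat.cast_nonneg (α := ℝ) n).eq_or_lt with h0 | h0
  · simp [← h0]
  rw [← sub_eq_zero, ← mul_sub, intervalIntegral.integral_interval_sub_left (h1 _ _) (h1 _ _),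
    intervalIntegral.integral_congr (g := fun _ => 0)]
  · simp
  · intro x hx
    rw [Set.uIcc_of_le (mul_le_mul_of_nonneg_left huv h0.le)] at hx
    have h2 := hI (x / n) ⟨by rw [le_div_iff₀ h0, mul_comm]; exact hx.1,
      by rw [div_le_iff₀ h0, mul_comm]; exact hx.2⟩
    rw [mul_div_cancel₀ _ h0.ne'] at h2
    simp [h2]

lemma bidQueue_ne_zero_of_scale {n k : ℕ} {x : ℝ}
    (h : 0 < ((lobPath b s gap o).scale n).Qb k x) :
    (bookAfter b s o (arrivals gap (n * x))).bidQueue b k ≠ 0 := by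
  intro h0
  simp [Path.scale, lobPath, bookAt, h0] at h

lemma askQueue_ne_zero_of_scale {n k : ℕ} {x : ℝ}
    (h : 0 < ((lobPath b s gap o).scale n).Qa k x) :
    (bookAfter b s o (arrivals gap (n * x))).askQueue b k ≠ 0 := by
  intro h0
  simp [Path.scale, lobPath, bookAt, h0] at h

/-- While bin `k'` holds bids, the highest bid is not below it. -/
lemma scale_Tβ_eq_of_bids (h : Timing gap) {n k k' : ℕ} (hk : k < k') {u v : ℝ} (huv : u ≤ v)
    (hQ : ∀ x ∈ Set.Icc u v, 0 < ((lobPath b s gap o).scale n).Qb k' x) :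
    ((lobPath b s gap o).scale n).Tβ k v = ((lobPath b s gap o).scale n).Tβ k u :=
  scaled_integral_eq_of_not (I := fun j => (bookAfter b s o j).bidBin b = k) h huv fun x hx hxk => by
    have := Book.le_bidBin b (bidQueue_ne_zero_of_scale (hQ x hx))
    omega

/-- While bin `k'` holds bids, the lowest ask is above it. -/
lemma Regular.scale_Tα_eq_of_bids (hs : Regular b lo hi s) (h : Timing gap) {n k k' : ℕ}
    (hk : k ≤ k') {u v : ℝ} (huv : u ≤ v)
    (hQ : ∀ x ∈ Set.Icc u v, 0 < ((lobPath b s gap o).scale n).Qb k' x) :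
    ((lobPath b s gap o).scale n).Tα k v = ((lobPath b s gap o).scale n).Tα k u :=
  scaled_integral_eq_of_not (I := fun j => (bookAfter b s o j).askBin b = k) h huv fun x hx hxk => by
    have h1 := Book.le_bidBin b (bidQueue_ne_zero_of_scale (hQ x hx))
    have h2 := (hs.after o (arrivals gap (n * x))).admissible.bidBin_lt_askBin
    omega

/-- While bin `k'` holds asks, the lowest ask is not above it. -/
lemma scale_Tα_eq_of_asks (h : Timing gap) {n k k' : ℕ} (hk : k' < k) {u v : ℝ} (huv : u ≤ v)
    (hQ : ∀ x ∈ Set.Icc u v, 0 < ((lobPath b s gap o).scale n).Qa k' x) :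
    ((lobPath b s gap o).scale n).Tα k v = ((lobPath b s gap o).scale n).Tα k u :=
  scaled_integral_eq_of_not (I := fun j => (bookAfter b s o j).askBin b = k) h huv fun x hx hxk => by
    have := Book.askBin_le b (askQueue_ne_zero_of_scale (hQ x hx))
    omega

/-- While bin `k'` holds asks, the highest bid is below it. -/
lemma Regular.scale_Tβ_eq_of_asks (hs : Regular b lo hi s) (h : Timing gap) {n k k' : ℕ}
    (hk : k' ≤ k) {u v : ℝ} (huv : u ≤ v)
    (hQ : ∀ x ∈ Set.Icc u v, 0 < ((lobPath b s gap o).scale n).Qa k' x) :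
    ((lobPath b s gap o).scale n).Tβ k v = ((lobPath b s gap o).scale n).Tβ k u :=
  scaled_integral_eq_of_not (I := fun j => (bookAfter b s o j).bidBin b = k) h huv fun x hx hxk => by
    have h1 := Book.askBin_le b (askQueue_ne_zero_of_scale (hQ x hx))
    have h2 := (hs.after o (arrivals gap (n * x))).admissible.bidBin_lt_askBin
    omega

end

section

/-! ### Lipschitz functions on the half-line -/

section Lipschitz

variable {f g : ℝ → ℝ}

lemma lipOn_iff : LipOn f ↔ ∃ K : ℝ, 0 ≤ K ∧ ∀ u ≥ 0, ∀ v ≥ 0, |f u - f v| ≤ K * |u - v| := by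
  constructor
  · rintro ⟨K, hK⟩
    exact ⟨K, K.2, fun u hu v hv => hK.dist_le_mul u hu v hv⟩
  · rintro ⟨K, hK0, hK⟩
    exact ⟨⟨K, hK0⟩, LipschitzOnWith.of_dist_le_mul fun u hu v hv => hK u hu v hv⟩

lemma lipOn_of_sub_mem (h : ∀ u ≥ 0, ∀ v, u ≤ v → f v - f u ∈ Set.Icc 0 (v - u)) : LipOn f := by
  refine lipOn_iff.2 ⟨1, zero_le_one, fun u hu v hv => ?_⟩
  rw [one_mul]
  rcases le_total u v with huv | huv
  · have := h u hu v huv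
    rw [abs_sub_comm, abs_sub_comm u, abs_of_nonneg this.1, abs_of_nonneg (sub_nonneg.2 huv)]
    exact this.2
  · have := h v hv u huv
    rw [abs_of_nonneg this.1, abs_of_nonneg (sub_nonneg.2 huv)]
    exact this.2

lemma lipOn_const (c : ℝ) : LipOn fun _ => c := lipOn_iff.2 ⟨0, le_rfl, by simp⟩

lemma lipOn_mul_id (c : ℝ) : LipOn fun t => c * t :=
  lipOn_iff.2 ⟨|c|, abs_nonneg _, fun u _ v _ => by rw [← mul_sub, abs_mul]⟩

lemma LipOn.add (hf : LipOn f) (hg : LipOn g) : LipOn fun t => f t + g t := by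
  obtain ⟨K, hK⟩ := hf
  obtain ⟨L, hL⟩ := hg
  exact ⟨K + L, hK.add hL⟩

lemma LipOn.sub (hf : LipOn f) (hg : LipOn g) : LipOn fun t => f t - g t := by
  obtain ⟨K, hK⟩ := hf
  obtain ⟨L, hL⟩ := hg
  exact ⟨K + L, hK.sub hL⟩

lemma LipOn.mul_const (hf : LipOn f) (c : ℝ) : LipOn fun t => f t * c := by
  obtain ⟨K, hK0, hK⟩ := lipOn_iff.1 hf
  refine lipOn_iff.2 ⟨K * |c|, by positivity, fun u hu v hv => ?_⟩
  rw [← sub_mul, abs_mul, mul_right_comm]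
  exact mul_le_mul_of_nonneg_right (hK u hu v hv) (abs_nonneg c)

lemma LipOn.const_mul (hf : LipOn f) (c : ℝ) : LipOn fun t => c * f t := by
  simpa only [mul_comm c] using hf.mul_const c

lemma LipOn.sum {ι : Type*} {S : Finset ι} {f : ι → ℝ → ℝ} (h : ∀ i ∈ S, LipOn (f i)) :
    LipOn fun t => ∑ i ∈ S, f i t := by
  classical
  induction S using Finset.induction_on with
  | empty => simpa using lipOn_const 0
  | insert a S ha ih =>
    simp only [Finset.sum_insert ha]
    exact (h a (Finset.mem_insert_self _ _)).add
      (ih fun i hi => h i (Finset.mem_insert_of_mem hi))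

lemma LipOn.congr (hf : LipOn f) (h : ∀ t ≥ 0, g t = f t) : LipOn g := by
  obtain ⟨K, hK0, hK⟩ := lipOn_iff.1 hf
  refine lipOn_iff.2 ⟨K, hK0, fun u hu v hv => ?_⟩
  rw [h u hu, h v hv]
  exact hK u hu v hv

lemma LipOn.continuousAt (hf : LipOn f) {t : ℝ} (ht : 0 < t) : ContinuousAt f t := by
  obtain ⟨K, hK⟩ := hf
  exact hK.continuousOn.continuousAt (Ici_mem_nhds ht)

lemma LipOn.ae_differentiableAt (hf : LipOn f) :
    ∀ᵐ t ∂(volume.restrict (Set.Ioi (0 : ℝ))), DifferentiableAt ℝ f t := by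
  obtain ⟨K, hK⟩ := hf
  rw [ae_restrict_iff' measurableSet_Ioi]
  filter_upwards [hK.ae_differentiableWithinAt_of_mem_real] with t ht ht0
  exact (ht (Set.mem_Ici.2 (le_of_lt ht0))).differentiableAt (Ici_mem_nhds ht0)

end Lipschitz

/-! ### Fluid limits -/

variable {N : ℕ} {b : Binning N} {pb pa : ℕ → ℝ} {gap : ℕ → ℝ} {o : ℕ → Order} {s : ℕ → Book}
  {lo hi : ℕ} {φ : ℕ → ℕ} {F : Path}

/-- The `n`-th scaled path. -/
def scaledPath (b : Binning N) (s : ℕ → Book) (gap : ℕ → ℝ) (o : ℕ → Order) (n : ℕ) : Path :=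
  (lobPath b (s n) gap o).scale n

/-- A system: typical arrivals and a sequence of initial states. -/
structure System (b : Binning N) (pb pa gap : ℕ → ℝ) (o : ℕ → Order) (s : ℕ → Book) (lo hi : ℕ) :
    Prop where
  sample : Sample b pb pa gap o
  lo_lt_hi : lo < hi
  hi_le : hi ≤ N + 1
  init : ∀ᶠ n in atTop, InitialState b lo hi n (s n)

/-- `F` is the fluid limit of a system along the subsequence `φ`. -/
structure IsFluidLimit (b : Binning N) (pb pa gap : ℕ → ℝ) (o : ℕ → Order) (s : ℕ → Book)
    (lo hi : ℕ) (φ : ℕ → ℕ) (F : Path) : Prop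
    extends System b pb pa gap o s lo hi where
  strictMono : StrictMono φ
  conv : PathUOC N lo hi (fun n => scaledPath b s gap o (φ n)) F

/-! ### Approximate balance along a sequence of books, and compactness. -/

namespace System

variable (L : System b pb pa gap o s lo hi)
include L

lemma approx_Qb {k : ℕ} (hk : k ∈ Finset.Ioo lo hi) (T : ℝ) {ε : ℝ} (hε : 0 < ε) :
    ∀ᶠ n : ℕ in atTop, ∀ t ∈ Set.Icc 0 T,
      |(scaledPath b s gap o n).Qb k t - ((scaledPath b s gap o n).Qb k 0 +
        (pb k * ∑ a ∈ Finset.Ioc k hi, (scaledPath b s gap o n).Tα a t) -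
        (scaledPath b s gap o n).Tβ k t * ∑ q ∈ Finset.Icc 1 k, pa q)| ≤ ε := by
  filter_upwards [L.init, L.sample.balance_Qb L.lo_lt_hi L.hi_le hk T hε] with n h1 h2
  exact h2 _ h1

lemma approx_Qa {k : ℕ} (hk : k ∈ Finset.Ioo lo hi) (T : ℝ) {ε : ℝ} (hε : 0 < ε) :
    ∀ᶠ n : ℕ in atTop, ∀ t ∈ Set.Icc 0 T,
      |(scaledPath b s gap o n).Qa k t - ((scaledPath b s gap o n).Qa k 0 +
        (pa k * ∑ a ∈ Finset.Ico lo k, (scaledPath b s gap o n).Tβ a t) -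
        (scaledPath b s gap o n).Tα k t * ∑ p ∈ Finset.Icc k N, pb p)| ≤ ε := by
  filter_upwards [L.init, L.sample.balance_Qa L.lo_lt_hi L.hi_le hk T hε] with n h1 h2
  exact h2 _ h1

lemma uoc_B (k : ℕ) : UOC (fun n => (scaledPath b s gap o n).B k) fun t => pb k * t :=
  uoc_iff.2 fun T _ hε => (L.sample.balance_B k T hε).mono fun n hn => hn (s n)

lemma uoc_A (k : ℕ) : UOC (fun n => (scaledPath b s gap o n).A k) fun t => pa k * t :=
  uoc_iff.2 fun T _ hε => (L.sample.balance_A k T hε).mono fun n hn => hn (s n)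

lemma Qb_zero_le {k : ℕ} (hk : k ∈ Finset.Ioo lo hi) :
    ∀ᶠ n in atTop, (scaledPath b s gap o n).Qb k 0 ≤ 1 := by
  filter_upwards [L.init, eventually_ge_atTop 1] with n hn hn1
  have h1 : (((s n).bidQueue b k).toNat : ℝ) ≤ n := by
    exact_mod_cast ENat.toNat_le_of_le_natCast (hn.bids_le k hk)
  have h2 : (0 : ℝ) < n := by exact_mod_cast hn1
  simp only [scaledPath, Path.scale, lobPath, mul_zero, bookAt_zero L.sample.timing]
  rw [inv_mul_le_iff₀ h2]
  linarith

lemma Qa_zero_le {k : ℕ} (hk : k ∈ Finset.Ioo lo hi) :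
    ∀ᶠ n in atTop, (scaledPath b s gap o n).Qa k 0 ≤ 1 := by
  filter_upwards [L.init, eventually_ge_atTop 1] with n hn hn1
  have h1 : (((s n).askQueue b k).toNat : ℝ) ≤ n := by
    exact_mod_cast ENat.toNat_le_of_le_natCast (hn.asks_le k hk)
  have h2 : (0 : ℝ) < n := by exact_mod_cast hn1
  simp only [scaledPath, Path.scale, lobPath, mul_zero, bookAt_zero L.sample.timing]
  rw [inv_mul_le_iff₀ h2]
  linarith

/-- Every subsequence has a convergent further subsequence. -/
lemma exists_isFluidLimit (hφ : StrictMono φ) : ∃ ψ : ℕ → ℕ, StrictMono ψ ∧ ∃ F : Path,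
    PathUOC N lo hi (fun n => scaledPath b s gap o (φ (ψ n))) F ∧ PathLipschitz N lo hi F := by
  have htm := L.sample.timing
  -- Local times at rational times, together with initial queues, determine everything. The
  -- truncation at `1` keeps every vector in the compact box; it is inactive in the window for large
  -- `n`.
  let v : ℕ → (ℕ × ℚ ⊕ ℕ × ℚ) ⊕ (ℕ ⊕ ℕ) → ℝ := fun n => Sum.elim
    (Sum.elim (fun i => (scaledPath b s gap o (φ n)).Tβ i.1 i.2)
      fun i => (scaledPath b s gap o (φ n)).Tα i.1 i.2)
    (Sum.elim (fun k => min ((scaledPath b s gap o (φ n)).Qb k 0) 1)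
      fun k => min ((scaledPath b s gap o (φ n)).Qa k 0) 1)
  let B : (ℕ × ℚ ⊕ ℕ × ℚ) ⊕ (ℕ ⊕ ℕ) → ℝ := Sum.elim
    (Sum.elim (fun i => |(i.2 : ℝ)|) fun i => |(i.2 : ℝ)|) fun _ => 1
  have hTβ : ∀ n k u v, |(scaledPath b s gap o n).Tβ k v - (scaledPath b s gap o n).Tβ k u| ≤
      |v - u| := by
    intro n k u v
    rcases le_total u v with h | h
    · have := htm.scale_Tβ_sub (b := b) (o := o) (s n) n k h
      rw [abs_of_nonneg (sub_nonneg.2 h)]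
      exact (abs_of_nonneg this.1).trans_le this.2
    · have := htm.scale_Tβ_sub (b := b) (o := o) (s n) n k h
      rw [abs_sub_comm, abs_sub_comm v, abs_of_nonneg (sub_nonneg.2 h)]
      exact (abs_of_nonneg this.1).trans_le this.2
  have hTα : ∀ n k u v, |(scaledPath b s gap o n).Tα k v - (scaledPath b s gap o n).Tα k u| ≤
      |v - u| := by
    intro n k u v
    rcases le_total u v with h | h
    · have := htm.scale_Tα_sub (b := b) (o := o) (s n) n k h
      rw [abs_of_nonneg (sub_nonneg.2 h)]
      exact (abs_of_nonneg this.1).trans_le this.2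
    · have := htm.scale_Tα_sub (b := b) (o := o) (s n) n k h
      rw [abs_sub_comm, abs_sub_comm v, abs_of_nonneg (sub_nonneg.2 h)]
      exact (abs_of_nonneg this.1).trans_le this.2
  have hTβ0 : ∀ n k, (scaledPath b s gap o n).Tβ k 0 = 0 := fun n k => scale_Tβ_zero _ _ _
  have hTα0 : ∀ n k, (scaledPath b s gap o n).Tα k 0 = 0 := fun n k => scale_Tα_zero _ _ _
  have hv : ∀ n, v n ∈ Set.pi Set.univ fun i => Set.Icc (-B i) (B i) := by
    intro n i _
    rw [Set.mem_Icc, ← abs_le]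
    rcases i with (⟨k, q⟩ | ⟨k, q⟩) | (k | k)
    · have h0 := hTβ (φ n) k 0 q
      rwa [hTβ0, sub_zero, sub_zero] at h0
    · have h0 := hTα (φ n) k 0 q
      rwa [hTα0, sub_zero, sub_zero] at h0
    · have h0 := scale_Qb_nonneg (b := b) (gap := gap) (o := o) (s (φ n)) (φ n) k 0
      exact (abs_of_nonneg (le_min h0 zero_le_one)).trans_le (min_le_right _ _)
    · have h0 := scale_Qa_nonneg (b := b) (gap := gap) (o := o) (s (φ n)) (φ n) k 0
      exact (abs_of_nonneg (le_min h0 zero_le_one)).trans_le (min_le_right _ _)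
  -- Sequential compactness of a countable product of intervals plays the part of the diagonal
  -- argument.
  obtain ⟨l, -, ψ, hψ, hlim⟩ := (isCompact_univ_pi fun i => isCompact_Icc
    (a := -B i) (b := B i)).tendsto_subseq hv
  have hlim' := tendsto_pi_nhds.1 hlim
  have hφψ : Tendsto (fun n => φ (ψ n)) atTop atTop := (hφ.comp hψ).tendsto_atTop
  have h1 : ∀ k, ∃ g, UOC (fun n => (scaledPath b s gap o (φ (ψ n))).Tβ k) g ∧
      ∀ s t, |g t - g s| ≤ |t - s| := fun k =>
    exists_uoc_of_rat (fun n => hTβ _ k) fun q => ⟨_, hlim' (Sum.inl (Sum.inl (k, q)))⟩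
  have h2 : ∀ k, ∃ g, UOC (fun n => (scaledPath b s gap o (φ (ψ n))).Tα k) g ∧
      ∀ s t, |g t - g s| ≤ |t - s| := fun k =>
    exists_uoc_of_rat (fun n => hTα _ k) fun q => ⟨_, hlim' (Sum.inl (Sum.inr (k, q)))⟩
  choose gβ hgβ hgβL using h1
  choose gα hgα hgαL using h2
  have hlip : ∀ g : ℝ → ℝ, (∀ s t, |g t - g s| ≤ |t - s|) → LipOn g := fun g hg =>
    lipOn_iff.2 ⟨1, zero_le_one, fun u _ v _ => by simpa using hg v u⟩
  have hQb : ∀ k ∈ Finset.Ioo lo hi, Tendsto (fun n => (scaledPath b s gap o (φ (ψ n))).Qb k 0)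
      atTop (𝓝 (l (Sum.inr (Sum.inl k)))) := fun k hk =>
    (hlim' (Sum.inr (Sum.inl k))).congr' ((hφψ.eventually (L.Qb_zero_le hk)).mono fun n hn =>
      min_eq_left hn)
  have hQa : ∀ k ∈ Finset.Ioo lo hi, Tendsto (fun n => (scaledPath b s gap o (φ (ψ n))).Qa k 0)
      atTop (𝓝 (l (Sum.inr (Sum.inr k)))) := fun k hk =>
    (hlim' (Sum.inr (Sum.inr k))).congr' ((hφψ.eventually (L.Qa_zero_le hk)).mono fun n hn =>
      min_eq_left hn)
  -- The limits of arrivals and queues are not extracted but read off from the laws and the balance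
  -- equations.
  refine ⟨ψ, hψ, ⟨fun k t => pb k * t, fun k t => pa k * t,
    fun k t => l (Sum.inr (Sum.inl k)) + (pb k * ∑ a ∈ Finset.Ioc k hi, gα a t) -
      gβ k t * ∑ q ∈ Finset.Icc 1 k, pa q,
    fun k t => l (Sum.inr (Sum.inr k)) + (pa k * ∑ a ∈ Finset.Ico lo k, gβ a t) -
      gα k t * ∑ p ∈ Finset.Icc k N, pb p, gβ, gα⟩, ⟨?_, ?_, ?_, ?_, ?_, ?_⟩,
    ⟨?_, ?_, ?_, ?_, ?_, ?_⟩⟩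
  · exact fun k _ => (L.uoc_B k).comp hφψ
  · exact fun k _ => (L.uoc_A k).comp hφψ
  · intro k hk
    exact UOC.of_approx (((uoc_const (hQb k hk)).add
      ((UOC.sum fun a _ => hgα a).const_mul (pb k))).sub ((hgβ k).mul_const _))
      fun T ε hε => hφψ.eventually (L.approx_Qb hk T hε)
  · intro k hk
    exact UOC.of_approx (((uoc_const (hQa k hk)).add
      ((UOC.sum fun a _ => hgβ a).const_mul (pa k))).sub ((hgα k).mul_const _))
      fun T ε hε => hφψ.eventually (L.approx_Qa hk T hε)
  · exact fun k _ => hgβ k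
  · exact fun k _ => hgα k
  · exact fun k _ => lipOn_mul_id _
  · exact fun k _ => lipOn_mul_id _
  · exact fun k _ => ((lipOn_const _).add ((LipOn.sum fun a _ => hlip _ (hgαL a)).const_mul _)).sub
      ((hlip _ (hgβL k)).mul_const _)
  · exact fun k _ => ((lipOn_const _).add ((LipOn.sum fun a _ => hlip _ (hgβL a)).const_mul _)).sub
      ((hlip _ (hgαL k)).mul_const _)
  · exact fun k _ => hlip _ (hgβL k)
  · exact fun k _ => hlip _ (hgαL k)

end System

/-! ### The equations satisfied by fluid limits. -/

namespace IsFluidLimit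

variable (L : IsFluidLimit b pb pa gap o s lo hi φ F)
include L

lemma tendsto_φ : Tendsto φ atTop atTop := L.strictMono.tendsto_atTop

lemma B_eq {k : ℕ} (hk : k ∈ Finset.Icc 1 N) : ∀ t ≥ 0, F.B k t = pb k * t :=
  (L.conv.B k hk).limit_unique ((L.uoc_B k).comp L.tendsto_φ)

lemma A_eq {k : ℕ} (hk : k ∈ Finset.Icc 1 N) : ∀ t ≥ 0, F.A k t = pa k * t :=
  (L.conv.A k hk).limit_unique ((L.uoc_A k).comp L.tendsto_φ)

lemma Tβ_sub {k : ℕ} (hk : k ∈ Finset.Ico lo hi) {u v : ℝ} (hu : 0 ≤ u) (huv : u ≤ v) :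
    F.Tβ k v - F.Tβ k u ∈ Set.Icc 0 (v - u) :=
  isClosed_Icc.mem_of_tendsto (((L.conv.Tβ k hk).tendsto (hu.trans huv)).sub
    ((L.conv.Tβ k hk).tendsto hu)) (Eventually.of_forall fun _ =>
      L.sample.timing.scale_Tβ_sub _ _ _ huv)

lemma Tα_sub {k : ℕ} (hk : k ∈ Finset.Ioc lo hi) {u v : ℝ} (hu : 0 ≤ u) (huv : u ≤ v) :
    F.Tα k v - F.Tα k u ∈ Set.Icc 0 (v - u) :=
  isClosed_Icc.mem_of_tendsto (((L.conv.Tα k hk).tendsto (hu.trans huv)).sub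
    ((L.conv.Tα k hk).tendsto hu)) (Eventually.of_forall fun _ =>
      L.sample.timing.scale_Tα_sub _ _ _ huv)

lemma Tβ_zero {k : ℕ} (hk : k ∈ Finset.Ico lo hi) : F.Tβ k 0 = 0 :=
  tendsto_nhds_unique ((L.conv.Tβ k hk).tendsto le_rfl)
    (tendsto_const_nhds.congr fun n => (scale_Tβ_zero (s (φ n)) (φ n) k).symm)

lemma Tα_zero {k : ℕ} (hk : k ∈ Finset.Ioc lo hi) : F.Tα k 0 = 0 :=
  tendsto_nhds_unique ((L.conv.Tα k hk).tendsto le_rfl)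
    (tendsto_const_nhds.congr fun n => (scale_Tα_zero (s (φ n)) (φ n) k).symm)

lemma Tβ_nonneg {k : ℕ} (hk : k ∈ Finset.Ico lo hi) {t : ℝ} (ht : 0 ≤ t) : 0 ≤ F.Tβ k t := by
  have := (L.Tβ_sub hk le_rfl ht).1
  rwa [L.Tβ_zero hk, sub_zero] at this

lemma Tα_nonneg {k : ℕ} (hk : k ∈ Finset.Ioc lo hi) {t : ℝ} (ht : 0 ≤ t) : 0 ≤ F.Tα k t := by
  have := (L.Tα_sub hk le_rfl ht).1
  rwa [L.Tα_zero hk, sub_zero] at this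

lemma lipOn_Tβ {k : ℕ} (hk : k ∈ Finset.Ico lo hi) : LipOn (F.Tβ k) :=
  lipOn_of_sub_mem fun _ hu _ huv => L.Tβ_sub hk hu huv

lemma lipOn_Tα {k : ℕ} (hk : k ∈ Finset.Ioc lo hi) : LipOn (F.Tα k) :=
  lipOn_of_sub_mem fun _ hu _ huv => L.Tα_sub hk hu huv

lemma sum_Tβ {t : ℝ} (ht : 0 ≤ t) : ∑ k ∈ Finset.Ico lo hi, F.Tβ k t = t := by
  refine tendsto_nhds_unique (tendsto_finsetSum _ fun k hk => (L.conv.Tβ k hk).tendsto ht)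
    (tendsto_const_nhds.congr' ?_)
  filter_upwards [L.tendsto_φ.eventually L.init, L.tendsto_φ.eventually_ge_atTop 1] with n h1 h2
  exact (h1.regular.sum_scale_Tβ L.sample.timing h2 t).symm

lemma sum_Tα {t : ℝ} (ht : 0 ≤ t) : ∑ k ∈ Finset.Ioc lo hi, F.Tα k t = t := by
  refine tendsto_nhds_unique (tendsto_finsetSum _ fun k hk => (L.conv.Tα k hk).tendsto ht)
    (tendsto_const_nhds.congr' ?_)
  filter_upwards [L.tendsto_φ.eventually L.init, L.tendsto_φ.eventually_ge_atTop 1] with n h1 h2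
  exact (h1.regular.sum_scale_Tα L.sample.timing h2 t).symm

lemma Qb_nonneg {k : ℕ} (hk : k ∈ Finset.Ioo lo hi) {t : ℝ} (ht : 0 ≤ t) : 0 ≤ F.Qb k t :=
  ge_of_tendsto' ((L.conv.Qb k hk).tendsto ht) fun _ => scale_Qb_nonneg _ _ _ _

lemma Qa_nonneg {k : ℕ} (hk : k ∈ Finset.Ioo lo hi) {t : ℝ} (ht : 0 ≤ t) : 0 ≤ F.Qa k t :=
  ge_of_tendsto' ((L.conv.Qa k hk).tendsto ht) fun _ => scale_Qa_nonneg _ _ _ _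

/-- The integrated form of equation 6. It also yields Lipschitz continuity of the queue and
differentiability wherever the local times are differentiable. -/
lemma balance_Qb {k : ℕ} (hk : k ∈ Finset.Ioo lo hi) : ∀ t ≥ 0, F.Qb k t = F.Qb k 0 +
    (pb k * ∑ a ∈ Finset.Ioc k hi, F.Tα a t) - F.Tβ k t * ∑ q ∈ Finset.Icc 1 k, pa q := by
  have hk' := Finset.mem_Ioo.1 hk
  refine (L.conv.Qb k hk).limit_unique (UOC.of_approx (((uoc_const
    ((L.conv.Qb k hk).tendsto le_rfl)).add ((UOC.sum fun a ha => L.conv.Tα a ?_).const_mul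
      (pb k))).sub ((L.conv.Tβ k ?_).mul_const _))
      fun T ε hε => L.tendsto_φ.eventually (L.approx_Qb hk T hε))
  · rw [Finset.mem_Ioc] at ha ⊢; omega
  · rw [Finset.mem_Ico]; omega

lemma balance_Qa {k : ℕ} (hk : k ∈ Finset.Ioo lo hi) : ∀ t ≥ 0, F.Qa k t = F.Qa k 0 +
    (pa k * ∑ a ∈ Finset.Ico lo k, F.Tβ a t) - F.Tα k t * ∑ p ∈ Finset.Icc k N, pb p := by
  have hk' := Finset.mem_Ioo.1 hk
  refine (L.conv.Qa k hk).limit_unique (UOC.of_approx (((uoc_const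
    ((L.conv.Qa k hk).tendsto le_rfl)).add ((UOC.sum fun a ha => L.conv.Tβ a ?_).const_mul
      (pa k))).sub ((L.conv.Tα k ?_).mul_const _))
      fun T ε hε => L.tendsto_φ.eventually (L.approx_Qa hk T hε))
  · rw [Finset.mem_Ico] at ha ⊢; omega
  · rw [Finset.mem_Ioc]; omega

lemma lipOn_Qb {k : ℕ} (hk : k ∈ Finset.Ioo lo hi) : LipOn (F.Qb k) := by
  have hk' := Finset.mem_Ioo.1 hk
  refine LipOn.congr (((lipOn_const _).add ((LipOn.sum fun a ha => L.lipOn_Tα ?_).const_mul _)).sub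
    ((L.lipOn_Tβ ?_).mul_const _)) (L.balance_Qb hk)
  · rw [Finset.mem_Ioc] at ha ⊢; omega
  · rw [Finset.mem_Ico]; omega

lemma lipOn_Qa {k : ℕ} (hk : k ∈ Finset.Ioo lo hi) : LipOn (F.Qa k) := by
  have hk' := Finset.mem_Ioo.1 hk
  refine LipOn.congr (((lipOn_const _).add ((LipOn.sum fun a ha => L.lipOn_Tβ ?_).const_mul _)).sub
    ((L.lipOn_Tα ?_).mul_const _)) (L.balance_Qa hk)
  · rw [Finset.mem_Ico] at ha ⊢; omega
  · rw [Finset.mem_Ioc]; omega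

omit L in
/-- If a continuous limit is positive at `t`, then so are the approximations in a neighbourhood. -/
lemma exists_pos_nhd {f : ℕ → ℝ → ℝ} {g : ℝ → ℝ} (h : UOC f g) {t : ℝ} (ht : 0 < t)
    (hg : ContinuousAt g t) (hpos : 0 < g t) :
    ∃ δ > 0, δ < t ∧ ∀ᶠ n in atTop, ∀ x ∈ Set.Icc (t - δ) (t + δ), 0 < f n x := by
  have h1 : ∀ᶠ x in 𝓝 t, g t / 2 < g x := hg.eventually_const_lt (half_lt_self hpos)
  obtain ⟨δ, hδ, hball⟩ := Metric.eventually_nhds_iff.1 h1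
  refine ⟨min (δ / 2) (t / 2), by positivity, (min_le_right _ _).trans_lt (half_lt_self ht), ?_⟩
  filter_upwards [uoc_iff.1 h (t + t) (g t / 2) (half_pos hpos)] with n hn x hx
  have h2 := min_le_left (δ / 2) (t / 2)
  have h3 := min_le_right (δ / 2) (t / 2)
  have h4 : g t / 2 < g x := hball (by
    rw [Real.dist_eq, abs_lt]; constructor <;> linarith [hx.1, hx.2])
  have h5 := (abs_le.1 (hn x ⟨by linarith [hx.1], by linarith [hx.2]⟩)).1
  linarith

omit L in
/-- A limit of functions that are constant near `t` has derivative zero at `t`. -/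
lemma hasDerivAt_zero_of_const {f : ℕ → ℝ → ℝ} {g : ℝ → ℝ} (h : UOC f g) {t δ : ℝ} (hδ : 0 < δ)
    (hδt : δ < t) (hf : ∀ᶠ n in atTop, ∀ u v, t - δ ≤ u → u ≤ v → v ≤ t + δ → f n v = f n u) :
    HasDerivAt g 0 t := by
  have h1 : ∀ u v, t - δ ≤ u → u ≤ v → v ≤ t + δ → g v = g u := fun u v hu huv hv =>
    tendsto_nhds_unique_of_eventuallyEq (h.tendsto (by linarith)) (h.tendsto (by linarith))
      (hf.mono fun n hn => hn u v hu huv hv)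
  refine (hasDerivAt_const t (g t)).congr_of_eventuallyEq ?_
  filter_upwards [Icc_mem_nhds (show t - δ < t by linarith) (show t < t + δ by linarith)] with x hx
  rcases le_total x t with hxt | hxt
  · exact (h1 x t hx.1 hxt (by linarith)).symm
  · exact h1 t x (by linarith) hxt hx.2

lemma deriv_Tβ_of_bids {k k' : ℕ} (hk : k ∈ Finset.Ico lo hi) (hk' : k' ∈ Finset.Ioo lo hi)
    (hkk : k < k') {t : ℝ} (ht : 0 < t) (hpos : 0 < F.Qb k' t) : HasDerivAt (F.Tβ k) 0 t := by
  obtain ⟨δ, hδ, hδt, hn⟩ := exists_pos_nhd (L.conv.Qb k' hk') ht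
    ((L.lipOn_Qb hk').continuousAt ht) hpos
  refine hasDerivAt_zero_of_const (L.conv.Tβ k hk) hδ hδt (hn.mono fun n hn u v hu huv hv => ?_)
  exact scale_Tβ_eq_of_bids L.sample.timing hkk huv fun x hx =>
    hn x ⟨hu.trans hx.1, hx.2.trans hv⟩

lemma deriv_Tα_of_bids {k k' : ℕ} (hk : k ∈ Finset.Ioc lo hi) (hk' : k' ∈ Finset.Ioo lo hi)
    (hkk : k ≤ k') {t : ℝ} (ht : 0 < t) (hpos : 0 < F.Qb k' t) : HasDerivAt (F.Tα k) 0 t := by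
  obtain ⟨δ, hδ, hδt, hn⟩ := exists_pos_nhd (L.conv.Qb k' hk') ht
    ((L.lipOn_Qb hk').continuousAt ht) hpos
  refine hasDerivAt_zero_of_const (L.conv.Tα k hk) hδ hδt ?_
  filter_upwards [hn, L.tendsto_φ.eventually L.init] with n hn hs u v hu huv hv
  exact hs.regular.scale_Tα_eq_of_bids L.sample.timing hkk huv fun x hx =>
    hn x ⟨hu.trans hx.1, hx.2.trans hv⟩

lemma deriv_Tα_of_asks {k k' : ℕ} (hk : k ∈ Finset.Ioc lo hi) (hk' : k' ∈ Finset.Ioo lo hi)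
    (hkk : k' < k) {t : ℝ} (ht : 0 < t) (hpos : 0 < F.Qa k' t) : HasDerivAt (F.Tα k) 0 t := by
  obtain ⟨δ, hδ, hδt, hn⟩ := exists_pos_nhd (L.conv.Qa k' hk') ht
    ((L.lipOn_Qa hk').continuousAt ht) hpos
  refine hasDerivAt_zero_of_const (L.conv.Tα k hk) hδ hδt (hn.mono fun n hn u v hu huv hv => ?_)
  exact scale_Tα_eq_of_asks L.sample.timing hkk huv fun x hx =>
    hn x ⟨hu.trans hx.1, hx.2.trans hv⟩

lemma deriv_Tβ_of_asks {k k' : ℕ} (hk : k ∈ Finset.Ico lo hi) (hk' : k' ∈ Finset.Ioo lo hi)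
    (hkk : k' ≤ k) {t : ℝ} (ht : 0 < t) (hpos : 0 < F.Qa k' t) : HasDerivAt (F.Tβ k) 0 t := by
  obtain ⟨δ, hδ, hδt, hn⟩ := exists_pos_nhd (L.conv.Qa k' hk') ht
    ((L.lipOn_Qa hk').continuousAt ht) hpos
  refine hasDerivAt_zero_of_const (L.conv.Tβ k hk) hδ hδt ?_
  filter_upwards [hn, L.tendsto_φ.eventually L.init] with n hn hs u v hu huv hv
  exact hs.regular.scale_Tβ_eq_of_asks L.sample.timing hkk huv fun x hx =>
    hn x ⟨hu.trans hx.1, hx.2.trans hv⟩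

omit L in
lemma hasDerivAt_congr_nonneg {f g : ℝ → ℝ} (h : ∀ t ≥ 0, f t = g t) {t d : ℝ} (ht : 0 < t)
    (hg : HasDerivAt g d t) : HasDerivAt f d t :=
  hg.congr_of_eventuallyEq (by filter_upwards [Ici_mem_nhds ht] with x hx using h x hx)

lemma hasDerivAt_Qb {k : ℕ} (hk : k ∈ Finset.Ioo lo hi) {t : ℝ} (ht : 0 < t)
    (h1 : ∀ k' ∈ Finset.Ioc k hi, DifferentiableAt ℝ (F.Tα k') t)
    (h2 : DifferentiableAt ℝ (F.Tβ k) t) :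
    HasDerivAt (F.Qb k) (pb k * ∑ k' ∈ Finset.Ioc k hi, deriv (F.Tα k') t
        - deriv (F.Tβ k) t * ∑ k' ∈ Finset.Icc 1 k, pa k') t :=
  hasDerivAt_congr_nonneg (L.balance_Qb hk) ht
    ((((HasDerivAt.fun_sum fun a ha => (h1 a ha).hasDerivAt).const_mul (pb k)).const_add _).sub
      (h2.hasDerivAt.mul_const _))

lemma hasDerivAt_Qa {k : ℕ} (hk : k ∈ Finset.Ioo lo hi) {t : ℝ} (ht : 0 < t)
    (h1 : ∀ k' ∈ Finset.Ico lo k, DifferentiableAt ℝ (F.Tβ k') t)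
    (h2 : DifferentiableAt ℝ (F.Tα k) t) :
    HasDerivAt (F.Qa k) (pa k * ∑ k' ∈ Finset.Ico lo k, deriv (F.Tβ k') t
        - deriv (F.Tα k) t * ∑ k' ∈ Finset.Icc k N, pb k') t :=
  hasDerivAt_congr_nonneg (L.balance_Qa hk) ht
    ((((HasDerivAt.fun_sum fun a ha => (h1 a ha).hasDerivAt).const_mul (pa k)).const_add _).sub
      (h2.hasDerivAt.mul_const _))

/-- Fluid limits satisfy the fluid equations. -/
lemma fluidEquations : FluidEquations N lo hi pb pa F where
  ae_differentiable := by
    have h1 : ∀ᵐ t ∂(volume.restrict (Set.Ioi (0 : ℝ))), ∀ k ∈ Finset.Icc 1 N,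
        DifferentiableAt ℝ (F.B k) t := (ae_ball_iff (Finset.countable_toSet _)).2 fun k hk =>
      ((lipOn_mul_id _).congr (L.B_eq hk)).ae_differentiableAt
    have h2 : ∀ᵐ t ∂(volume.restrict (Set.Ioi (0 : ℝ))), ∀ k ∈ Finset.Icc 1 N,
        DifferentiableAt ℝ (F.A k) t := (ae_ball_iff (Finset.countable_toSet _)).2 fun k hk =>
      ((lipOn_mul_id _).congr (L.A_eq hk)).ae_differentiableAt
    have h3 : ∀ᵐ t ∂(volume.restrict (Set.Ioi (0 : ℝ))), ∀ k ∈ Finset.Ioo lo hi,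
        DifferentiableAt ℝ (F.Qb k) t := (ae_ball_iff (Finset.countable_toSet _)).2 fun k hk =>
      (L.lipOn_Qb hk).ae_differentiableAt
    have h4 : ∀ᵐ t ∂(volume.restrict (Set.Ioi (0 : ℝ))), ∀ k ∈ Finset.Ioo lo hi,
        DifferentiableAt ℝ (F.Qa k) t := (ae_ball_iff (Finset.countable_toSet _)).2 fun k hk =>
      (L.lipOn_Qa hk).ae_differentiableAt
    have h5 : ∀ᵐ t ∂(volume.restrict (Set.Ioi (0 : ℝ))), ∀ k ∈ Finset.Ico lo hi,
        DifferentiableAt ℝ (F.Tβ k) t := (ae_ball_iff (Finset.countable_toSet _)).2 fun k hk =>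
      (L.lipOn_Tβ hk).ae_differentiableAt
    have h6 : ∀ᵐ t ∂(volume.restrict (Set.Ioi (0 : ℝ))), ∀ k ∈ Finset.Ioc lo hi,
        DifferentiableAt ℝ (F.Tα k) t := (ae_ball_iff (Finset.countable_toSet _)).2 fun k hk =>
      (L.lipOn_Tα hk).ae_differentiableAt
    filter_upwards [h1, h2, h3, h4, h5, h6] with t g1 g2 g3 g4 g5 g6
    exact ⟨g1, g2, g3, g4, g5, g6⟩
  deriv_B k hk t ht := hasDerivAt_congr_nonneg (L.B_eq hk) ht
    (by simpa using (hasDerivAt_id t).const_mul (pb k))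
  deriv_A k hk t ht := hasDerivAt_congr_nonneg (L.A_eq hk) ht
    (by simpa using (hasDerivAt_id t).const_mul (pa k))
  deriv_Tβ k hk t ht hpos := by
    obtain ⟨k', hk', hpos'⟩ := Finset.exists_lt_of_sum_lt (s := Finset.Ioo k hi)
      (f := fun _ => (0 : ℝ)) (by simpa using hpos)
    rw [Finset.mem_Ioo] at hk'
    have hk2 := Finset.mem_Ico.1 hk
    exact L.deriv_Tβ_of_bids hk (Finset.mem_Ioo.2 ⟨by omega, hk'.2⟩) hk'.1 ht hpos'
  deriv_Tα k hk t ht hpos := by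
    obtain ⟨k', hk', hpos'⟩ := Finset.exists_lt_of_sum_lt (s := Finset.Ioo lo k)
      (f := fun _ => (0 : ℝ)) (by simpa using hpos)
    rw [Finset.mem_Ioo] at hk'
    have hk2 := Finset.mem_Ioc.1 hk
    exact L.deriv_Tα_of_asks hk (Finset.mem_Ioo.2 ⟨hk'.1, by omega⟩) hk'.2 ht hpos'
  sum_Tβ t ht := L.sum_Tβ ht
  sum_Tα t ht := L.sum_Tα ht
  nonneg_Qb k hk t ht := L.Qb_nonneg hk ht
  nonneg_Qa k hk t ht := L.Qa_nonneg hk ht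
  deriv_Qb_zero k hk t ht h0 d hd := by
    -- A nonnegative function that vanishes at an interior time has a local minimum there.
    refine IsLocalMin.hasDerivAt_eq_zero ?_ hd
    filter_upwards [Ici_mem_nhds ht] with x hx
    rw [h0]
    exact L.Qb_nonneg hk hx
  deriv_Qa_zero k hk t ht h0 d hd := by
    refine IsLocalMin.hasDerivAt_eq_zero ?_ hd
    filter_upwards [Ici_mem_nhds ht] with x hx
    rw [h0]
    exact L.Qa_nonneg hk hx
  deriv_Qb k hk t ht h1 h2 := L.hasDerivAt_Qb hk ht h1 h2
  deriv_Qa k hk t ht h1 h2 := L.hasDerivAt_Qa hk ht h1 h2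

end IsFluidLimit

end

section

/-! ### Almost every realization is typical -/

section Typical

variable {N : ℕ} (b : Binning N) {μb μa : Measure unitInterval} [IsProbabilityMeasure μb]
  [IsProbabilityMeasure μa]

lemma labelLaw_real {G : Set Order} (hG : MeasurableSet G) :
    (labelLaw μb μa).real G =
      2⁻¹ * μb.real (Sum.inl ⁻¹' G) + 2⁻¹ * μa.real (Sum.inr ⁻¹' G) := by
  simp only [measureReal_def, labelLaw, Measure.add_apply, Measure.smul_apply,
    Measure.map_apply measurable_inl hG, Measure.map_apply measurable_inr hG, smul_eq_mul]
  rw [ENNReal.toReal_add (ENNReal.mul_ne_top (by simp) (measure_ne_top _ _))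
    (ENNReal.mul_ne_top (by simp) (measure_ne_top _ _)), ENNReal.toReal_mul, ENNReal.toReal_mul]
  simp

lemma measurableSet_idx_eq (k : ℕ) : MeasurableSet {x | b.idx x = k} :=
  b.measurable_idx (measurableSet_singleton k)

/-- The total rate `2` cancels the probability `1/2` of a bid. -/
lemma incr_inl_image {S : Set unitInterval} (hS : MeasurableSet S) (z : ℝ × Order) :
    incr μb μa (Sum.inl '' S) z = (Sum.inl '' S : Set Order).indicator 1 z.2 - μb.real S * z.1 := by
  rw [incr, labelLaw_real hS.inl_image, Set.preimage_image_eq _ Sum.inl_injective,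
    Set.preimage_inr_image_inl, measureReal_empty]
  ring

lemma incr_inr_image {S : Set unitInterval} (hS : MeasurableSet S) (z : ℝ × Order) :
    incr μb μa (Sum.inr '' S) z = (Sum.inr '' S : Set Order).indicator 1 z.2 - μa.real S * z.1 := by
  rw [incr, labelLaw_real hS.inr_image, Set.preimage_image_eq _ Sum.inr_injective,
    Set.preimage_inl_image_inr, measureReal_empty]
  ring

lemma incr_univ (z : ℝ × Order) : incr μb μa Set.univ z = 1 - 2 * z.1 := by
  simp [incr]

lemma sum_binProb (μ : Measure unitInterval) [IsProbabilityMeasure μ] :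
    ∑ k ∈ Finset.Icc 1 N, binProb b μ k = 1 := by
  simp only [binProb]
  rw [← measureReal_biUnion_finset (fun i _ j _ hij => Set.disjoint_left.2 fun x hx hx' =>
    hij (hx.symm.trans hx')) (fun k _ => measurableSet_idx_eq b k)]
  have : ⋃ k ∈ Finset.Icc 1 N, {x | b.idx x = k} = Set.univ := by
    ext x
    simp [b.one_le x, b.le_top x]
  rw [this, probReal_univ]

variable {Ω : Type*} [MeasurableSpace Ω] {P : Measure Ω} [IsProbabilityMeasure P]
  {gap : ℕ → Ω → ℝ} {label : ℕ → Ω → Order}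

omit [IsProbabilityMeasure P] in
lemma ae_gap_pos (hflow : IsOrderFlow P μb μa gap label) : ∀ᵐ ω ∂P, ∀ j, 0 < gap j ω := by
  rw [ae_all_iff]
  intro j
  have h1 : P.map (fun ω => (gap j ω, label j ω)) (Set.Iic 0 ×ˢ Set.univ) = 0 := by
    rw [hflow.law j, Measure.prod_prod, expMeasure_Iic_zero, zero_mul]
  rw [Measure.map_apply ((hflow.measurable_gap j).prodMk (hflow.measurable_label j))
    (measurableSet_Iic.prod MeasurableSet.univ)] at h1
  rw [ae_iff]
  convert! h1 using 2
  ext ω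
  simp

/-- The uniform law is used for each bin of bids and of asks, and for the set of all orders, where
it becomes the law of large numbers for the gaps. -/
lemma ae_sample (hflow : IsOrderFlow P μb μa gap label) :
    ∀ᵐ ω ∂P, Sample b (binProb b μb) (binProb b μa) (fun j => gap j ω) (fun j => label j ω) := by
  have h1 : ∀ᵐ ω ∂P, ∀ k : ℕ, _ :=
    ae_all_iff.2 fun k => ae_unifLaw b hflow (measurableSet_idx_eq b k).inl_image
  have h2 : ∀ᵐ ω ∂P, ∀ k : ℕ, _ :=
    ae_all_iff.2 fun k => ae_unifLaw b hflow (measurableSet_idx_eq b k).inr_image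
  filter_upwards [ae_gap_pos hflow, ae_unifLaw b hflow MeasurableSet.univ, h1, h2]
    with ω hpos huniv hb ha
  refine ⟨⟨hpos, fun C ε hε => ?_⟩, fun lo hi hlh hhi k => ?_, fun lo hi hlh hhi k => ?_,
    fun k => measureReal_nonneg, fun k => measureReal_nonneg⟩
  · filter_upwards [(huniv 0 (N + 1) (by omega) le_rfl).total C hε] with n hn m hm
    have := hn m hm
    simpa [incr_univ, Finset.sum_sub_distrib, Finset.mul_sum] using this
  · convert! hb k lo hi hlh hhi using 2 with j
    rw [incr_inl_image (measurableSet_idx_eq b k)]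
    congr 1
    rcases label j ω with p | q
    · by_cases h : b.idx p = k <;> simp [code, h]
    · simp [code]
  · convert! ha k lo hi hlh hhi using 2 with j
    rw [incr_inr_image (measurableSet_idx_eq b k)]
    congr 1
    rcases label j ω with p | q
    · simp [code]
    · by_cases h : b.idx q = k <;> simp [code, h]

end Typical

/-! ### Coupling of fluid limits -/

variable {N : ℕ} {b : Binning N} {pb pa : ℕ → ℝ} {gap : ℕ → ℝ} {o : ℕ → Order} {s s' : ℕ → Book}
  {φ φ' : ℕ → ℕ} {F F' : Path}

lemma bidQueue_eq_zero {t : Book} {k : ℕ} (hk : k ∉ Finset.Icc 1 N) : t.bidQueue b k = 0 := by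
  by_contra h
  rw [← Ne, Book.bidQueue_eq_cnt, cnt_ne_zero_iff] at h
  obtain ⟨x, -, rfl⟩ := h
  exact hk (Finset.mem_Icc.2 ⟨b.one_le x, b.le_top x⟩)

lemma askQueue_eq_zero {t : Book} {k : ℕ} (hk : k ∉ Finset.Icc 1 N) : t.askQueue b k = 0 := by
  by_contra h
  rw [← Ne, Book.askQueue_eq_cnt, cnt_ne_zero_iff] at h
  obtain ⟨x, -, rfl⟩ := h
  exact hk (Finset.mem_Icc.2 ⟨b.one_le x, b.le_top x⟩)

/-- Sum of the differences of the queues of two books. -/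
def queueDist (b : Binning N) (t t' : Book) : ℝ :=
  ∑ k ∈ Finset.Icc 1 N, (|((t.bidQueue b k).toNat : ℝ) - (t'.bidQueue b k).toNat| +
    |((t.askQueue b k).toNat : ℝ) - (t'.askQueue b k).toNat|)

/-- The `ℓ¹` bound of the chain; queues outside the bins `1, …, N` vanish and do not contribute.
Passing to positive and negative parts then preserves the bound for the queues themselves. -/
lemma Regular.abs_net_sub_le {t t' : Book} (ht : Regular b 0 (N + 1) t)
    (ht' : Regular b 0 (N + 1) t') (o : ℕ → Order) (m : ℕ) {k : ℕ} (hk : k ∈ Finset.Ioo 0 (N + 1)) :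
    (|net b (bookAfter b t o m) k - net b (bookAfter b t' o m) k| : ℤ) ≤ queueDist b t t' := by
  rw [ht.net_bookAfter le_rfl o m k hk, ht'.net_bookAfter le_rfl o m k hk]
  have h1 := abs_netChain_sub_le (lo := 0) (hi := N + 1) (M := N + 2) (by omega) (by omega)
    (net b t') (net b t) (fun i => code b (o i)) (fun i q hq => by
      obtain ⟨x, -, rfl⟩ := (code_eq_inr_iff b (o i) q).1 hq
      have := b.le_top x
      omega) m (k := k) (by have := (Finset.mem_Ioo.1 hk).2; omega)
  have h2 : ((∑ i ∈ Finset.range (N + 2), |net b t i - net b t' i| : ℤ) : ℝ) ≤ queueDist b t t' := by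
    rw [queueDist]
    push_cast
    rw [← Finset.sum_subset (s₁ := Finset.Icc 1 N)]
    · refine Finset.sum_le_sum fun i _ => ?_
      simp only [net]
      push_cast
      refine le_trans (le_of_eq (congrArg _ ?_)) (abs_sub _ _)
      ring
    · intro i hi
      have := Finset.mem_Icc.1 hi
      exact Finset.mem_range.2 (by omega)
    · intro i _ hi
      simp [net, bidQueue_eq_zero hi, askQueue_eq_zero hi]
  exact le_trans (by exact_mod_cast h1) h2

lemma abs_max_zero_sub_le (x y : ℤ) : |max x 0 - max y 0| ≤ |x - y| := by
  have := abs_max_sub_max_le_abs x y 0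
  simpa using this

lemma Regular.abs_bidQueue_sub_le {t t' : Book} (ht : Regular b 0 (N + 1) t)
    (ht' : Regular b 0 (N + 1) t') (o : ℕ → Order) (m : ℕ) {k : ℕ} (hk : k ∈ Finset.Ioo 0 (N + 1)) :
    |(((bookAfter b t o m).bidQueue b k).toNat : ℝ) - ((bookAfter b t' o m).bidQueue b k).toNat| ≤
      queueDist b t t' := by
  refine le_trans ?_ (ht.abs_net_sub_le ht' o m hk)
  have h1 := abs_max_zero_sub_le (net b (bookAfter b t o m) k) (net b (bookAfter b t' o m) k)
  rw [← (ht.after o m).toNat_bidQueue, ← (ht'.after o m).toNat_bidQueue] at h1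
  exact_mod_cast h1

lemma Regular.abs_askQueue_sub_le {t t' : Book} (ht : Regular b 0 (N + 1) t)
    (ht' : Regular b 0 (N + 1) t') (o : ℕ → Order) (m : ℕ) {k : ℕ} (hk : k ∈ Finset.Ioo 0 (N + 1)) :
    |(((bookAfter b t o m).askQueue b k).toNat : ℝ) - ((bookAfter b t' o m).askQueue b k).toNat| ≤
      queueDist b t t' := by
  refine le_trans ?_ (ht.abs_net_sub_le ht' o m hk)
  have h1 := abs_max_zero_sub_le (-net b (bookAfter b t o m) k) (-net b (bookAfter b t' o m) k)
  rw [← (ht.after o m).toNat_askQueue, ← (ht'.after o m).toNat_askQueue, neg_sub_neg,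
    abs_sub_comm (net b (bookAfter b t' o m) k)] at h1
  exact_mod_cast h1

lemma scaled_queueDist (h : Timing gap) (n : ℕ) (t t' : Book) :
    (n : ℝ)⁻¹ * queueDist b t t' = ∑ k ∈ Finset.Icc 1 N,
      (|((lobPath b t gap o).scale n).Qb k 0 - ((lobPath b t' gap o).scale n).Qb k 0| +
        |((lobPath b t gap o).scale n).Qa k 0 - ((lobPath b t' gap o).scale n).Qa k 0|) := by
  simp only [queueDist, Finset.mul_sum, Path.scale, lobPath, mul_zero, bookAt_zero h, ← mul_sub,
    abs_mul, abs_inv, Nat.abs_cast, mul_add]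

/-- Finite books driven by the same arrivals have fluid limits with the same queues if the queues
are the same initially. -/
lemma IsFluidLimit.queues_eq (L : IsFluidLimit b pb pa gap o s 0 (N + 1) φ F)
    (L' : IsFluidLimit b pb pa gap o s' 0 (N + 1) φ F')
    (hQ : ∀ k ∈ Finset.Icc 1 N, F.Qb k 0 = F'.Qb k 0 ∧ F.Qa k 0 = F'.Qa k 0) :
    ∀ k ∈ Finset.Icc 1 N, ∀ t ≥ 0, F.Qb k t = F'.Qb k t ∧ F.Qa k t = F'.Qa k t := by
  have hIoo : ∀ k ∈ Finset.Icc 1 N, k ∈ Finset.Ioo 0 (N + 1) := fun k hk => by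
    rw [Finset.mem_Icc] at hk; rw [Finset.mem_Ioo]; omega
  have h0 : Tendsto (fun n => ((φ n : ℕ) : ℝ)⁻¹ * queueDist b (s (φ n)) (s' (φ n))) atTop (𝓝 0) := by
    have h1 : ∑ k ∈ Finset.Icc 1 N, (|F.Qb k 0 - F'.Qb k 0| + |F.Qa k 0 - F'.Qa k 0|) = 0 :=
      Finset.sum_eq_zero fun k hk => by rw [(hQ k hk).1, (hQ k hk).2]; simp
    have h2 : ∀ k ∈ Finset.Icc 1 N, Tendsto (fun n =>
        |(scaledPath b s gap o (φ n)).Qb k 0 - (scaledPath b s' gap o (φ n)).Qb k 0| +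
        |(scaledPath b s gap o (φ n)).Qa k 0 - (scaledPath b s' gap o (φ n)).Qa k 0|) atTop
        (𝓝 (|F.Qb k 0 - F'.Qb k 0| + |F.Qa k 0 - F'.Qa k 0|)) := fun k hk =>
      ((((L.conv.Qb k (hIoo k hk)).tendsto le_rfl).sub
        ((L'.conv.Qb k (hIoo k hk)).tendsto le_rfl)).abs).add
      ((((L.conv.Qa k (hIoo k hk)).tendsto le_rfl).sub
        ((L'.conv.Qa k (hIoo k hk)).tendsto le_rfl)).abs)
    have h3 := tendsto_finsetSum _ h2
    rw [h1] at h3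
    exact h3.congr fun n =>
      (scaled_queueDist (o := o) L.sample.timing (φ n) (s (φ n)) (s' (φ n))).symm
  intro k hk t ht
  constructor
  · have h1 := (((L.conv.Qb k (hIoo k hk)).tendsto ht).sub
      ((L'.conv.Qb k (hIoo k hk)).tendsto ht)).abs
    refine sub_eq_zero.1 (abs_nonpos_iff.1 (le_of_tendsto_of_tendsto h1 h0 ?_))
    filter_upwards [L.tendsto_φ.eventually L.init, L'.tendsto_φ.eventually L'.init] with n hn hn'
    simp only [scaledPath, Path.scale, lobPath, bookAt, ← mul_sub, abs_mul, abs_inv, Nat.abs_cast]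
    exact mul_le_mul_of_nonneg_left (hn.regular.abs_bidQueue_sub_le hn'.regular _ _ (hIoo k hk))
      (by positivity)
  · have h1 := (((L.conv.Qa k (hIoo k hk)).tendsto ht).sub
      ((L'.conv.Qa k (hIoo k hk)).tendsto ht)).abs
    refine sub_eq_zero.1 (abs_nonpos_iff.1 (le_of_tendsto_of_tendsto h1 h0 ?_))
    filter_upwards [L.tendsto_φ.eventually L.init, L'.tendsto_φ.eventually L'.init] with n hn hn'
    simp only [scaledPath, Path.scale, lobPath, bookAt, ← mul_sub, abs_mul, abs_inv, Nat.abs_cast]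
    exact mul_le_mul_of_nonneg_left (hn.regular.abs_askQueue_sub_le hn'.regular _ _ (hIoo k hk))
      (by positivity)

/-! ### Finite initial states -/

lemma cnt_ne_top {f : unitInterval →₀ ℕ∞} (h : ∀ x, f x ≠ ⊤) (S : Set unitInterval) :
    cnt f S ≠ ⊤ := by
  classical
  refine WithTop.sum_ne_top.2 fun x _ => ?_
  dsimp only
  split_ifs
  · exact h x
  · exact ENat.zero_ne_top

/-- A fixed finite book meets the bound `n` once `n` exceeds its queues, so the constant sequence is
an admissible sequence of initial states. -/
lemma eventually_initialState {t : Book} (hf : t.IsFinite) (ha : t.Admissible b) :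
    ∀ᶠ n in atTop, InitialState b 0 (N + 1) n t := by
  have h1 : ∀ k, t.bidQueue b k ≠ ⊤ := fun k => by
    rw [Book.bidQueue_eq_cnt]; exact cnt_ne_top hf.1 _
  have h2 : ∀ k, t.askQueue b k ≠ ⊤ := fun k => by
    rw [Book.askQueue_eq_cnt]; exact cnt_ne_top hf.2 _
  have h3 : ∀ q : ℕ∞, q ≠ ⊤ → ∀ᶠ n : ℕ in atTop, q ≤ n := by
    intro q hq
    lift q to ℕ using hq
    filter_upwards [eventually_ge_atTop q] with n hn
    exact_mod_cast hn
  filter_upwards [(Filter.eventually_all_finset (Finset.Ioo 0 (N + 1))).2 fun k _ => h3 _ (h1 k),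
    (Filter.eventually_all_finset (Finset.Ioo 0 (N + 1))).2 fun k _ => h3 _ (h2 k)] with n g1 g2
  exact ⟨ha, Or.inl rfl, Or.inl rfl, g1, g2⟩

lemma IsFluidLimit.queues_zero_of_const {t : Book}
    (L : IsFluidLimit b pb pa gap o (fun _ => t) 0 (N + 1) φ F) :
    ∀ k ∈ Finset.Icc 1 N, F.Qb k 0 = 0 ∧ F.Qa k 0 = 0 := by
  intro k hk
  have hk' : k ∈ Finset.Ioo 0 (N + 1) := by
    rw [Finset.mem_Icc] at hk; rw [Finset.mem_Ioo]; omega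
  have h0 : ∀ c : ℝ, Tendsto (fun n => ((φ n : ℕ) : ℝ)⁻¹ * c) atTop (𝓝 0) := fun c => by
    simpa using ((tendsto_inv_atTop_nhds_zero_nat (𝕜 := ℝ)).comp L.tendsto_φ).mul_const c
  constructor
  · refine tendsto_nhds_unique ((L.conv.Qb k hk').tendsto le_rfl) ?_
    simp only [scaledPath, Path.scale, lobPath, mul_zero]
    exact h0 _
  · refine tendsto_nhds_unique ((L.conv.Qa k hk').tendsto le_rfl) ?_
    simp only [scaledPath, Path.scale, lobPath, mul_zero]
    exact h0 _

end

section

variable {N : ℕ} {b : Binning N} {pb pa : ℕ → ℝ} {gap : ℕ → ℝ} {o : ℕ → Order} {s : ℕ → Book}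
  {φ : ℕ → ℕ} {F : Path}

/-! ### Consequences of finitely many departures -/

section Departures

lemma sum_indicator_le_ncard {D : Set ℕ} (hD : D.Finite) (m : ℕ) :
    ∑ j ∈ Finset.range m, D.indicator 1 j ≤ D.ncard := by
  classical
  rw [Finset.sum_indicator_eq_sum_filter]
  simp only [Pi.one_apply, Finset.sum_const, smul_eq_mul, mul_one]
  rw [← Set.ncard_coe_finset]
  exact Set.ncard_le_ncard (fun j hj => (Finset.mem_filter.1 hj).2) hD

namespace IsFluidLimit

/-- Stated for general weights `x`, since it is needed both for whole bins and for part of a bin. -/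
lemma tendsto_sum_bidBin {lo hi : ℕ} (L : IsFluidLimit b pb pa gap o s lo hi φ F) {x : ℕ → ℝ}
    {p : ℝ} (hp : 0 ≤ p) (hU : UnifLaw lo hi (fun j => code b (o j)) fun j => x j - p * gap j)
    {k : ℕ} (hk : k ∈ Finset.Ico lo hi) {t : ℝ} (ht : 0 ≤ t) :
    Tendsto (fun n => (φ n : ℝ)⁻¹ * ∑ j ∈ Finset.range (arrivals gap (φ n * t)),
      if (bookAfter b (s (φ n)) o j).bidBin b = k then x j else 0) atTop (𝓝 (p * F.Tβ k t)) := by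
  have h1 := ((L.conv.Tβ k hk).tendsto ht).const_mul p
  refine tendsto_of_tendsto_of_dist h1 ?_
  rw [Metric.tendsto_atTop']
  intro ε hε
  have h2 := eventually_visits_book L.sample.timing L.hi_le hp hU t (ε := ε / 2) (by positivity)
  obtain ⟨n₀, hn₀⟩ := eventually_atTop.1 ((L.tendsto_φ.eventually (h2.and L.init)).and
    (L.tendsto_φ.eventually_ge_atTop 1))
  refine ⟨n₀, fun n hn => ?_⟩
  obtain ⟨⟨g1, g2⟩, g3⟩ := hn₀ n hn.le
  have g4 := (g1 _ g2 t ⟨ht, le_rfl⟩ k).2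
  have g5 : (0 : ℝ) < φ n := by exact_mod_cast g3
  rw [dist_zero_right, Real.norm_of_nonneg dist_nonneg, Real.dist_eq, abs_sub_comm]
  simp only [scaledPath, Path.scale]
  rw [mul_left_comm, ← mul_sub, abs_mul, abs_of_pos (inv_pos.2 g5), inv_mul_lt_iff₀ g5]
  nlinarith

lemma tendsto_sum_askBin {lo hi : ℕ} (L : IsFluidLimit b pb pa gap o s lo hi φ F) {x : ℕ → ℝ}
    {p : ℝ} (hp : 0 ≤ p) (hU : UnifLaw lo hi (fun j => code b (o j)) fun j => x j - p * gap j)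
    {k : ℕ} (hk : k ∈ Finset.Ioc lo hi) {t : ℝ} (ht : 0 ≤ t) :
    Tendsto (fun n => (φ n : ℝ)⁻¹ * ∑ j ∈ Finset.range (arrivals gap (φ n * t)),
      if (bookAfter b (s (φ n)) o j).askBin b = k then x j else 0) atTop (𝓝 (p * F.Tα k t)) := by
  have h1 := ((L.conv.Tα k hk).tendsto ht).const_mul p
  refine tendsto_of_tendsto_of_dist h1 ?_
  rw [Metric.tendsto_atTop']
  intro ε hε
  have h2 := eventually_visits_book L.sample.timing L.hi_le hp hU t (ε := ε / 2) (by positivity)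
  obtain ⟨n₀, hn₀⟩ := eventually_atTop.1 ((L.tendsto_φ.eventually (h2.and L.init)).and
    (L.tendsto_φ.eventually_ge_atTop 1))
  refine ⟨n₀, fun n hn => ?_⟩
  obtain ⟨⟨g1, g2⟩, g3⟩ := hn₀ n hn.le
  have g4 := (g1 _ g2 t ⟨ht, le_rfl⟩ k).1
  have g5 : (0 : ℝ) < φ n := by exact_mod_cast g3
  rw [dist_zero_right, Real.norm_of_nonneg dist_nonneg, Real.dist_eq, abs_sub_comm]
  simp only [scaledPath, Path.scale]
  rw [mul_left_comm, ← mul_sub, abs_mul, abs_of_pos (inv_pos.2 g5), inv_mul_lt_iff₀ g5]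
  nlinarith

lemma tendsto_inv_mul_const {lo hi : ℕ} (L : IsFluidLimit b pb pa gap o s lo hi φ F) (c : ℝ) :
    Tendsto (fun n => ((φ n : ℕ) : ℝ)⁻¹ * c) atTop (𝓝 0) := by
  simpa using ((tendsto_inv_atTop_nhds_zero_nat (𝕜 := ℝ)).comp L.tendsto_φ).mul_const c

variable {t₀ : Book} (L : IsFluidLimit b pb pa gap o (fun _ => t₀) 0 (N + 1) φ F)
include L

/-- An ask in bin `1` is compatible with every bid. So each such arrival while the highest bid is in
`k` is one of the finitely many departures, whereas their scaled number tends to `pa 1` times the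
local time. -/
lemma Tβ_eq_zero_of_departures {x : unitInterval}
    (hD : {j | (bookAfter b t₀ o j).BidDeparts b (o j) x}.Finite) (hpa : 0 < pa 1) {k : ℕ}
    (hk : k ∈ Finset.Icc 1 N) (hkx : ∀ y, b.idx y = k → y ≤ x) : ∀ t ≥ 0, F.Tβ k t = 0 := by
  intro t ht
  have hk1 := Finset.mem_Icc.1 hk
  have hk2 : k ∈ Finset.Ico 0 (N + 1) := Finset.mem_Ico.2 (by omega)
  refine le_antisymm ?_ (L.Tβ_nonneg hk2 ht)
  have h1 := L.tendsto_sum_bidBin hpa.le (L.sample.ask_law 0 (N + 1) (by omega) le_rfl 1) hk2 ht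
  have h2 := le_of_tendsto_of_tendsto' h1 (L.tendsto_inv_mul_const
    ({j | (bookAfter b t₀ o j).BidDeparts b (o j) x}.ncard : ℝ)) fun n => ?_
  · nlinarith
  · refine mul_le_mul_of_nonneg_left ?_ (by positivity)
    refine le_trans ?_ (Nat.cast_le.2 (sum_indicator_le_ncard hD (arrivals gap (φ n * t))))
    push_cast
    refine Finset.sum_le_sum fun j _ => ?_
    by_cases h3 : (bookAfter b t₀ o j).bidBin b = k
    · by_cases h4 : code b (o j) = Sum.inr 1
      · rw [if_pos h3, if_pos h4, Set.indicator_of_mem]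
        · simp
        · obtain ⟨q, hq, hq1⟩ := (code_eq_inr_iff b _ _).1 h4
          refine ⟨q, hq, by omega, hkx _ ?_⟩
          rw [← Book.bidBin_eq b (Book.bids_nonempty b (by omega)), h3]
      · simp [h3, h4]
    · simp [h3]

lemma Tα_eq_zero_of_departures {x : unitInterval}
    (hD : {j | (bookAfter b t₀ o j).AskDeparts b (o j) x}.Finite) (hpb : 0 < pb N) {k : ℕ}
    (hk : k ∈ Finset.Icc 1 N) (hkx : ∀ y, b.idx y = k → x ≤ y) : ∀ t ≥ 0, F.Tα k t = 0 := by
  intro t ht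
  have hk1 := Finset.mem_Icc.1 hk
  have hk2 : k ∈ Finset.Ioc 0 (N + 1) := Finset.mem_Ioc.2 (by omega)
  refine le_antisymm ?_ (L.Tα_nonneg hk2 ht)
  have h1 := L.tendsto_sum_askBin hpb.le (L.sample.bid_law 0 (N + 1) (by omega) le_rfl N) hk2 ht
  have h2 := le_of_tendsto_of_tendsto' h1 (L.tendsto_inv_mul_const
    ({j | (bookAfter b t₀ o j).AskDeparts b (o j) x}.ncard : ℝ)) fun n => ?_
  · nlinarith
  · refine mul_le_mul_of_nonneg_left ?_ (by positivity)
    refine le_trans ?_ (Nat.cast_le.2 (sum_indicator_le_ncard hD (arrivals gap (φ n * t))))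
    push_cast
    refine Finset.sum_le_sum fun j _ => ?_
    by_cases h3 : (bookAfter b t₀ o j).askBin b = k
    · by_cases h4 : code b (o j) = Sum.inl N
      · rw [if_pos h3, if_pos h4, Set.indicator_of_mem]
        · simp
        · obtain ⟨q, hq, hq1⟩ := (code_eq_inl_iff b _ _).1 h4
          refine ⟨q, hq, by omega, hkx _ ?_⟩
          rw [← Book.askBin_eq b (Book.asks_nonempty b (by omega)), h3]
      · simp [h3, h4]
    · simp [h3]

end IsFluidLimit

/-- Bids that join the book in a set of low prices stay there, up to the departures. -/
lemma sum_joining_bids_le (t₀ : Book) (o : ℕ → Order) {x : unitInterval} {M : ℕ}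
    {S : Set unitInterval} (hSM : ∀ y ∈ S, b.idx y = M) (hSx : ∀ y ∈ S, y ≤ x) (m : ℕ) :
    ((∑ j ∈ Finset.range m, if M < (bookAfter b t₀ o j).askBin b then
        (Sum.inl '' S : Set Order).indicator 1 (o j) else 0 : ℕ) : ℕ∞) ≤
      cnt (bookAfter b t₀ o m).bids S +
        (∑ j ∈ Finset.range m,
          {j | (bookAfter b t₀ o j).BidDeparts b (o j) x}.indicator 1 j : ℕ) := by
  classical
  induction m with
  | zero => simp
  | succ m ih =>
    rw [Finset.sum_range_succ, Finset.sum_range_succ, bookAfter]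
    push_cast at ih ⊢
    rcases hom : o m with p | q
    · rw [Book.cnt_bids_step_inl]
      refine le_trans (add_le_add_left ih _) ?_
      by_cases h1 : M < (bookAfter b t₀ o m).askBin b ∧ p ∈ S
      · have h2 := hSM p h1.2
        rw [if_pos h1.1, if_pos ⟨h1.2, h2 ▸ h1.1⟩, Set.indicator_of_mem (Set.mem_image_of_mem _ h1.2)]
        rw [add_right_comm, ← add_assoc]
        simp
      · have h3 : ((if M < (bookAfter b t₀ o m).askBin b then
            (Sum.inl '' S : Set Order).indicator 1 (Sum.inl p) else 0 : ℕ) : ℕ∞) = 0 := by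
          by_cases h4 : M < (bookAfter b t₀ o m).askBin b
          · have h5 : p ∉ S := fun h => h1 ⟨h4, h⟩
            simp [h5]
          · simp [h4]
        push_cast at h3
        rw [h3, add_zero]
        exact add_le_add le_self_add le_self_add
    · have h1 := Book.cnt_bids_step_inr (b := b) (bookAfter b t₀ o m) q S
      have h0 : (Sum.inl '' S : Set Order).indicator (1 : Order → ℕ) (Sum.inr q) = 0 := by simp
      rw [h0, Nat.cast_zero, ite_self, add_zero]
      rw [← h1] at ih
      refine ih.trans ?_
      rw [add_assoc, add_comm (ite _ _ _), ← add_assoc, ← add_assoc]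
      refine add_le_add le_rfl ?_
      -- A bid lost from `S` has price at most `x`, so the loss is recorded by the departure
      -- indicator.
      split_ifs with h2
      · rw [Set.indicator_of_mem]
        · simp
        · exact ⟨q, hom, h2.1, hSx _ h2.2⟩
      · exact zero_le

/-- Asks that join the book in a set of high prices stay there, up to the departures. -/
lemma sum_joining_asks_le (t₀ : Book) (o : ℕ → Order) {x : unitInterval} {M : ℕ}
    {S : Set unitInterval} (hSM : ∀ y ∈ S, b.idx y = M) (hSx : ∀ y ∈ S, x ≤ y) (m : ℕ) :
    ((∑ j ∈ Finset.range m, if (bookAfter b t₀ o j).bidBin b < M then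
        (Sum.inr '' S : Set Order).indicator 1 (o j) else 0 : ℕ) : ℕ∞) ≤
      cnt (bookAfter b t₀ o m).asks S +
        (∑ j ∈ Finset.range m,
          {j | (bookAfter b t₀ o j).AskDeparts b (o j) x}.indicator 1 j : ℕ) := by
  classical
  induction m with
  | zero => simp
  | succ m ih =>
    rw [Finset.sum_range_succ, Finset.sum_range_succ, bookAfter]
    push_cast at ih ⊢
    rcases hom : o m with p | q
    · have h1 := Book.cnt_asks_step_inl (b := b) (bookAfter b t₀ o m) p S
      have h0 : (Sum.inr '' S : Set Order).indicator (1 : Order → ℕ) (Sum.inl p) = 0 := by simp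
      rw [h0, Nat.cast_zero, ite_self, add_zero]
      rw [← h1] at ih
      refine ih.trans ?_
      rw [add_assoc, add_comm (ite _ _ _), ← add_assoc, ← add_assoc]
      refine add_le_add le_rfl ?_
      split_ifs with h2
      · rw [Set.indicator_of_mem]
        · simp
        · exact ⟨p, hom, h2.1, hSx _ h2.2⟩
      · exact zero_le
    · rw [Book.cnt_asks_step_inr]
      refine le_trans (add_le_add_left ih _) ?_
      by_cases h1 : (bookAfter b t₀ o m).bidBin b < M ∧ q ∈ S
      · have h2 := hSM q h1.2
        rw [if_pos h1.1, if_pos ⟨h1.2, h2 ▸ h1.1⟩, Set.indicator_of_mem (Set.mem_image_of_mem _ h1.2)]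
        rw [add_right_comm, ← add_assoc]
        simp
      · have h3 : ((if (bookAfter b t₀ o m).bidBin b < M then
            (Sum.inr '' S : Set Order).indicator 1 (Sum.inr q) else 0 : ℕ) : ℕ∞) = 0 := by
          by_cases h4 : (bookAfter b t₀ o m).bidBin b < M
          · have h5 : q ∉ S := fun h => h1 ⟨h4, h⟩
            simp [h5]
          · simp [h4]
        push_cast at h3
        rw [h3, add_zero]
        exact add_le_add le_self_add le_self_add

namespace IsFluidLimit

variable {t₀ : Book} (L : IsFluidLimit b pb pa gap o (fun _ => t₀) 0 (N + 1) φ F)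
include L

lemma regular_const : Regular b 0 (N + 1) t₀ := by
  obtain ⟨n, hn⟩ := L.init.exists
  exact hn.regular

/-- Bids at prices in `S` join while the lowest ask is above `M`, at rate `r`. All but finitely many
of them stay, and a finite number vanishes under scaling. -/
lemma mul_sum_Tα_le {x : unitInterval}
    (hD : {j | (bookAfter b t₀ o j).BidDeparts b (o j) x}.Finite) {M : ℕ}
    (hM : M ∈ Finset.Icc 1 N) {S : Set unitInterval} (hSM : ∀ y ∈ S, b.idx y = M)
    (hSx : ∀ y ∈ S, y ≤ x) {r : ℝ} (hr : 0 ≤ r)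
    (hU : UnifLaw 0 (N + 1) (fun j => code b (o j))
      fun j => (Sum.inl '' S : Set Order).indicator 1 (o j) - r * gap j) :
    ∀ t ≥ 0, r * ∑ a ∈ Finset.Ioc M (N + 1), F.Tα a t ≤ F.Qb M t := by
  intro t ht
  have hM1 := Finset.mem_Icc.1 hM
  have hM2 : M ∈ Finset.Ioo 0 (N + 1) := Finset.mem_Ioo.2 (by omega)
  have h1 := tendsto_finsetSum (Finset.Ioc M (N + 1)) fun a ha =>
    L.tendsto_sum_askBin hr hU (k := a) (Finset.mem_Ioc.2 ⟨by have := (Finset.mem_Ioc.1 ha).1; omega, (Finset.mem_Ioc.1 ha).2⟩) ht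
  have h2 := ((L.conv.Qb M hM2).tendsto ht).add (L.tendsto_inv_mul_const
    ({j | (bookAfter b t₀ o j).BidDeparts b (o j) x}.ncard : ℝ))
  rw [add_zero] at h2
  rw [Finset.mul_sum]
  refine le_of_tendsto_of_tendsto' h1 h2 fun n => ?_
  simp only [scaledPath, Path.scale, lobPath, bookAt]
  rw [← Finset.mul_sum, ← mul_add]
  refine mul_le_mul_of_nonneg_left ?_ (by positivity)
  set m := arrivals gap (φ n * t)
  have hR := L.regular_const.after o m
  have h3 : cnt (bookAfter b t₀ o m).bids S ≤ (bookAfter b t₀ o m).bidQueue b M := by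
    rw [Book.bidQueue_eq_cnt]
    exact cnt_mono _ hSM
  have h4 := (sum_joining_bids_le t₀ o hSM hSx m).trans (add_le_add h3
    (Nat.cast_le.2 (sum_indicator_le_ncard hD m)))
  rw [← ENat.natCast_toNat (hR.bids_ne_top M hM2)] at h4
  have h5 : ((∑ j ∈ Finset.range m, if M < (bookAfter b t₀ o j).askBin b then
      (Sum.inl '' S : Set Order).indicator 1 (o j) else 0 : ℕ) : ℝ) ≤
      ((bookAfter b t₀ o m).bidQueue b M).toNat +
      {j | (bookAfter b t₀ o j).BidDeparts b (o j) x}.ncard := by exact_mod_cast h4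
  refine le_trans (le_of_eq ?_) h5
  rw [Finset.sum_comm]
  push_cast
  refine Finset.sum_congr rfl fun j _ => ?_
  have h6 := (L.regular_const.after o j).askBin_le_hi
  rw [Finset.sum_ite_eq]
  have h7 : (Sum.inl '' S : Set Order).indicator (1 : Order → ℝ) (o j) =
      (((Sum.inl '' S : Set Order).indicator (1 : Order → ℕ) (o j) : ℕ) : ℝ) := by
    by_cases h8 : o j ∈ (Sum.inl '' S : Set Order)
    · simp [Set.indicator_of_mem h8]
    · simp [Set.indicator_of_notMem h8]
  rw [h7]
  simp only [Finset.mem_Ioc, h6, and_true]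

lemma mul_sum_Tβ_le {x : unitInterval}
    (hD : {j | (bookAfter b t₀ o j).AskDeparts b (o j) x}.Finite) {M : ℕ}
    (hM : M ∈ Finset.Icc 1 N) {S : Set unitInterval} (hSM : ∀ y ∈ S, b.idx y = M)
    (hSx : ∀ y ∈ S, x ≤ y) {r : ℝ} (hr : 0 ≤ r)
    (hU : UnifLaw 0 (N + 1) (fun j => code b (o j))
      fun j => (Sum.inr '' S : Set Order).indicator 1 (o j) - r * gap j) :
    ∀ t ≥ 0, r * ∑ a ∈ Finset.Ico 0 M, F.Tβ a t ≤ F.Qa M t := by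
  intro t ht
  have hM1 := Finset.mem_Icc.1 hM
  have hM2 : M ∈ Finset.Ioo 0 (N + 1) := Finset.mem_Ioo.2 (by omega)
  have h1 := tendsto_finsetSum (Finset.Ico 0 M) fun a ha =>
    L.tendsto_sum_bidBin hr hU (k := a)
      (Finset.mem_Ico.2 ⟨by omega, by have := (Finset.mem_Ico.1 ha).2; omega⟩) ht
  have h2 := ((L.conv.Qa M hM2).tendsto ht).add (L.tendsto_inv_mul_const
    ({j | (bookAfter b t₀ o j).AskDeparts b (o j) x}.ncard : ℝ))
  rw [add_zero] at h2
  rw [Finset.mul_sum]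
  refine le_of_tendsto_of_tendsto' h1 h2 fun n => ?_
  simp only [scaledPath, Path.scale, lobPath, bookAt]
  rw [← Finset.mul_sum, ← mul_add]
  refine mul_le_mul_of_nonneg_left ?_ (by positivity)
  set m := arrivals gap (φ n * t)
  have hR := L.regular_const.after o m
  have h3 : cnt (bookAfter b t₀ o m).asks S ≤ (bookAfter b t₀ o m).askQueue b M := by
    rw [Book.askQueue_eq_cnt]
    exact cnt_mono _ hSM
  have h4 := (sum_joining_asks_le t₀ o hSM hSx m).trans (add_le_add h3
    (Nat.cast_le.2 (sum_indicator_le_ncard hD m)))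
  rw [← ENat.natCast_toNat (hR.asks_ne_top M hM2)] at h4
  have h5 : ((∑ j ∈ Finset.range m, if (bookAfter b t₀ o j).bidBin b < M then
      (Sum.inr '' S : Set Order).indicator 1 (o j) else 0 : ℕ) : ℝ) ≤
      ((bookAfter b t₀ o m).askQueue b M).toNat +
      {j | (bookAfter b t₀ o j).AskDeparts b (o j) x}.ncard := by exact_mod_cast h4
  refine le_trans (le_of_eq ?_) h5
  rw [Finset.sum_comm]
  push_cast
  refine Finset.sum_congr rfl fun j _ => ?_
  rw [Finset.sum_ite_eq]
  have h7 : (Sum.inr '' S : Set Order).indicator (1 : Order → ℝ) (o j) =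
      (((Sum.inr '' S : Set Order).indicator (1 : Order → ℕ) (o j) : ℕ) : ℝ) := by
    by_cases h8 : o j ∈ (Sum.inr '' S : Set Order)
    · simp [Set.indicator_of_mem h8]
    · simp [Set.indicator_of_notMem h8]
  rw [h7]
  simp only [Finset.mem_Ico, Nat.zero_le, true_and]

end IsFluidLimit

end Departures

end

section

variable {N : ℕ} {b : Binning N} {pb pa : ℕ → ℝ} {gap : ℕ → ℝ} {o : ℕ → Order} {s : ℕ → Book}
  {φ : ℕ → ℕ} {F : Path}

/-! ### Positive queues and the local times beyond them -/

/-- The function is constant on positive times, and the bound by `t` forces the constant to vanish;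
no derivative at `0` is needed. -/
lemma eq_zero_of_hasDerivAt_zero {f : ℝ → ℝ} (h : ∀ t > 0, HasDerivAt f 0 t)
    (hf : ∀ t ≥ 0, f t ∈ Set.Icc 0 t) : ∀ t ≥ 0, f t = 0 := by
  intro t ht
  rcases ht.eq_or_lt with rfl | ht
  · simpa using hf 0 le_rfl
  refine le_antisymm (le_of_forall_pos_le_add fun u hu => ?_) (hf t ht.le).1
  rw [zero_add]
  rcases le_total t u with htu | htu
  · exact (hf t ht.le).2.trans htu
  · rw [constant_of_has_deriv_right_zero (a := u) (b := t)
      (fun x hx => (h x (hu.trans_le hx.1)).continuousAt.continuousWithinAt)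
      (fun x hx => (h x (hu.trans_le hx.1)).hasDerivWithinAt) t ⟨htu, le_rfl⟩]
    exact (hf u hu.le).2

namespace IsFluidLimit

section

variable {lo hi : ℕ} (L : IsFluidLimit b pb pa gap o s lo hi φ F)
include L

lemma Tβ_mem_Icc {k : ℕ} (hk : k ∈ Finset.Ico lo hi) : ∀ t ≥ 0, F.Tβ k t ∈ Set.Icc 0 t :=
  fun t ht => by simpa [L.Tβ_zero hk] using L.Tβ_sub hk le_rfl ht

lemma Tα_mem_Icc {k : ℕ} (hk : k ∈ Finset.Ioc lo hi) : ∀ t ≥ 0, F.Tα k t ∈ Set.Icc 0 t :=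
  fun t ht => by simpa [L.Tα_zero hk] using L.Tα_sub hk le_rfl ht

lemma comp {ψ : ℕ → ℕ} (hψ : StrictMono ψ) :
    IsFluidLimit b pb pa gap o s lo hi (φ ∘ ψ) F :=
  ⟨L.toSystem, L.strictMono.comp hψ,
    fun k hk => (L.conv.B k hk).comp hψ.tendsto_atTop,
    fun k hk => (L.conv.A k hk).comp hψ.tendsto_atTop,
    fun k hk => (L.conv.Qb k hk).comp hψ.tendsto_atTop,
    fun k hk => (L.conv.Qa k hk).comp hψ.tendsto_atTop,
    fun k hk => (L.conv.Tβ k hk).comp hψ.tendsto_atTop,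
    fun k hk => (L.conv.Tα k hk).comp hψ.tendsto_atTop⟩

end

variable (L : IsFluidLimit b pb pa gap o s 0 (N + 1) φ F)
  (hQ : ∀ k ∈ Finset.Icc 1 N, F.Qb k 0 = 0 ∧ F.Qa k 0 = 0)
include L

/-- A positive queue in bin `1` would give the local time of bin `0` derivative zero at `s₀`, but
its derivative is one. The interval reaches `2 * s₀` only to make `s₀` interior. -/
lemma Tβ_zero_eq_zero {s₀ : ℝ} (hs : 0 < s₀) (hpos : ∀ u ∈ Set.Icc 0 (2 * s₀), F.Tβ 0 u = u)
    (hN : 1 ≤ N) : F.Qb 1 s₀ = 0 := by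
  have h1 : 1 ∈ Finset.Ioo 0 (N + 1) := Finset.mem_Ioo.2 (by omega)
  by_contra hne
  have h2 := L.deriv_Tβ_of_bids (k := 0) (Finset.mem_Ico.2 (by omega)) h1 zero_lt_one hs
    (lt_of_le_of_ne (L.Qb_nonneg h1 hs.le) (Ne.symm hne))
  have h3 : HasDerivAt (F.Tβ 0) 1 s₀ := by
    refine (hasDerivAt_id s₀).congr_of_eventuallyEq ?_
    filter_upwards [Icc_mem_nhds hs (show s₀ < 2 * s₀ by linarith)] with u hu
    exact hpos u hu
  exact zero_ne_one (h2.unique h3)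

lemma Tα_top_eq_zero {s₀ : ℝ} (hs : 0 < s₀)
    (hpos : ∀ u ∈ Set.Icc 0 (2 * s₀), F.Tα (N + 1) u = u) (hN : 1 ≤ N) : F.Qa N s₀ = 0 := by
  have h1 : N ∈ Finset.Ioo 0 (N + 1) := Finset.mem_Ioo.2 (by omega)
  by_contra hne
  have h2 := L.deriv_Tα_of_asks (k := N + 1) (Finset.mem_Ioc.2 (by omega)) h1 (by omega) hs
    (lt_of_le_of_ne (L.Qa_nonneg h1 hs.le) (Ne.symm hne))
  have h3 : HasDerivAt (F.Tα (N + 1)) 1 s₀ := by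
    refine (hasDerivAt_id s₀).congr_of_eventuallyEq ?_
    filter_upwards [Icc_mem_nhds hs (show s₀ < 2 * s₀ by linarith)] with u hu
    exact hpos u hu
  exact zero_ne_one (h2.unique h3)

include hQ

/-- If the highest bid avoids the bins `1, …, M - 1` and a positive fraction of the bids arriving
into bin `M` below the lowest ask are never served, then the queue of bids in bin `M` is
positive. -/
lemma Qb_pos (hpb : ∀ k ∈ Finset.Icc 1 N, 0 < pb k) (hpa : ∀ k ∈ Finset.Icc 1 N, 0 < pa k)
    (hpb1 : ∑ k ∈ Finset.Icc 1 N, pb k = 1) (hpa1 : ∑ k ∈ Finset.Icc 1 N, pa k = 1) {M : ℕ}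
    (hM : 1 ≤ M) (hMN : M < N) (hτ : ∀ k, 1 ≤ k → k < M → ∀ t ≥ 0, F.Tβ k t = 0) {r : ℝ}
    (hr : 0 < r) (hrM : ∀ t ≥ 0, r * ∑ a ∈ Finset.Ioc M (N + 1), F.Tα a t ≤ F.Qb M t) :
    ∀ t > 0, 0 < F.Qb M t := by
  intro t ht
  by_contra hneg
  have hα0 : ∀ a ∈ Finset.Ioc 0 (N + 1), ∀ u ≥ 0, 0 ≤ F.Tα a u := fun a ha u hu =>
    L.Tα_nonneg ha hu
  have hsub : ∀ k, Finset.Ioc k (N + 1) ⊆ Finset.Ioc 0 (N + 1) := fun k =>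
    Finset.Ioc_subset_Ioc_left (Nat.zero_le k)
  -- If the queue in `M` is empty at `t`, the lowest ask has spent no time above `M` up to `t`.
  have h1 : ∑ a ∈ Finset.Ioc M (N + 1), F.Tα a t ≤ 0 := by
    have := hrM t ht.le
    by_contra h
    nlinarith [mul_pos hr (not_le.1 h)]
  have h2 : ∀ u ∈ Set.Icc 0 t, ∀ a, M < a → a ≤ N + 1 → F.Tα a u = 0 := by
    intro u hu a ha haN
    have ha0 : a ∈ Finset.Ioc 0 (N + 1) := Finset.mem_Ioc.2 (by omega)
    have h3 := Finset.single_le_sum (fun a ha => hα0 a (hsub M ha) t ht.le)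
      (Finset.mem_Ioc.2 ⟨ha, haN⟩)
    have h4 := (L.Tα_sub ha0 hu.1 hu.2).1
    have h5 := hα0 a ha0 u hu.1
    linarith
  -- Without asks above `M`, bins from `M` upwards gain no bids, so the highest bid cannot have
  -- spent time there either, since asks would have removed bids at a positive rate. Lower bins are
  -- excluded by hypothesis.
  have h3 : ∀ u ∈ Set.Icc 0 t, ∀ k, 1 ≤ k → k ≤ N → F.Tβ k u = 0 := by
    intro u hu k hk hkN
    rcases lt_or_ge k M with hkM | hkM
    · exact hτ k hk hkM u hu.1
    have hk1 : k ∈ Finset.Ioo 0 (N + 1) := Finset.mem_Ioo.2 (by omega)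
    have hk2 : k ∈ Finset.Ico 0 (N + 1) := Finset.mem_Ico.2 (by omega)
    have h4 := L.balance_Qb hk1 u hu.1
    have h5 := L.Qb_nonneg hk1 hu.1
    have h6 : ∑ a ∈ Finset.Ioc k (N + 1), F.Tα a u = 0 := Finset.sum_eq_zero fun a ha =>
      h2 u hu a (by have := (Finset.mem_Ioc.1 ha).1; omega) (Finset.mem_Ioc.1 ha).2
    have h7 : 0 < ∑ q ∈ Finset.Icc 1 k, pa q := Finset.sum_pos
      (fun q hq => hpa q (Finset.Icc_subset_Icc_right hkN hq)) ⟨1, Finset.mem_Icc.2 ⟨le_rfl, hk⟩⟩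
    rw [h6, (hQ k (Finset.mem_Icc.2 ⟨hk, hkN⟩)).1] at h4
    refine le_antisymm ?_ (L.Tβ_nonneg hk2 hu.1)
    by_contra h
    nlinarith [mul_pos (not_le.1 h) h7]
  have h4 : ∀ u ∈ Set.Icc 0 t, F.Tβ 0 u = u := by
    intro u hu
    have h5 := L.sum_Tβ hu.1
    rwa [Finset.sum_eq_single 0 (fun k hk hk0 => h3 u hu k (by omega)
      (by have := (Finset.mem_Ico.1 hk).2; omega)) (by simp)] at h5
  have hs : 0 < t / 2 := by positivity
  have hst : t / 2 ∈ Set.Icc 0 t := ⟨hs.le, by linarith⟩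
  -- The highest bid is thus always in bin `0`, so bin `1` holds no bids. Its balance then forces
  -- the lowest ask to be in bin `1` all the time.
  have h5 := L.Tβ_zero_eq_zero hs (by rwa [mul_div_cancel₀ t two_ne_zero]) (by omega)
  have h1N : 1 ∈ Finset.Icc 1 N := Finset.mem_Icc.2 (by omega)
  have h1N' : 1 ∈ Finset.Ioo 0 (N + 1) := Finset.mem_Ioo.2 (by omega)
  have h6 := L.balance_Qb h1N' _ hs.le
  rw [h5, (hQ 1 h1N).1, h3 _ hst 1 le_rfl (by omega), zero_mul, sub_zero, zero_add, eq_comm,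
    mul_eq_zero, or_iff_right (hpb 1 h1N).ne'] at h6
  have h7 := L.sum_Tα hs.le
  rw [← Finset.sum_Ioc_consecutive _ (Nat.zero_le 1) (by omega), h6, add_zero,
    Finset.sum_eq_single 1 (fun k hk hk1 => absurd (Finset.mem_Ioc.1 hk) (by omega))
      (by simp)] at h7
  have h8 := L.balance_Qa h1N' _ hs.le
  have h9 := L.Qa_nonneg h1N' hs.le
  rw [hpb1, h7, (hQ 1 h1N).2, Finset.sum_eq_single 0
    (fun k hk hk1 => absurd (Finset.mem_Ico.1 hk) (by omega)) (by simp), h4 _ hst] at h8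
  -- Asks in bin `1` would then arrive at rate `pa 1 < 1` and depart at the total bid rate `1`,
  -- which makes their queue negative. The strict inequality uses `N ≥ 2`, a consequence of `M < N`.
  have h10 : pa 1 < ∑ k ∈ Finset.Icc 1 N, pa k := Finset.single_lt_sum (j := N) (by omega) h1N
    (Finset.mem_Icc.2 (by omega)) (hpa N (Finset.mem_Icc.2 (by omega)))
    fun k hk _ => (hpa k hk).le
  rw [hpa1] at h10
  nlinarith

/-- If the lowest ask avoids the bins `M + 1, …, N` and a positive fraction of the asks arriving
into bin `M` above the highest bid are never served, then the queue of asks in bin `M` is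
positive. -/
lemma Qa_pos (hpb : ∀ k ∈ Finset.Icc 1 N, 0 < pb k) (hpa : ∀ k ∈ Finset.Icc 1 N, 0 < pa k)
    (hpb1 : ∑ k ∈ Finset.Icc 1 N, pb k = 1) (hpa1 : ∑ k ∈ Finset.Icc 1 N, pa k = 1) {M : ℕ}
    (hM : 1 < M) (hMN : M ≤ N) (hτ : ∀ k, M < k → k ≤ N → ∀ t ≥ 0, F.Tα k t = 0) {r : ℝ}
    (hr : 0 < r) (hrM : ∀ t ≥ 0, r * ∑ a ∈ Finset.Ico 0 M, F.Tβ a t ≤ F.Qa M t) :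
    ∀ t > 0, 0 < F.Qa M t := by
  intro t ht
  by_contra hneg
  have hβ0 : ∀ a ∈ Finset.Ico 0 (N + 1), ∀ u ≥ 0, 0 ≤ F.Tβ a u := fun a ha u hu =>
    L.Tβ_nonneg ha hu
  have hsub : Finset.Ico 0 M ⊆ Finset.Ico 0 (N + 1) :=
    Finset.Ico_subset_Ico_right (by omega)
  have h1 : ∑ a ∈ Finset.Ico 0 M, F.Tβ a t ≤ 0 := by
    have := hrM t ht.le
    by_contra h
    nlinarith [mul_pos hr (not_le.1 h)]
  have h2 : ∀ u ∈ Set.Icc 0 t, ∀ a < M, F.Tβ a u = 0 := by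
    intro u hu a ha
    have ha0 : a ∈ Finset.Ico 0 (N + 1) := Finset.mem_Ico.2 (by omega)
    have h3 := Finset.single_le_sum (fun a ha => hβ0 a (hsub ha) t ht.le)
      (Finset.mem_Ico.2 ⟨Nat.zero_le a, ha⟩)
    have h4 := (L.Tβ_sub ha0 hu.1 hu.2).1
    have h5 := hβ0 a ha0 u hu.1
    linarith
  have h3 : ∀ u ∈ Set.Icc 0 t, ∀ k, 1 ≤ k → k ≤ N → F.Tα k u = 0 := by
    intro u hu k hk hkN
    rcases lt_or_ge M k with hkM | hkM
    · exact hτ k hkM hkN u hu.1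
    have hk1 : k ∈ Finset.Ioo 0 (N + 1) := Finset.mem_Ioo.2 (by omega)
    have hk2 : k ∈ Finset.Ioc 0 (N + 1) := Finset.mem_Ioc.2 (by omega)
    have h4 := L.balance_Qa hk1 u hu.1
    have h5 := L.Qa_nonneg hk1 hu.1
    have h6 : ∑ a ∈ Finset.Ico 0 k, F.Tβ a u = 0 := Finset.sum_eq_zero fun a ha =>
      h2 u hu a (by have := (Finset.mem_Ico.1 ha).2; omega)
    have h7 : 0 < ∑ q ∈ Finset.Icc k N, pb q := Finset.sum_pos
      (fun q hq => hpb q (Finset.Icc_subset_Icc_left hk hq)) ⟨N, Finset.mem_Icc.2 ⟨hkN, le_rfl⟩⟩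
    rw [h6, (hQ k (Finset.mem_Icc.2 ⟨hk, hkN⟩)).2] at h4
    refine le_antisymm ?_ (L.Tα_nonneg hk2 hu.1)
    by_contra h
    nlinarith [mul_pos (not_le.1 h) h7]
  have h4 : ∀ u ∈ Set.Icc 0 t, F.Tα (N + 1) u = u := by
    intro u hu
    have h5 := L.sum_Tα hu.1
    rwa [Finset.sum_eq_single (N + 1) (fun k hk hk0 => h3 u hu k (Finset.mem_Ioc.1 hk).1
      (by have := (Finset.mem_Ioc.1 hk).2; omega)) (by simp)] at h5
  have hs : 0 < t / 2 := by positivity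
  have hst : t / 2 ∈ Set.Icc 0 t := ⟨hs.le, by linarith⟩
  have h5 := L.Tα_top_eq_zero hs (by rwa [mul_div_cancel₀ t two_ne_zero]) (by omega)
  have h1N : N ∈ Finset.Icc 1 N := Finset.mem_Icc.2 (by omega)
  have h1N' : N ∈ Finset.Ioo 0 (N + 1) := Finset.mem_Ioo.2 (by omega)
  have h6 := L.balance_Qa h1N' _ hs.le
  rw [h5, (hQ N h1N).2, h3 _ hst N (by omega) le_rfl, zero_mul, sub_zero, zero_add, eq_comm,
    mul_eq_zero, or_iff_right (hpa N h1N).ne'] at h6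
  have h7 := L.sum_Tβ hs.le
  rw [Finset.sum_Ico_succ_top (Nat.zero_le N), h6, zero_add] at h7
  have h8 := L.balance_Qb h1N' _ hs.le
  have h9 := L.Qb_nonneg h1N' hs.le
  rw [hpa1, h7, (hQ N h1N).1, Finset.sum_eq_single (N + 1)
    (fun k hk hk1 => absurd (Finset.mem_Ioc.1 hk) (by omega)) (by simp), h4 _ hst] at h8
  have h10 : pb N < ∑ k ∈ Finset.Icc 1 N, pb k := Finset.single_lt_sum (j := 1) (by omega) h1N
    (Finset.mem_Icc.2 (by omega)) (hpb 1 (Finset.mem_Icc.2 (by omega)))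
    fun k hk _ => (hpb k hk).le
  rw [hpb1] at h10
  nlinarith

/-- The queues are those of the fluid limit of any given finite book. -/
lemma exists_const {t₀ : Book} (hf : t₀.IsFinite) (ha : t₀.Admissible b) :
    ∃ φ' F', IsFluidLimit b pb pa gap o (fun _ => t₀) 0 (N + 1) φ' F' ∧
      ∀ k ∈ Finset.Icc 1 N, ∀ t ≥ 0, F'.Qb k t = F.Qb k t ∧ F'.Qa k t = F.Qa k t := by
  have hS : System b pb pa gap o (fun _ => t₀) 0 (N + 1) :=
    ⟨L.sample, L.lo_lt_hi, L.hi_le, eventually_initialState hf ha⟩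
  obtain ⟨ψ, hψ, F', hF', -⟩ := hS.exists_isFluidLimit L.strictMono
  have L' : IsFluidLimit b pb pa gap o (fun _ => t₀) 0 (N + 1) (φ ∘ ψ) F' :=
    ⟨hS, L.strictMono.comp hψ, hF'⟩
  -- The comparison needs a common subsequence, so the given limit is also restricted to `φ ∘ ψ`.
  refine ⟨φ ∘ ψ, F', L', L'.queues_eq (L.comp hψ) fun k hk => ?_⟩
  have h1 := L'.queues_zero_of_const k hk
  have h2 := hQ k hk
  exact ⟨h1.1.trans h2.1.symm, h1.2.trans h2.2.symm⟩

end IsFluidLimit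

/-! ### Thresholds -/

section Threshold

variable (b) (μ : Measure unitInterval) [IsProbabilityMeasure μ] {S : Set unitInterval} {M : ℕ}

/-- The supremum need not be attained. Bin `M` lies strictly below it, so a sequence in `S` that
tends to the supremum exhausts the bin, and some element must already leave positive mass below it.
-/
lemma exists_mem_of_lt_idx_sSup (hM : M < b.idx (sSup S)) (hp : 0 < binProb b μ M) :
    ∃ x ∈ S, 0 < μ.real {y | b.idx y = M ∧ y ≤ x} := by
  have hlt : ∀ y, b.idx y = M → y < sSup S := fun y hy => by
    by_contra h
    have := b.mono (not_lt.1 h)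
    omega
  have hS : S.Nonempty := by
    rw [Set.nonempty_iff_ne_empty]
    -- For empty `S` the supremum is the lowest price; then bin `M` would be empty, contrary to its
    -- positive mass.
    rintro rfl
    have h1 : {y | b.idx y = M} = ∅ := Set.eq_empty_of_forall_notMem fun y hy => by
      have := hlt y hy
      rw [sSup_empty] at this
      exact not_lt_bot this
    rw [binProb, h1, measureReal_empty] at hp
    exact lt_irrefl _ hp
  obtain ⟨u, -, hu, huS⟩ := exists_seq_tendsto_sSup hS (OrderTop.bddAbove S)
  by_contra! hcon
  have h1 : ∀ n, μ {y | b.idx y = M ∧ y ≤ u n} = 0 := fun n =>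
    (measureReal_eq_zero_iff).1 (le_antisymm (hcon (u n) (huS n)) measureReal_nonneg)
  have h2 : μ {y | b.idx y = M} = 0 := by
    refine measure_mono_null (fun y hy => ?_) (measure_iUnion_null h1)
    obtain ⟨n, hn⟩ := (hu.eventually_const_lt (hlt y hy)).exists
    exact Set.mem_iUnion.2 ⟨n, hy, hn.le⟩
  rw [binProb, measureReal_def, h2] at hp
  simp at hp

lemma exists_mem_of_idx_sInf_lt (hM : b.idx (sInf S) < M) (hp : 0 < binProb b μ M) :
    ∃ x ∈ S, 0 < μ.real {y | b.idx y = M ∧ x ≤ y} := by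
  have hlt : ∀ y, b.idx y = M → sInf S < y := fun y hy => by
    by_contra h
    have := b.mono (not_lt.1 h)
    omega
  have hS : S.Nonempty := by
    rw [Set.nonempty_iff_ne_empty]
    rintro rfl
    have h1 : {y | b.idx y = M} = ∅ := Set.eq_empty_of_forall_notMem fun y hy => by
      have := hlt y hy
      rw [sInf_empty] at this
      exact not_top_lt this
    rw [binProb, h1, measureReal_empty] at hp
    exact lt_irrefl _ hp
  obtain ⟨u, -, hu, huS⟩ := exists_seq_tendsto_sInf hS (OrderBot.bddBelow S)
  by_contra! hcon
  have h1 : ∀ n, μ {y | b.idx y = M ∧ u n ≤ y} = 0 := fun n =>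
    (measureReal_eq_zero_iff).1 (le_antisymm (hcon (u n) (huS n)) measureReal_nonneg)
  have h2 : μ {y | b.idx y = M} = 0 := by
    refine measure_mono_null (fun y hy => ?_) (measure_iUnion_null h1)
    obtain ⟨n, hn⟩ := (hu.eventually_lt_const (hlt y hy)).exists
    exact Set.mem_iUnion.2 ⟨n, hy, hn.le⟩
  rw [binProb, measureReal_def, h2] at hp
  simp at hp

end Threshold

/-! ### Positive queues beyond the thresholds, for a fixed finite book. -/

section Main

variable {Ω : Type*} [MeasurableSpace Ω] {P : Measure Ω} [IsProbabilityMeasure P]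
  {μb μa : Measure unitInterval} [IsProbabilityMeasure μb] [IsProbabilityMeasure μa]
  {g : ℕ → Ω → ℝ} {label : ℕ → Ω → Order}

/-- The price `x` is chosen before the realization, so the uniform law for the part of bin `M` below
`x` costs a single null set, valid for all subsequences and limits. -/
lemma ae_Qb_pos (hflow : IsOrderFlow P μb μa g label)
    (hp : ∀ k ∈ Finset.Icc 1 N, 0 < binProb b μb k ∧ 0 < binProb b μa k) {t₀ : Book} {M : ℕ}
    (hM : 1 ≤ M) (hMκ : M < b.idx (kappaB P b label t₀)) :
    ∀ᵐ ω ∂P, ∀ φ F, IsFluidLimit b (binProb b μb) (binProb b μa) (fun j => g j ω)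
      (fun j => label j ω) (fun _ => t₀) 0 (N + 1) φ F → ∀ t > 0, 0 < F.Qb M t := by
  have hMN : M < N := hMκ.trans_le (b.le_top _)
  have hMm : M ∈ Finset.Icc 1 N := Finset.mem_Icc.2 (by omega)
  obtain ⟨x, hx, hr⟩ := exists_mem_of_lt_idx_sSup b μb hMκ (hp M hMm).1
  set S := {y | b.idx y = M ∧ y ≤ x} with hS
  have hSm : MeasurableSet S := (measurableSet_idx_eq b M).inter measurableSet_Iic
  -- A price of bin `M` that is at most `x` shows that all lower bins lie below `x` entirely, so
  -- finiteness of departures applies to them.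
  obtain ⟨y₀, hy₀, hy₀x⟩ : S.Nonempty := by
    rw [Set.nonempty_iff_ne_empty]
    intro h
    rw [h, measureReal_empty] at hr
    exact lt_irrefl _ hr
  filter_upwards [hx, ae_unifLaw b hflow hSm.inl_image] with ω hD hU φ F L
  have hU' := hU 0 (N + 1) (by omega) le_rfl
  simp only [incr_inl_image hSm] at hU'
  refine L.Qb_pos L.queues_zero_of_const (fun k hk => (hp k hk).1) (fun k hk => (hp k hk).2)
    (sum_binProb b μb) (sum_binProb b μa) hM hMN (fun k hk hkM => ?_) hr
    (L.mul_sum_Tα_le hD hMm (fun y hy => hy.1) (fun y hy => hy.2) hr.le hU')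
  refine L.Tβ_eq_zero_of_departures hD (hp 1 (Finset.mem_Icc.2 (by omega))).2
    (Finset.mem_Icc.2 (by omega)) fun y hy => le_trans ?_ hy₀x
  by_contra h
  have := b.mono (not_le.1 h).le
  omega

lemma ae_Qa_pos (hflow : IsOrderFlow P μb μa g label)
    (hp : ∀ k ∈ Finset.Icc 1 N, 0 < binProb b μb k ∧ 0 < binProb b μa k) {t₀ : Book} {M : ℕ}
    (hM : M ≤ N) (hMκ : b.idx (kappaA P b label t₀) < M) :
    ∀ᵐ ω ∂P, ∀ φ F, IsFluidLimit b (binProb b μb) (binProb b μa) (fun j => g j ω)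
      (fun j => label j ω) (fun _ => t₀) 0 (N + 1) φ F → ∀ t > 0, 0 < F.Qa M t := by
  have hMN : 1 < M := (b.one_le _).trans_lt hMκ
  have hMm : M ∈ Finset.Icc 1 N := Finset.mem_Icc.2 (by omega)
  obtain ⟨x, hx, hr⟩ := exists_mem_of_idx_sInf_lt b μa hMκ (hp M hMm).2
  set S := {y | b.idx y = M ∧ x ≤ y} with hS
  have hSm : MeasurableSet S := (measurableSet_idx_eq b M).inter measurableSet_Ici
  obtain ⟨y₀, hy₀, hy₀x⟩ : S.Nonempty := by
    rw [Set.nonempty_iff_ne_empty]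
    intro h
    rw [h, measureReal_empty] at hr
    exact lt_irrefl _ hr
  filter_upwards [hx, ae_unifLaw b hflow hSm.inr_image] with ω hD hU φ F L
  have hU' := hU 0 (N + 1) (by omega) le_rfl
  simp only [incr_inr_image hSm] at hU'
  refine L.Qa_pos L.queues_zero_of_const (fun k hk => (hp k hk).1) (fun k hk => (hp k hk).2)
    (sum_binProb b μb) (sum_binProb b μa) hMN hM (fun k hk hkM => ?_) hr
    (L.mul_sum_Tβ_le hD hMm (fun y hy => hy.1) (fun y hy => hy.2) hr.le hU')
  refine L.Tα_eq_zero_of_departures hD (hp N (Finset.mem_Icc.2 (by omega))).1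
    (Finset.mem_Icc.2 (by omega)) fun y hy => hy₀x.trans ?_
  by_contra h
  have := b.mono (not_le.1 h).le
  omega

end Main

/-- The local times outside of the bins between two positive queues vanish. -/
lemma IsFluidLimit.sum_localTimes (L : IsFluidLimit b pb pa gap o s 0 (N + 1) φ F) {K K' : ℕ}
    (hK : 1 ≤ K) (hKN : K ≤ N) (hK1 : 1 ≤ K') (hK' : K' ≤ N)
    (hb : 2 ≤ K → ∀ t > 0, 0 < F.Qb (K - 1) t) (ha : K' < N → ∀ t > 0, 0 < F.Qa (K' + 1) t) :
    ∀ t ≥ 0, ∑ k ∈ Finset.Icc (K - 1) K', F.Tβ k t = t ∧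
      ∑ k ∈ Finset.Icc K (K' + 1), F.Tα k t = t := by
  intro t ht
  constructor
  · refine Eq.trans (Finset.sum_subset (fun k hk => ?_) fun k hk hk' => ?_) (L.sum_Tβ ht)
    · have := Finset.mem_Icc.1 hk
      exact Finset.mem_Ico.2 (by omega)
    · have h1 := Finset.mem_Ico.1 hk
      rw [Finset.mem_Icc, not_and_or, not_le, not_le] at hk'
      -- Bids in `K - 1` exclude the bins below; asks in `K' + 1` exclude that bin and those above.
      -- If such a bin does not exist, nothing has to be excluded on that side.
      refine eq_zero_of_hasDerivAt_zero (fun u hu => ?_) (L.Tβ_mem_Icc hk) t ht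
      rcases hk' with h2 | h2
      · exact L.deriv_Tβ_of_bids hk (Finset.mem_Ioo.2 (by omega)) h2 hu (hb (by omega) u hu)
      · exact L.deriv_Tβ_of_asks hk (Finset.mem_Ioo.2 (by omega)) h2 hu (ha (by omega) u hu)
  · refine Eq.trans (Finset.sum_subset (fun k hk => ?_) fun k hk hk' => ?_) (L.sum_Tα ht)
    · have := Finset.mem_Icc.1 hk
      exact Finset.mem_Ioc.2 (by omega)
    · have h1 := Finset.mem_Ioc.1 hk
      rw [Finset.mem_Icc, not_and_or, not_le, not_le] at hk'
      refine eq_zero_of_hasDerivAt_zero (fun u hu => ?_) (L.Tα_mem_Icc hk) t ht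
      rcases hk' with h2 | h2
      · exact L.deriv_Tα_of_bids hk (Finset.mem_Ioo.2 (by omega)) (by omega) hu
          (hb (by omega) u hu)
      · exact L.deriv_Tα_of_asks hk (Finset.mem_Ioo.2 (by omega)) h2 hu (ha (by omega) u hu)

end

end

end LOB

theorem mainTheorem6 {Ω : Type*} [MeasurableSpace Ω] (P : Measure Ω) [IsProbabilityMeasure P]
    (N : ℕ) (b : LOB.Binning N)
    (μb μa : Measure unitInterval) [IsProbabilityMeasure μb] [IsProbabilityMeasure μa]
    (gap : ℕ → Ω → ℝ) (label : ℕ → Ω → LOB.Order)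
    (hflow : LOB.IsOrderFlow P μb μa gap label) :
    -- almost surely: subsequential convergence, and the equations for every fluid limit
    (∀ᵐ ω ∂P, ∀ lo hi : ℕ, lo < hi → hi ≤ N + 1 →
      ∀ s : ℕ → LOB.Book, (∀ᶠ n in atTop, LOB.InitialState b lo hi n (s n)) →
      ∀ X : ℕ → LOB.Path,
        (∀ n, X n = (LOB.lobPath b (s n) (fun j => gap j ω) (fun j => label j ω)).scale n) →
        (∀ φ : ℕ → ℕ, StrictMono φ → ∃ ψ : ℕ → ℕ, StrictMono ψ ∧ ∃ F : LOB.Path,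
          LOB.PathUOC N lo hi (fun n => X (φ (ψ n))) F ∧ LOB.PathLipschitz N lo hi F) ∧
        (∀ φ : ℕ → ℕ, StrictMono φ → ∀ F : LOB.Path,
          LOB.PathUOC N lo hi (fun n => X (φ n)) F →
          LOB.FluidEquations N lo hi (LOB.binProb b μb) (LOB.binProb b μa) F)) ∧
    -- finite books: location of the local times in terms of the thresholds, if the fluid limit
    -- starts from the empty state and every bin receives orders of each type
    ((∀ k ∈ Finset.Icc 1 N, 0 < LOB.binProb b μb k ∧ 0 < LOB.binProb b μa k) →
      ∀ s₀ : LOB.Book, s₀.IsFinite → s₀.Admissible b →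
      ∀ᵐ ω ∂P, ∀ s : ℕ → LOB.Book, (∀ᶠ n in atTop, LOB.InitialState b 0 (N + 1) n (s n)) →
      ∀ φ : ℕ → ℕ, StrictMono φ → ∀ F : LOB.Path,
        LOB.PathUOC N 0 (N + 1) (fun n =>
          (LOB.lobPath b (s (φ n)) (fun j => gap j ω) (fun j => label j ω)).scale (φ n)) F →
        (∀ k ∈ Finset.Icc 1 N, F.Qb k 0 = 0 ∧ F.Qa k 0 = 0) →
        ∀ t ≥ 0,
          ∑ k ∈ Finset.Icc (b.idx (LOB.kappaB P b label s₀) - 1)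
              (b.idx (LOB.kappaA P b label s₀)), F.Tβ k t = t ∧
          ∑ k ∈ Finset.Icc (b.idx (LOB.kappaB P b label s₀))
              (b.idx (LOB.kappaA P b label s₀) + 1), F.Tα k t = t) := by
  constructor
  · filter_upwards [LOB.ae_sample b hflow] with ω hω lo hi hlh hhi s hs X hX
    obtain rfl : X = LOB.scaledPath b s (fun j => gap j ω) (fun j => label j ω) := funext hX
    have hS : LOB.System b (LOB.binProb b μb) (LOB.binProb b μa) (fun j => gap j ω)
      (fun j => label j ω) s lo hi := ⟨hω, hlh, hhi, hs⟩
    refine ⟨fun φ hφ => hS.exists_isFluidLimit hφ, fun φ hφ F hF => ?_⟩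
    exact LOB.IsFluidLimit.fluidEquations ⟨hS, hφ, hF⟩
  · intro hp s₀ hf ha
    set K := b.idx (LOB.kappaB P b label s₀) with hK
    set K' := b.idx (LOB.kappaA P b label s₀) with hK'
    have hK1 : 1 ≤ K := b.one_le _
    have hKN : K ≤ N := b.le_top _
    have hK1' : 1 ≤ K' := b.one_le _
    have hKN' : K' ≤ N := b.le_top _
    filter_upwards [LOB.ae_sample b hflow,
      eventually_imp_distrib_left.2 fun h : 2 ≤ K =>
        LOB.ae_Qb_pos hflow hp (show 1 ≤ K - 1 by omega) (show K - 1 < K by omega),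
      eventually_imp_distrib_left.2 fun h : K' < N =>
        LOB.ae_Qa_pos hflow hp (show K' + 1 ≤ N by omega) (show K' < K' + 1 by omega)]
      with ω hω h1 h2 s hs φ hφ F hF hQ
    have L : LOB.IsFluidLimit b (LOB.binProb b μb) (LOB.binProb b μa) (fun j => gap j ω)
      (fun j => label j ω) s 0 (N + 1) φ F := ⟨⟨hω, by omega, le_rfl, hs⟩, hφ, hF⟩
    -- The thresholds concern the book started from `s₀`. Only positivity of queues is transferred
    -- from its fluid limit; the local times are then located for `F` itself.
    obtain ⟨φ', F', L', hF'⟩ := L.exists_const hQ hf ha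
    refine L.sum_localTimes hK1 hKN hK1' hKN' (fun h t ht => ?_) fun h t ht => ?_
    · rw [← (hF' _ (Finset.mem_Icc.2 (by omega)) t ht.le).1]
      exact h1 h φ' F' L' t ht
    · rw [← (hF' _ (Finset.mem_Icc.2 (by omega)) t ht.le).2]
      exact h2 h φ' F' L' t ht
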